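/- All sizes are in bits and $\lg=\log_2$. **Parameters.** Let $T,Z,\gamma,\lambda,v,H,\beta,R,n$ be natural numbers with $n\ge 1$ and $\gamma>0$. For integers $b\ge 1$, $k\ge 0$ put $$\mathrm{hash}_b=\max(\lceil 2H\lg b\rceil+\gamma,\ \lambda),\qquad \mathrm{nodesize}_{b,k}=(k+1)(2T+\gamma+1)+k(\mathrm{hash}_b+v),$$ and $\mathrm{nodesize}_b=\mathrm{nodesize}_{b,b}$. **vORAM.** The vORAM is a complete binary tree of buckets with levels $0,\dots,T$, each bucket holding up to $Z$ bits of block data, together with a local stash. A block has an identifier $1\|r$ with $r$ uniform in $\{0,1\}^{2T+\gamma}$; its first $T+1$ bits determine a root-to-leaf path, and the bits of the block lie in the buckets of this path and in the stash. $\mathsf{evict}(id)$ moves the content of all buckets on the path of $id$ into the stash, merging partial blocks with equal identifiers. $\mathsf{writeback}(id)$ fills the buckets on this path from the leaf to the root, greedily, with (possibly split) blocks of the stash whose own paths contain the bucket; the order in which eligible blocks are taken is given by an arbitrary fixed rule. If two paths have been evicted and are both written back, buckets that they share are distributed again in the second writeback, without loss of data. **HIRB.** A HIRB of height $H$ with parameter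 $\beta$ is a uniquely represented search tree on label hashes. Each label $x$ has a uniformly random hash of $\mathrm{hash}_\beta$ bits and a random height from the geometric distribution with probability $(\beta-1)/\beta$ truncated to $\{0,\dots,H\}$; all of these and all identifiers are independent. For $0\le \ell\le H$ the stored hashes of height $>\ell$ cut the hash space into intervals, which are the nodes at height $\ell$; a node contains the hashes of height exactly $\ell$ in its interval. A node with $k$ items is stored as one vORAM block of length $\mathrm{nodesize}_{\beta,k}$. Initially the $H+1$ empty nodes are inserted into an empty vORAM, each by evicting a random path, putting the node in the stash under a new random identifier, and writing the path back. An insert, remove or update/lookup operation for a label with hash $h$ descends from height $H$ to height $0$. At each height it evicts the path of the node on the search path of $h$ and a second path: that of the node on the right of $h$ if $h$ is stored with a greater height, and a uniformly random path otherwise. It puts the accessed nodes (after splitting or merging them as the operation requires) into the stash under new random identifiers, and writes back both paths. **Theorem.** Suppose that $$T\ge \lg(4n+\lg n+\gamma),\qquad \beta=\max\{b\ge 1 : Z\ge 20\cdot \mathrm{nodesize}_b\},\qquad R\ge \gamma\cdot\mathrm{nodesize}_\beta,$$ that $\beta\ge 2$, and that $\log_\beta n\le H\le\lceil \lg n\rceil$.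 Then for every finite sequence of HIRB operations (fixed independently of the random choices) on the initially empty HIRB after which at most $n$ labels are present, the probability that, after the last operation, the stash contains more than $R$ bits, or two distinct HIRB nodes have the same vORAM identifier, or two distinct labels that are present have the same hash, is at most $$30\cdot(0.883)^\gamma .$$ -/

import Mathlib

open scoped Finset

/-! ### Parameters and block lengths (all sizes are in bits) -/

/-- Number of bits of a label hash when the HIRB has height `H` and expected branching factor `b`:
`max (2 H lg b + γ, lam)`, rounded up to an integer. -/
noncomputable def hashLength (H γ lam b : ℕ) : ℕ :=
  max (⌈2 * (H : ℝ) * Real.logb 2 (b : ℝ)⌉₊ + γ) lam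

/-- Length of a HIRB node that holds `k` items: `k + 1` vORAM identifiers of `2T + γ + 1` bits each,
`k` label hashes and `k` value slots of `v` bits each, for a HIRB with expected branching
factor `b`. -/
noncomputable def nodeSize (T H γ lam v b k : ℕ) : ℕ :=
  (k + 1) * (2 * T + γ + 1) + k * (hashLength H γ lam b + v)

/-- The parameters of a vORAM+HIRB. -/
structure VHParams where
  /-- height of the vORAM tree, whose levels are `0, …, T` -/
  T : ℕ
  /-- size of a vORAM bucket -/
  Z : ℕ
  /-- collision parameter -/
  γ : ℕ
  /-- security parameter -/
  lam : ℕ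
  /-- size of a value slot -/
  v : ℕ
  /-- height of the HIRB tree, whose levels are `0, …, H` -/
  H : ℕ
  /-- expected branching factor of the HIRB tree -/
  β : ℕ

/-- Length of a HIRB node with `k` items, for the parameters `p`. -/
noncomputable def VHParams.nodeSize (p : VHParams) (k : ℕ) : ℕ :=
  _root_.nodeSize p.T p.H p.γ p.lam p.v p.β k

/-! ### The vORAM -/

/-- A vORAM identifier, a bit string (of length `2T + γ + 1` and with first bit `1`). -/
abbrev BlockId := List Bool

/-- A bucket of the vORAM tree is addressed by a bit string: a bucket at level `t` by `t + 1` bits,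
the first of which is `1`. -/
abbrev BucketAddr := List Bool

/-- The identifier `1 ‖ r` made from the random bits `r`. -/
def idOfBits {m : ℕ} (r : Fin m → Bool) : BlockId := true :: List.ofFn r

/-- The bucket at level `t` on the path from the root to the leaf that is given by `i`. -/
def loc (i : BlockId) (t : ℕ) : BucketAddr := i.take (t + 1)

/-- A collection of (partial) blocks: for each identifier, how many bits of the block with this
identifier are in it. -/
abbrev Blocks := BlockId →₀ ℕ

/-- Total number of bits in a collection of partial blocks. -/
def Blocks.size (f : Blocks) : ℕ := f.sum fun _ l => l

/-- State of the vORAM: the partial blocks in each bucket and those in the stash. -/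
structure VORAM where
  bucket : BucketAddr → Blocks
  stash : Blocks

/-- The addresses of the buckets on the path of `i`. -/
def pathOf (T : ℕ) (i : BlockId) : Finset BucketAddr := (Finset.range (T + 1)).image (loc i)

/-- Empty all buckets on the path of `i`; their partial blocks are merged into the stash. -/
noncomputable def VORAM.evict (T : ℕ) (m : VORAM) (i : BlockId) : VORAM where
  bucket a := if a ∈ pathOf T i then 0 else m.bucket a
  stash := m.stash + ∑ t ∈ Finset.range (T + 1), m.bucket (loc i t)

/-- Move `l` bits of block `j` from the stash to bucket `a`. -/
noncomputable def VORAM.move (m : VORAM) (a : BucketAddr) (j : BlockId) (l : ℕ) : VORAM where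
  bucket := Function.update m.bucket a (m.bucket a + Finsupp.single j l)
  stash := m.stash - Finsupp.single j l

/-- Add a block with identifier `j` and length `l` to the stash. -/
noncomputable def VORAM.putStash (m : VORAM) (j : BlockId) (l : ℕ) : VORAM where
  bucket := m.bucket
  stash := m.stash + Finsupp.single j l

/-- Remove the block with identifier `j` from the stash. -/
noncomputable def VORAM.takeStash (m : VORAM) (j : BlockId) : VORAM where
  bucket := m.bucket
  stash := m.stash.erase j

/-- A rule for the arbitrary choice of the next block in a writeback: from the state, the bucket that
is being filled, and the nonempty set `W` of candidates, it selects an element of `W`. -/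
abbrev SelectionRule :=
  (m : VORAM) → (a : BucketAddr) → (W : Finset BlockId) → W.Nonempty → {j : BlockId // j ∈ W}

/-- Fill bucket `a` from the stash: as long as there is a candidate in `W` and the bucket is not full,
select a candidate and move the largest part of it that fits. (If only a part of the candidate fits,
then the bucket is full and the loop ends.) -/
noncomputable def fillBucket (sel : SelectionRule) (Z : ℕ) (a : BucketAddr)
    (m : VORAM) (W : Finset BlockId) : VORAM :=
  if h : W.Nonempty ∧ (m.bucket a).size < Z then
    fillBucket sel Z a
      (m.move a (sel m a W h.1) (min (m.stash (sel m a W h.1)) (Z - (m.bucket a).size)))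
      (W.erase (sel m a W h.1))
  else m
termination_by #W
decreasing_by exact Finset.card_erase_lt_of_mem (sel m a W h.1).2

/-- Rewrite the buckets on the path of `i` from the leaf to the root, opportunistically storing the
partial blocks of the stash that may reside there. When the path has just been evicted, the initial
`evict` does nothing. It matters only if two paths have been evicted and the other one has already
been rewritten: then the content of the buckets that the two paths share is not lost, but is
distributed again. -/
noncomputable def VORAM.writeback (sel : SelectionRule) (T Z : ℕ) (m : VORAM) (i : BlockId) : VORAM :=
  (List.range (T + 1)).reverse.foldl
    (fun m t => fillBucket sel Z (loc i t) m (m.stash.support.filter fun j => loc j t = loc i t))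
    (m.evict T i)

/-! ### The HIRB tree

The shape of a HIRB is determined by the hashes it stores and their heights. A node at height `l`
is the gap between two consecutive stored hashes of height greater than `l`; it is named by its height
and the stored hash that bounds the gap on the left (`⊥` for the leftmost node at that height), and its
items are the hashes of height exactly `l` inside the gap. Values do not influence the shape, and each
of them occupies a slot of the same size in its node. -/

/-- A label hash. -/
abbrev HashVal (p : VHParams) := Fin (2 ^ hashLength p.H p.γ p.lam p.β)

/-- The stored hashes with their heights; `none` if a hash is not stored. -/
abbrev Hirb (p : VHParams) := HashVal p → Option ℕ

/-- Name of a HIRB node: its height and its left boundary. -/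
abbrev HNode (p : VHParams) := ℕ × WithBot (HashVal p)

section Tree
variable {p : VHParams}

/-- The stored hashes of height greater than `l`; they separate the nodes at height `l`. -/
noncomputable def separators (D : Hirb p) (l : ℕ) : Finset (HashVal p) :=
  Finset.univ.filter fun g => ∃ j ∈ D g, l < j

/-- The node at height `l` on the search path of `h` (the one to the left of `h` if `h` is itself a
separator). -/
noncomputable def searchNode (D : Hirb p) (l : ℕ) (h : HashVal p) : HNode p :=
  (l, ((separators D l).filter (· < h)).max)

/-- The hashes stored in node `ν`. -/
noncomputable def nodeItems (D : Hirb p) (ν : HNode p) : Finset (HashVal p) :=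
  Finset.univ.filter fun g => D g = some ν.1 ∧ searchNode D ν.1 g = ν

/-- `ν` is a node of the HIRB. At each height `l ≤ H` there are the leftmost node, and one node to the
right of each separator. -/
def IsHNode (D : Hirb p) (ν : HNode p) : Prop :=
  ν.1 ≤ p.H ∧ (ν.2 = ⊥ ∨ ∃ g ∈ separators D ν.1, ν.2 = (g : WithBot (HashVal p)))

/-- Length of the vORAM block that stores node `ν`. -/
noncomputable def blockSize (D : Hirb p) (ν : HNode p) : ℕ := p.nodeSize #(nodeItems D ν)

end Tree

/-! ### Operations -/

/-- HIRB operations: insert the item with a given label (or replace its value), remove it, or look up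
and update its value. -/
inductive HOp (L : Type*) where
  | insert (x : L)
  | remove (x : L)
  | update (x : L)

/-- The label of an operation. -/
def HOp.label {L : Type*} : HOp L → L
  | .insert x => x
  | .remove x => x
  | .update x => x

/-- The labels that are present after an operation. -/
def HOp.applyLabels {L : Type*} [DecidableEq L] (S : Finset L) : HOp L → Finset L
  | .insert x => Insert.insert x S
  | .remove x => S.erase x
  | .update _ => S

/-- The labels that are present after a sequence of operations on an initially empty dictionary. -/
def labelsAfter {L : Type*} [DecidableEq L] (ops : List (HOp L)) : Finset L :=
  ops.foldl HOp.applyLabels ∅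

/-- All random choices: the hash function (a random oracle), for each label the coins for its height
(a random function), and the random bits of the identifiers. The vORAM accesses are indexed by the
number of the HIRB operation (`0` is the initialization) and the height in the HIRB, and each of
them uses up to three random identifiers. -/
abbrev Coins (p : VHParams) (L : Type*) :=
  (L → HashVal p) × (L → Fin p.H → Fin p.β) × (ℕ × ℕ × Fin 3 → Fin (2 * p.T + p.γ) → Bool)

/-- The distribution of the random choices: all of them are independent and uniform. -/
noncomputable def coinsMeasure (p : VHParams) (L : Type*) : MeasureTheory.Measure (Coins p L) :=
  (MeasureTheory.Measure.infinitePi fun _ : L =>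
      ProbabilityTheory.uniformOn (Set.univ : Set (HashVal p))).prod
    ((MeasureTheory.Measure.infinitePi fun _ : L =>
        ProbabilityTheory.uniformOn (Set.univ : Set (Fin p.H → Fin p.β))).prod
      (MeasureTheory.Measure.infinitePi fun _ : ℕ × ℕ × Fin 3 =>
        ProbabilityTheory.uniformOn (Set.univ : Set (Fin (2 * p.T + p.γ) → Bool))))

/-- The largest `l ≤ H` such that the first `l` coins are `0`: a sample from the truncated geometric
distribution on `{0, …, H}` with probability `(β - 1) / β`. -/
def heightOfCoins {H b : ℕ} (c : Fin H → Fin b) : ℕ :=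
  Nat.findGreatest (fun l => ∀ i : Fin H, (i : ℕ) < l → (c i : ℕ) = 0) H

section Run
variable {p : VHParams} {L : Type*}

/-- The hash of a label. -/
def Coins.hash (ω : Coins p L) (x : L) : HashVal p := ω.1 x

/-- The height of a label. -/
def Coins.chooseHeight (ω : Coins p L) (x : L) : ℕ := heightOfCoins (ω.2.1 x)

/-- The `c`-th random identifier for operation number `k` at height `l`. -/
def Coins.idgen (ω : Coins p L) (k l : ℕ) (c : Fin 3) : BlockId := idOfBits (ω.2.2 (k, l, c))

/-- The HIRB after an operation. -/
noncomputable def HOp.applyHirb (ω : Coins p L) (D : Hirb p) : HOp L → Hirb p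
  | .insert x =>
      if D (ω.hash x) = none then Function.update D (ω.hash x) (some (ω.chooseHeight x)) else D
  | .remove x => Function.update D (ω.hash x) none
  | .update _ => D

/-- The vORAM together with the identifiers under which the HIRB nodes are stored in it (the pointers
of the HIRB). -/
structure NodeStore (p : VHParams) where
  ptr : HNode p → BlockId
  mem : VORAM

/-- Initialization at height `l`: a vORAM insertion of an empty node, that is, evict a random path, put
the block into the stash under a new random identifier, and write the path back. -/
noncomputable def initStep (sel : SelectionRule) (ω : Coins p L) (s : NodeStore p) (l : ℕ) :
    NodeStore p where
  ptr := Function.update s.ptr (l, ⊥) (ω.idgen 0 l 0)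
  mem := (((s.mem.evict p.T (ω.idgen 0 l 2)).putStash (ω.idgen 0 l 0) (p.nodeSize 0)).writeback
    sel p.T p.Z (ω.idgen 0 l 2))

/-- One step, at height `l`, of an operation with label hash `h` that turns the HIRB `D` into `D'`.
The left node `v₀ = searchNode D l h` is always accessed, and the right node `v₁ = (l, h)` if it exists;
otherwise the second path is a random one. Both paths are evicted, the old nodes are removed from
the stash, the new contents (after splitting or merging) are put there under the new
random identifiers `new₀` and `new₁`, and both paths are written back. -/
noncomputable def pathStep (sel : SelectionRule) (D D' : Hirb p) (h : HashVal p)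
    (new₀ new₁ dummy : BlockId) (l : ℕ) (s : NodeStore p) : NodeStore p :=
  let v₀ : HNode p := searchNode D l h
  let v₁ : HNode p := (l, (h : WithBot (HashVal p)))
  let id₀ := s.ptr v₀
  let id₁ := if h ∈ separators D l then s.ptr v₁ else dummy
  let m₁ := (s.mem.evict p.T id₀).evict p.T id₁
  let m₂ := m₁.takeStash id₀
  let m₃ := if h ∈ separators D l then m₂.takeStash id₁ else m₂
  let m₄ := m₃.putStash new₀ (blockSize D' v₀)
  let m₅ := if h ∈ separators D' l then m₄.putStash new₁ (blockSize D' v₁) else m₄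
  let ptr' := Function.update s.ptr v₀ new₀
  { ptr := if h ∈ separators D' l then Function.update ptr' v₁ new₁ else ptr'
    mem := (m₅.writeback sel p.T p.Z id₀).writeback sel p.T p.Z id₁ }

/-- State of the vORAM+HIRB: the number of operations so far, the HIRB, and its nodes in the vORAM. -/
structure VHState (p : VHParams) where
  clock : ℕ
  tree : Hirb p
  store : NodeStore p

/-- The initial state: an empty HIRB of height `H`, whose nodes are inserted into an empty vORAM from the
leaf to the root. -/
noncomputable def initState (sel : SelectionRule) (ω : Coins p L) : VHState p where
  clock := 0
  tree := fun _ => none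
  store := (List.range (p.H + 1)).foldl (initStep sel ω)
    { ptr := fun _ => [], mem := { bucket := fun _ => 0, stash := 0 } }

/-- Execute one operation: walk down the search path, from height `H` (the root) to height `0`. -/
noncomputable def execOp (sel : SelectionRule) (ω : Coins p L) (s : VHState p) (op : HOp L) :
    VHState p where
  clock := s.clock + 1
  tree := op.applyHirb ω s.tree
  store := (List.range (p.H + 1)).reverse.foldl
    (fun st l => pathStep sel s.tree (op.applyHirb ω s.tree) (ω.hash op.label)
      (ω.idgen (s.clock + 1) l 0) (ω.idgen (s.clock + 1) l 1) (ω.idgen (s.clock + 1) l 2) l st)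
    s.store

/-- The state after a sequence of operations. -/
noncomputable def runOps (sel : SelectionRule) (ω : Coins p L) (ops : List (HOp L)) : VHState p :=
  ops.foldl (execOp sel ω) (initState sel ω)

/-- The stash holds more than `R` bits. -/
def StashOverflow (R : ℕ) (s : VHState p) : Prop := R < s.store.mem.stash.size

/-- Two distinct HIRB nodes have the same vORAM identifier. -/
def IdCollision (s : VHState p) : Prop :=
  ∃ ν μ : HNode p, IsHNode s.tree ν ∧ IsHNode s.tree μ ∧ ν ≠ μ ∧ s.store.ptr ν = s.store.ptr μ

/-- Two distinct labels in the dictionary have the same hash. -/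
def HashCollision (ω : Coins p L) (S : Finset L) : Prop :=
  ∃ x ∈ S, ∃ y ∈ S, x ≠ y ∧ ω.hash x = ω.hash y

/-- The event that, after the operations `ops`, the vORAM+HIRB fails because of stash overflow or a
collision (of block identifiers or of label hashes). -/
def failureEvent [DecidableEq L] (sel : SelectionRule) (R : ℕ) (ops : List (HOp L)) :
    Set (Coins p L) :=
  {ω | StashOverflow R (runOps sel ω ops) ∨ IdCollision (runOps sel ω ops) ∨
    HashCollision ω (labelsAfter ops)}

end Run

/-!
Stash overflow is the main part; the two kinds of collisions are estimated at the end by counting pairs.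

*Deterministic part.* Call a bucket full if it holds at least `Z` bits. A greedy writeback establishes
the invariant `StoreInv`: a block has data above a bucket of its path that is not full only if no path
through this bucket has been rewritten since the block was put into the stash. At the end, let `t` be
the largest subtree of full buckets that contains the root. A block with data in the stash or in `t`
then has a path that either stays in `t`, or leaves `t` at an exit through which no path has been evicted
since the last access to the block. If the stash overflows and the identifiers are distinct, the
blocks of this kind have more than `R + Z * |t|` bits in total (`exists_overloaded_subtree`). By the union
bound over the subtrees (`RTree.sum_all_le`, a Catalan generating function) and Markov's inequality it
suffices to bound the expectation of `exp (θ * load)` by `9.2 * exp |t|` for every `t`, where `θ` is the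
inverse of eight full node lengths.

*Independence.* The shape of the HIRB after each operation depends only on the hashes and the heights. So
does the index of the random identifier of each node (`Trace.ptrIdx`) and of each evicted path
(`Trace.evIdx`). No index is evicted twice, and none of the evicted ones belongs to a node at the end
(`Trace.evIdx_inj`, `Trace.evIdx_ne_ptrIdx`, `Trace.ptrIdx_injOn`). Given hashes and heights, the
evicted paths and the paths of the final nodes are therefore independent and uniform. The last access
to a node was made by the last operation whose hash lies in the closed gap of the node
(`Trace.ptrIdx_fst`).

*Heights.* For fixed hashes and evicted paths, the load is a sum over the gaps of all levels. The items of
a gap are divided into those on the left and those on the right of its most recently accessed hash, which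
are treated separately (`exp_load_le`). At one level, each hash becomes a separator with
probability `1 / β`; scanning the hashes from right to left, with a potential for the current gap, bounds the
expected product of the factors of all gaps (`markSum_left_le`) by a product over all accesses of
`1 + C * P`, where `P` is the probability of leaving `t` by an exit that has not been taken since
that access. The levels are combined from the root to the leaves (`expect_levels_le`); the number of hashes
that reach the root level costs only a constant factor as `n ≤ β ^ H`. The nodes whose path stays in `t` have
a fixed probability of at most `|t| / 2 ^ T` and are treated in the same way (`markSum_items_le`).

*Evictions.* It remains to average over the evicted paths. Since each access comes with two
evictions, the factors `1 + C * P` are at most a product of factors `1 + 0.6 * P` over all evictions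
(`prod_accesses_le`). In reverse chronological order, the number of exits of `t` that have not been taken
is a potential that pays for these factors: their expected product is at most `2.5 ^ (|t| + 1)`
(`expect_openExits_le`).
-/

open scoped BigOperators

/-! ### Paths and amounts of data in the vORAM -/

lemma mem_pathOf {T : ℕ} {i : BlockId} {a : BucketAddr} :
    a ∈ pathOf T i ↔ ∃ t ≤ T, loc i t = a := by
  simp [pathOf]

lemma loc_mem_pathOf {T t : ℕ} (i : BlockId) (ht : t ≤ T) : loc i t ∈ pathOf T i :=
  mem_pathOf.2 ⟨t, ht, rfl⟩

/-- Two paths that share a bucket share all buckets above it. -/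
lemma mem_pathOf_of_length_le {T : ℕ} {i j : BlockId} {a a' : BucketAddr}
    (ha : a ∈ pathOf T j) (ha' : a' ∈ pathOf T j) (hi : a' ∈ pathOf T i)
    (hl : a.length ≤ a'.length) : a ∈ pathOf T i := by
  obtain ⟨t, ht, rfl⟩ := mem_pathOf.1 ha
  obtain ⟨t', ht', rfl⟩ := mem_pathOf.1 ha'
  obtain ⟨s, hs, h⟩ := mem_pathOf.1 hi
  unfold loc at *
  rcases eq_or_ne j [] with rfl | hj
  · simpa using hi
  have hj' : 0 < j.length := List.length_pos_iff.2 hj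
  have h1 : j.take (t + 1) <+: i.take (s + 1) :=
    h ▸ List.prefix_of_prefix_length_le (List.take_prefix _ _) (List.take_prefix _ _) hl
  have h2 := h1.length_le
  have h3 := List.prefix_iff_eq_take.1 (h1.trans (List.take_prefix _ _))
  simp only [List.length_take] at h2 h3
  refine mem_pathOf.2 ⟨min (t + 1) j.length - 1, by omega, ?_⟩
  rw [h3, loc, Nat.sub_add_cancel (by omega)]

lemma loc_injOn {T : ℕ} {i : BlockId} (hi : T + 1 ≤ i.length) :
    Set.InjOn (loc i) (Finset.range (T + 1) : Set ℕ) := by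
  intro s hs t ht h
  have := congrArg List.length h
  simp only [Finset.coe_range, Set.mem_Iio] at hs ht
  simp only [loc, List.length_take] at this
  omega

lemma loc_length {T t : ℕ} {i : BlockId} (hi : T + 1 ≤ i.length) (ht : t ≤ T) :
    (loc i t).length = t + 1 := by
  simp only [loc, List.length_take]; omega

namespace VORAM

/-- All bits of a block lie on its path or in the stash. -/
def Placed (T : ℕ) (m : VORAM) : Prop := ∀ a j, m.bucket a j ≠ 0 → a ∈ pathOf T j

/-- The number of bits of block `j` on its path and in the stash. -/
noncomputable def total (T : ℕ) (m : VORAM) (j : BlockId) : ℕ :=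
  m.stash j + ∑ a ∈ pathOf T j, m.bucket a j

/-- The number of bits of block `j` in the stash and in the buckets of its path that lie strictly
above the level of bucket `a`. -/
noncomputable def above (T : ℕ) (m : VORAM) (a : BucketAddr) (j : BlockId) : ℕ :=
  m.stash j + ∑ a' ∈ pathOf T j with a'.length < a.length, m.bucket a' j

lemma above_le_total (T : ℕ) (m : VORAM) (a : BucketAddr) (j : BlockId) :
    m.above T a j ≤ m.total T j :=
  Nat.add_le_add_left (Finset.sum_le_sum_of_subset (Finset.filter_subset _ _)) _

/-! #### Eviction -/

section evict
variable {T : ℕ} {m : VORAM} {i : BlockId}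

lemma Placed.evict (hm : m.Placed T) : (m.evict T i).Placed T := by
  intro a j h
  simp only [VORAM.evict] at h
  split_ifs at h
  · simp at h
  · exact hm a j h

lemma evict_bucket_of_mem {a : BucketAddr} (ha : a ∈ pathOf T i) :
    (m.evict T i).bucket a = 0 := by simp [VORAM.evict, ha]

lemma evict_bucket_of_notMem {a : BucketAddr} (ha : a ∉ pathOf T i) :
    (m.evict T i).bucket a = m.bucket a := by simp [VORAM.evict, ha]

lemma evict_stash (hi : T + 1 ≤ i.length) (j : BlockId) :
    (m.evict T i).stash j = m.stash j + ∑ a ∈ pathOf T i, m.bucket a j := by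
  rw [pathOf, Finset.sum_image (loc_injOn hi)]
  simp [VORAM.evict]

lemma Placed.sum_inter (hm : m.Placed T) (j : BlockId) :
    ∑ a ∈ pathOf T i, m.bucket a j = ∑ a ∈ pathOf T j with a ∈ pathOf T i, m.bucket a j := by
  have : {a ∈ pathOf T j | a ∈ pathOf T i} = {a ∈ pathOf T i | a ∈ pathOf T j} := by
    ext a; simp [and_comm]
  rw [this, Finset.sum_filter_of_ne fun a _ h => hm a j h]

lemma total_evict (hm : m.Placed T) (hi : T + 1 ≤ i.length) (j : BlockId) :
    (m.evict T i).total T j = m.total T j := by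
  rw [total, total, evict_stash hi, hm.sum_inter,
    ← Finset.sum_filter_add_sum_filter_not (pathOf T j) (· ∈ pathOf T i) fun a => m.bucket a j,
    ← Finset.sum_filter_add_sum_filter_not (pathOf T j) (· ∈ pathOf T i)
      fun a => (m.evict T i).bucket a j]
  have h1 : ∑ a ∈ pathOf T j with a ∈ pathOf T i, (m.evict T i).bucket a j = 0 :=
    Finset.sum_eq_zero fun a ha => by simp [evict_bucket_of_mem (Finset.mem_filter.1 ha).2]
  have h2 : ∑ a ∈ pathOf T j with a ∉ pathOf T i, (m.evict T i).bucket a j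
      = ∑ a ∈ pathOf T j with a ∉ pathOf T i, m.bucket a j :=
    Finset.sum_congr rfl fun a ha => by rw [evict_bucket_of_notMem (Finset.mem_filter.1 ha).2]
  rw [h1, h2]; ring

/-- Eviction of a path that avoids `a` only moves data between places above `a`. -/
lemma above_evict (hm : m.Placed T) (hi : T + 1 ≤ i.length) {a : BucketAddr} {j : BlockId}
    (haj : a ∈ pathOf T j) (ha : a ∉ pathOf T i) :
    (m.evict T i).above T a j = m.above T a j := by
  have key : {a' ∈ pathOf T j | a' ∈ pathOf T i}
      = {a' ∈ {a' ∈ pathOf T j | a'.length < a.length} | a' ∈ pathOf T i} := by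
    ext a'
    simp only [Finset.mem_filter]
    refine ⟨fun h => ⟨⟨h.1, ?_⟩, h.2⟩, fun h => ⟨h.1.1, h.2⟩⟩
    by_contra hl
    exact ha (mem_pathOf_of_length_le haj h.1 h.2 (not_lt.1 hl))
  rw [above, above, evict_stash hi, hm.sum_inter, key,
    ← Finset.sum_filter_add_sum_filter_not {a' ∈ pathOf T j | a'.length < a.length}
      (· ∈ pathOf T i) fun a => m.bucket a j,
    ← Finset.sum_filter_add_sum_filter_not {a' ∈ pathOf T j | a'.length < a.length}
      (· ∈ pathOf T i) fun a => (m.evict T i).bucket a j]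
  have h1 : ∑ a' ∈ {a' ∈ pathOf T j | a'.length < a.length} with a' ∈ pathOf T i,
      (m.evict T i).bucket a' j = 0 :=
    Finset.sum_eq_zero fun a ha => by simp [evict_bucket_of_mem (Finset.mem_filter.1 ha).2]
  have h2 : ∑ a' ∈ {a' ∈ pathOf T j | a'.length < a.length} with a' ∉ pathOf T i,
      (m.evict T i).bucket a' j
      = ∑ a' ∈ {a' ∈ pathOf T j | a'.length < a.length} with a' ∉ pathOf T i, m.bucket a' j :=
    Finset.sum_congr rfl fun a ha => by rw [evict_bucket_of_notMem (Finset.mem_filter.1 ha).2]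
  rw [h1, h2]; ring

end evict

/-! #### Filling a bucket -/

lemma size_add_single (f : Blocks) (j : BlockId) (l : ℕ) :
    Blocks.size (f + Finsupp.single j l) = f.size + l := by
  rw [Blocks.size, Blocks.size, Finsupp.sum_add_index' (by simp) (by simp),
    Finsupp.sum_single_index rfl]

/-- The effect of `fillBucket`: it only moves data of candidates from the stash to bucket `a`, and
in the end the bucket is full or nothing of the candidates is left in the stash. -/
structure FillSpec (Z : ℕ) (a : BucketAddr) (W : Finset BlockId) (m m' : VORAM) : Prop where
  bucket_ne : ∀ a', a' ≠ a → m'.bucket a' = m.bucket a'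
  add_eq : ∀ j, m'.stash j + m'.bucket a j = m.stash j + m.bucket a j
  notMem : ∀ j, j ∉ W → m'.stash j = m.stash j
  mono : ∀ j, m'.stash j ≤ m.stash j
  full_or : Z ≤ (m'.bucket a).size ∨ ∀ j ∈ W, m'.stash j = 0

lemma fillSpec (sel : SelectionRule) (Z : ℕ) (a : BucketAddr) (W : Finset BlockId) (m : VORAM) :
    FillSpec Z a W m (fillBucket sel Z a m W) := by
  induction hn : #W generalizing W m with
  | zero =>
    obtain rfl : W = ∅ := Finset.card_eq_zero.1 hn
    rw [fillBucket]
    simp only [Finset.not_nonempty_empty, false_and, dite_false]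
    exact ⟨fun _ _ => rfl, fun _ => rfl, fun _ _ => rfl, fun _ => le_rfl, Or.inr (by simp)⟩
  | succ n ih =>
    rw [fillBucket]
    split_ifs with h
    · obtain ⟨j₀, hj₀⟩ : ∃ j₀, j₀ = (sel m a W h.1 : BlockId) := ⟨_, rfl⟩
      have hmem : j₀ ∈ W := hj₀ ▸ (sel m a W h.1).2
      rw [← hj₀]
      set l := min (m.stash j₀) (Z - (m.bucket a).size) with hl
      have hcard : #(W.erase j₀) = n := by rw [Finset.card_erase_of_mem hmem, hn]; rfl
      have H := ih (W.erase j₀) (m.move a j₀ l) hcard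
      have hst : ∀ j, (m.move a j₀ l).stash j = m.stash j - Finsupp.single j₀ l j := by
        intro j; simp [VORAM.move, Finsupp.tsub_apply]
      have hbk : (m.move a j₀ l).bucket a = m.bucket a + Finsupp.single j₀ l := by
        simp [VORAM.move]
      have hle : ∀ j, Finsupp.single j₀ l j ≤ m.stash j := by
        intro j
        by_cases hj : j = j₀
        · subst hj; simp [hl]
        · simp [Ne.symm hj]
      refine ⟨fun a' ha' => ?_, fun j => ?_, fun j hj => ?_, fun j => ?_, ?_⟩
      · rw [H.bucket_ne a' ha']; simp [VORAM.move, ha']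
      · rw [H.add_eq, hst, hbk, Finsupp.add_apply]
        have := hle j
        omega
      · have hne : j₀ ≠ j := fun e => hj (e ▸ hmem)
        rw [H.notMem j (fun hc => hj (Finset.mem_of_mem_erase hc)), hst]
        simp [hne]
      · exact (H.mono j).trans (by rw [hst]; exact Nat.sub_le _ _)
      · by_cases hfull : m.stash j₀ ≤ Z - (m.bucket a).size
        · refine H.full_or.imp id fun h0 j hj => ?_
          by_cases hjj : j = j₀
          · subst hjj
            rw [H.notMem j (Finset.notMem_erase _ _), hst]
            simp [hl, min_eq_left hfull]
          · exact h0 j (Finset.mem_erase.2 ⟨hjj, hj⟩)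
        · left
          -- the bucket has become full, so that the loop has ended
          have hsz : ((m.move a j₀ l).bucket a).size = Z := by
            rw [hbk, size_add_single, hl, min_eq_right (by omega)]; omega
          rw [fillBucket, dif_neg (by rw [hsz]; simp), hsz]
    · refine ⟨fun _ _ => rfl, fun _ => rfl, fun _ _ => rfl, fun _ => le_rfl, ?_⟩
      have hW : W.Nonempty := Finset.card_pos.1 (by omega)
      exact Or.inl (not_lt.1 fun h' => h ⟨hW, h'⟩)

/-! #### Writeback -/

/-- The state of a writeback of path `i` of `m₀` when the buckets at level `t₀` and below have been
filled. -/
structure WbSpec (T Z : ℕ) (i : BlockId) (m₀ : VORAM) (t₀ : ℕ) (m : VORAM) : Prop where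
  placed : m.Placed T
  total : ∀ j, m.total T j = m₀.total T j
  bucket : ∀ a, a ∉ pathOf T i → m.bucket a = m₀.bucket a
  above : ∀ j, ∀ a ∈ pathOf T j, a ∉ pathOf T i → m.above T a j = m₀.above T a j
  empty : ∀ t ≤ T, t < t₀ → m.bucket (loc i t) = 0
  full_or : ∀ t ≤ T, t₀ ≤ t → ∀ j, loc i t ∈ pathOf T j →
    Z ≤ (m.bucket (loc i t)).size ∨ m.above T (loc i t) j = 0

lemma total_congr_move {m m' : VORAM} {a : BucketAddr} {j : BlockId}
    (hne : ∀ a', a' ≠ a → m'.bucket a' = m.bucket a')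
    (hadd : m'.stash j + m'.bucket a j = m.stash j + m.bucket a j)
    {P : Finset BucketAddr} (ha : a ∈ P) :
    m'.stash j + ∑ a' ∈ P, m'.bucket a' j = m.stash j + ∑ a' ∈ P, m.bucket a' j := by
  rw [← Finset.add_sum_erase P _ ha, ← Finset.add_sum_erase P (fun a' => m.bucket a' j) ha,
    ← add_assoc, ← add_assoc, hadd]
  congr 1
  exact Finset.sum_congr rfl fun a' h => by rw [hne a' (Finset.ne_of_mem_erase h)]

/-- One more bucket is filled. Here it matters that the buckets are filled from the leaf to the root: the
data of an eligible block that lies above the bucket is all in the stash. -/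
lemma WbSpec.fill {T Z t : ℕ} {i : BlockId} {m₀ m : VORAM} (sel : SelectionRule)
    (hi : T + 1 ≤ i.length) (ht : t ≤ T) (h : WbSpec T Z i m₀ (t + 1) m) :
    WbSpec T Z i m₀ t (fillBucket sel Z (loc i t) m
      (m.stash.support.filter fun j => loc j t = loc i t)) := by
  set a := loc i t with ha
  set W := m.stash.support.filter fun j => loc j t = a with hW
  have F := fillSpec sel Z a W m
  set m' := fillBucket sel Z a m W with hm'
  have hai : a ∈ pathOf T i := loc_mem_pathOf i ht
  -- blocks whose path misses `a` are not affected
  have hoff : ∀ j, loc j t ≠ a → m'.stash j = m.stash j ∧ m'.bucket a j = m.bucket a j := by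
    intro j hj
    have h1 := F.notMem j (by simp [hW, hj])
    have h2 := F.add_eq j
    exact ⟨h1, by omega⟩
  have hsame : ∀ j, a ∈ pathOf T j → loc j t = a := by
    intro j hj
    obtain ⟨s, hs, e⟩ := mem_pathOf.1 hj
    have hl := loc_length hi ht
    rw [← ha, ← e] at hl
    simp only [loc, List.length_take] at hl
    rw [← e]
    rcases Nat.lt_or_ge s t with hst | hst
    · omega
    · have hlen : (loc j s).length = t + 1 := by
        simp only [loc, List.length_take]; exact hl
      have e2 : loc j t = (loc j s).take (t + 1) := by
        simp only [loc, List.take_take, min_eq_left (Nat.succ_le_succ hst)]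
      rw [e2, ← hlen, List.take_length]
  refine ⟨?_, ?_, ?_, ?_, ?_, ?_⟩
  · intro a' j hj
    by_cases e : a' = a
    · subst e
      by_cases hl : loc j t = a
      · exact hl ▸ loc_mem_pathOf j ht
      · rw [(hoff j hl).2] at hj; exact h.placed _ j hj
    · rw [F.bucket_ne a' e] at hj; exact h.placed a' j hj
  · intro j
    rw [← h.total j]
    by_cases hl : loc j t = a
    · exact total_congr_move F.bucket_ne (F.add_eq j) (hl ▸ loc_mem_pathOf j ht)
    · have hna : a ∉ pathOf T j := fun hc => hl (hsame j hc)
      rw [VORAM.total, VORAM.total, (hoff j hl).1]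
      congr 1
      exact Finset.sum_congr rfl fun a' h' => by
        rw [F.bucket_ne a' fun e => hna (e ▸ h')]
  · intro a' ha'
    rw [F.bucket_ne a' fun e => ha' (e ▸ hai), h.bucket a' ha']
  · intro j a' ha'j ha'
    rw [← h.above j a' ha'j ha']
    by_cases hl : loc j t = a
    · have haj : a ∈ pathOf T j := hl ▸ loc_mem_pathOf j ht
      refine total_congr_move F.bucket_ne (F.add_eq j) ?_
      refine Finset.mem_filter.2 ⟨haj, ?_⟩
      by_contra hlen
      exact ha' (mem_pathOf_of_length_le ha'j haj hai (not_lt.1 hlen))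
    · have hna : a ∉ pathOf T j := fun hc => hl (hsame j hc)
      rw [VORAM.above, VORAM.above, (hoff j hl).1]
      congr 1
      exact Finset.sum_congr rfl fun a' h' => by
        rw [F.bucket_ne a' fun e => hna (e ▸ (Finset.mem_filter.1 h').1)]
  · intro s hs hst
    rw [F.bucket_ne, h.empty s hs (by omega)]
    intro e
    have := congrArg List.length e
    rw [ha, loc_length hi hs, loc_length hi ht] at this
    omega
  · intro s hs hst j hj
    rcases hst.eq_or_lt with rfl | hst'
    -- the bucket that has just been filled: all buckets above it are still empty
    · refine F.full_or.imp id fun h0 => ?_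
      have hl : loc j t = a := hsame j hj
      have hs0 : m'.stash j = 0 := by
        by_cases hjW : j ∈ W
        · exact h0 j hjW
        · rw [F.notMem j hjW]
          simpa [hW, hl] using hjW
      rw [VORAM.above, hs0, zero_add]
      refine Finset.sum_eq_zero fun a' ha' => ?_
      obtain ⟨ha'j, hlen⟩ := Finset.mem_filter.1 ha'
      obtain ⟨s, hs, rfl⟩ := mem_pathOf.1 (mem_pathOf_of_length_le ha'j hj hai hlen.le)
      rw [← ha, loc_length hi hs, ha, loc_length hi ht] at hlen
      rw [F.bucket_ne, h.empty s hs (by omega)]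
      · simp
      · intro e
        have := congrArg List.length e
        rw [ha, loc_length hi hs, loc_length hi ht] at this
        omega
    -- a bucket below: data that moves to `a` stays above it
    · have hsl : (loc i s).length = s + 1 := loc_length hi hs
      have hal : a.length = t + 1 := loc_length hi ht
      have hne : loc i s ≠ a := fun e => by rw [e] at hsl; omega
      rw [F.bucket_ne _ hne]
      refine (h.full_or s hs (by omega) j hj).imp id fun h0 => ?_
      rw [← h0]
      by_cases hl : loc j t = a
      · refine total_congr_move F.bucket_ne (F.add_eq j) ?_
        exact Finset.mem_filter.2 ⟨hl ▸ loc_mem_pathOf j ht, by omega⟩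
      · have hna : a ∉ pathOf T j := fun hc => hl (hsame j hc)
        rw [VORAM.above, VORAM.above, (hoff j hl).1]
        congr 1
        exact Finset.sum_congr rfl fun a' h' => by
          rw [F.bucket_ne a' fun e => hna (e ▸ (Finset.mem_filter.1 h').1)]

/-- The effect of a writeback: data stays in place with respect to the buckets off the path, and a
bucket on the path is full unless everything that fits into it has been moved to it or below. -/
lemma writeback_spec {T Z : ℕ} {i : BlockId} {m : VORAM} (sel : SelectionRule)
    (hi : T + 1 ≤ i.length) (hm : m.Placed T) :
    WbSpec T Z i m 0 (m.writeback sel T Z i) := by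
  have key : ∀ n ≤ T + 1, ∀ m', WbSpec T Z i m n m' → WbSpec T Z i m 0
      ((List.range n).reverse.foldl (fun m t => fillBucket sel Z (loc i t) m
        (m.stash.support.filter fun j => loc j t = loc i t)) m') := by
    intro n
    induction n with
    | zero => intro _ m' h; simpa using h
    | succ n ih =>
      intro hn m' h
      rw [List.range_succ, List.reverse_append, List.foldl_append]
      exact ih (by omega) _ (h.fill sel hi (by omega))
  refine key (T + 1) le_rfl _ ⟨hm.evict, fun j => total_evict hm hi j,
    fun a ha => evict_bucket_of_notMem ha, fun j a haj ha => above_evict hm hi haj ha,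
    fun t ht _ => evict_bucket_of_mem (loc_mem_pathOf i ht), fun t ht h => by omega⟩

end VORAM

/-! ### The invariant of the vORAM -/

/-- Invariant of a vORAM `m` that stores a set `live` of nodes, where node `ν` has identifier `ptr ν`
and length `size ν`, and `touched ν` is the set of the buckets on paths that have been rewritten since
the block of `ν` was put into the stash. The condition `fresh` is what a greedy writeback achieves: data
lies above a bucket of its path that is not full only if that bucket has not been rewritten since.
It is not required for the buckets in `S`, which have been evicted but not yet rewritten. -/
structure StoreInv {N : Type*} (T Z : ℕ) (S : Set BucketAddr) (live : Finset N) (ptr : N → BlockId)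
    (size : N → ℕ) (touched : N → Set BucketAddr) (m : VORAM) : Prop where
  placed : m.Placed T
  total_le : ∀ j, m.total T j ≤ ∑ ν ∈ live with ptr ν = j, size ν
  fresh : ∀ j, ∀ a ∈ pathOf T j, a ∉ S → (m.bucket a).size < Z → m.above T a j ≠ 0 →
    ∃ ν ∈ live, ptr ν = j ∧ a ∉ touched ν

namespace StoreInv
variable {N : Type*} {T Z : ℕ} {S : Set BucketAddr} {live : Finset N} {ptr : N → BlockId}
  {size : N → ℕ} {touched : N → Set BucketAddr} {m : VORAM}

/-- The set `S` may be added to the touched buckets, as `fresh` does not concern it. -/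
lemma congr {live' : Finset N} {ptr' : N → BlockId} {size' : N → ℕ}
    {touched' : N → Set BucketAddr} (h : StoreInv T Z S live ptr size touched m)
    (hl : live = live') (hp : ∀ ν ∈ live, ptr' ν = ptr ν) (hs : ∀ ν ∈ live, size' ν = size ν)
    (ht : ∀ ν ∈ live, touched' ν ⊆ touched ν ∪ S) :
    StoreInv T Z S live' ptr' size' touched' m := by
  subst hl
  refine ⟨h.placed, fun j => ?_, fun j a ha haS h1 h2 => ?_⟩
  · have : ∑ ν ∈ live with ptr' ν = j, size' ν = ∑ ν ∈ live with ptr ν = j, size ν := by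
      rw [Finset.sum_filter, Finset.sum_filter]
      exact Finset.sum_congr rfl fun ν hν => by rw [hp ν hν, hs ν hν]
    rw [this]; exact h.total_le j
  · obtain ⟨ν, hν, e, ht'⟩ := h.fresh j a ha haS h1 h2
    exact ⟨ν, hν, (hp ν hν).trans e, fun hc => (ht ν hν hc).elim ht' haS⟩

lemma evict {i : BlockId} (h : StoreInv T Z S live ptr size touched m) (hi : T + 1 ≤ i.length) :
    StoreInv T Z (S ∪ pathOf T i) live ptr size touched (m.evict T i) := by
  refine ⟨h.placed.evict, fun j => ?_, fun j a ha haS h1 h2 => ?_⟩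
  · rw [VORAM.total_evict h.placed hi]; exact h.total_le j
  · simp only [Set.mem_union, SetLike.mem_coe, not_or] at haS
    rw [VORAM.evict_bucket_of_notMem haS.2] at h1
    rw [VORAM.above_evict h.placed hi ha haS.2] at h2
    exact h.fresh j a ha haS.1 h1 h2

lemma writeback {i : BlockId} (sel : SelectionRule)
    (h : StoreInv T Z S live ptr size touched m) (hi : T + 1 ≤ i.length) :
    StoreInv T Z (S \ pathOf T i) live ptr size touched (m.writeback sel T Z i) := by
  have H := VORAM.writeback_spec (Z := Z) sel hi h.placed
  refine ⟨H.placed, fun j => ?_, fun j a ha haS h1 h2 => ?_⟩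
  · rw [H.total]; exact h.total_le j
  · by_cases hai : a ∈ pathOf T i
    · obtain ⟨t, ht, rfl⟩ := mem_pathOf.1 hai
      rcases H.full_or t ht (Nat.zero_le _) j ha with h3 | h3
      · omega
      · exact absurd h3 h2
    · rw [H.bucket a hai] at h1
      rw [H.above j a ha hai] at h2
      exact h.fresh j a ha (fun hc => haS ⟨hc, hai⟩) h1 h2

lemma takeStash [DecidableEq N] {v : N} (h : StoreInv T Z S live ptr size touched m)
    (hb : ∀ a ∈ pathOf T (ptr v), m.bucket a = 0) :
    StoreInv T Z S (live.erase v) ptr size touched (m.takeStash (ptr v)) := by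
  have h0 : (m.takeStash (ptr v)).total T (ptr v) = 0 := by
    rw [VORAM.total, Finset.sum_eq_zero fun a ha => by simp [VORAM.takeStash, hb a ha]]
    simp [VORAM.takeStash]
  have hne : ∀ j, j ≠ ptr v → (m.takeStash (ptr v)).stash j = m.stash j := fun j hj => by
    simp [VORAM.takeStash, hj]
  refine ⟨h.placed, fun j => ?_, fun j a ha haS h1 h2 => ?_⟩
  · by_cases hj : j = ptr v
    · rw [hj, h0]; exact Nat.zero_le _
    · have : {ν ∈ live.erase v | ptr ν = j} = {ν ∈ live | ptr ν = j} := by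
        ext ν
        simp only [Finset.mem_filter, Finset.mem_erase]
        exact ⟨fun h => ⟨h.1.2, h.2⟩, fun h => ⟨⟨fun e => hj (by rw [← h.2, e]), h.1⟩, h.2⟩⟩
      rw [this, VORAM.total, hne j hj]
      exact h.total_le j
  · have hj : j ≠ ptr v := by
      rintro rfl
      have := (m.takeStash (ptr v)).above_le_total T a (ptr v)
      omega
    rw [VORAM.above, hne j hj] at h2
    obtain ⟨ν, hν, e, ht⟩ := h.fresh j a ha haS h1 h2
    exact ⟨ν, Finset.mem_erase.2 ⟨fun e' => hj (by rw [← e, e']), hν⟩, e, ht⟩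

/-- A new block may be put into the stash when all buckets that count as touched since then are waiting to be
rewritten. -/
lemma putStash [DecidableEq N] {v : N} (h : StoreInv T Z S live ptr size touched m)
    (hv : v ∉ live) (ht : touched v ⊆ S) :
    StoreInv T Z S (insert v live) ptr size touched (m.putStash (ptr v) (size v)) := by
  refine ⟨h.placed, fun j => ?_, fun j a ha haS h1 h2 => ?_⟩
  · have h1 := h.total_le j
    have h2 : (m.putStash (ptr v) (size v)).total T j
        = m.total T j + if ptr v = j then size v else 0 := by
      rw [VORAM.total, VORAM.total]
      simp only [VORAM.putStash, Finsupp.add_apply, Finsupp.single_apply]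
      ring
    rw [h2, Finset.filter_insert]
    split_ifs with e
    · rw [Finset.sum_insert fun hc => hv (Finset.mem_filter.1 hc).1]; omega
    · simpa using h1
  · by_cases e : ptr v = j
    · exact ⟨v, Finset.mem_insert_self _ _, e, fun hc => haS (ht hc)⟩
    · have : (m.putStash (ptr v) (size v)).above T a j = m.above T a j := by
        rw [VORAM.above, VORAM.above]
        simp [VORAM.putStash, e]
      rw [this] at h2
      obtain ⟨ν, hν, e, ht⟩ := h.fresh j a ha haS h1 h2
      exact ⟨ν, Finset.mem_insert_of_mem hν, e, ht⟩

end StoreInv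

/-! ### Rooted subtrees of the bucket tree -/

/-- A rooted subtree of the bucket tree; it is used for the set of full buckets that are connected
to the root. -/
inductive RTree where
  | nil
  | node (l r : RTree)
  deriving DecidableEq

namespace RTree

/-- The number of buckets. -/
def size : RTree → ℕ
  | nil => 0
  | node l r => l.size + r.size + 1

/-- The addresses of the buckets, relative to the root. -/
def addrs : RTree → Finset (List Bool)
  | nil => ∅
  | node l r => insert [] (l.addrs.image (List.cons false) ∪ r.addrs.image (List.cons true))

/-- The address at which the path given by a bit string leaves the subtree; `none` if the whole path
lies in the subtree. -/
def exit : RTree → List Bool → Option (List Bool)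
  | nil, _ => some []
  | node _ _, [] => none
  | node l _, false :: bs => (l.exit bs).map (List.cons false)
  | node _ r, true :: bs => (r.exit bs).map (List.cons true)

/-- The addresses at which paths can leave the subtree. -/
def exits : RTree → Finset (List Bool)
  | nil => {[]}
  | node l r => l.exits.image (List.cons false) ∪ r.exits.image (List.cons true)

/-- All rooted subtrees of depth at most `d`. -/
def all : ℕ → Finset RTree
  | 0 => {nil}
  | d + 1 => insert nil ((all d ×ˢ all d).image fun p => node p.1 p.2)

open Classical in
/-- The largest rooted subtree of depth at most `d` all of whose addresses satisfy `P`. -/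
noncomputable def maximal (P : List Bool → Prop) : ℕ → RTree
  | 0 => nil
  | d + 1 => if P [] then node (maximal (fun a => P (false :: a)) d)
      (maximal (fun a => P (true :: a)) d) else nil

lemma card_addrs (t : RTree) : #t.addrs = t.size := by
  induction t with
  | nil => rfl
  | node l r hl hr =>
    rw [addrs, Finset.card_insert_of_notMem (by simp), Finset.card_union_of_disjoint,
      Finset.card_image_of_injective _ (List.cons_injective),
      Finset.card_image_of_injective _ (List.cons_injective), hl, hr, size]
    simp only [Finset.disjoint_left, Finset.mem_image]
    rintro _ ⟨a, _, rfl⟩ ⟨b, _, h⟩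
    simp at h

lemma card_exits_le (t : RTree) : #t.exits ≤ t.size + 1 := by
  induction t with
  | nil => simp [exits, size]
  | node l r hl hr =>
    refine (Finset.card_union_le _ _).trans ?_
    have h1 := Finset.card_image_le (s := l.exits) (f := List.cons false)
    have h2 := Finset.card_image_le (s := r.exits) (f := List.cons true)
    rw [size]; omega

lemma exit_mem_exits {t : RTree} {bs e : List Bool} (h : t.exit bs = some e) : e ∈ t.exits := by
  induction t generalizing bs e with
  | nil => simp only [exit, Option.some.injEq] at h; simp [exits, ← h]
  | node l r hl hr =>
    match bs with
    | [] => simp [exit] at h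
    | false :: bs =>
      obtain ⟨e', he, rfl⟩ := Option.map_eq_some_iff.1 h
      exact Finset.mem_union_left _ (Finset.mem_image_of_mem _ (hl he))
    | true :: bs =>
      obtain ⟨e', he, rfl⟩ := Option.map_eq_some_iff.1 h
      exact Finset.mem_union_right _ (Finset.mem_image_of_mem _ (hr he))

lemma exit_prefix {t : RTree} {bs e : List Bool} (h : t.exit bs = some e) : e <+: bs := by
  induction t generalizing bs e with
  | nil => simp only [exit, Option.some.injEq] at h; simp [← h]
  | node l r hl hr =>
    match bs with
    | [] => simp [exit] at h
    | false :: bs =>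
      obtain ⟨e', he, rfl⟩ := Option.map_eq_some_iff.1 h
      exact List.cons_prefix_cons.2 ⟨rfl, hl he⟩
    | true :: bs =>
      obtain ⟨e', he, rfl⟩ := Option.map_eq_some_iff.1 h
      exact List.cons_prefix_cons.2 ⟨rfl, hr he⟩

/-- The addresses of the subtree on a path are those that are shorter than the exit. -/
lemma length_lt_of_mem_addrs {t : RTree} {bs e a : List Bool} (h : t.exit bs = some e)
    (ha : a ∈ t.addrs) (hp : a <+: bs) : a.length < e.length := by
  induction t generalizing bs e a with
  | nil => simp [addrs] at ha
  | node l r hl hr =>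
    match bs with
    | [] => simp [exit] at h
    | false :: bs =>
      obtain ⟨e', he, rfl⟩ := Option.map_eq_some_iff.1 h
      simp only [addrs, Finset.mem_insert, Finset.mem_union, Finset.mem_image] at ha
      rcases ha with rfl | ⟨a', ha', rfl⟩ | ⟨a', ha', rfl⟩
      · simp
      · simpa using hl he ha' (List.cons_prefix_cons.1 hp).2
      · simp [List.cons_prefix_cons] at hp
    | true :: bs =>
      obtain ⟨e', he, rfl⟩ := Option.map_eq_some_iff.1 h
      simp only [addrs, Finset.mem_insert, Finset.mem_union, Finset.mem_image] at ha
      rcases ha with rfl | ⟨a', ha', rfl⟩ | ⟨a', ha', rfl⟩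
      · simp
      · simp [List.cons_prefix_cons] at hp
      · simpa using hr he ha' (List.cons_prefix_cons.1 hp).2

lemma maximal_mem_all (P : List Bool → Prop) (d : ℕ) : maximal P d ∈ all d := by
  induction d generalizing P with
  | zero => simp [maximal, all]
  | succ d ih =>
    rw [maximal, all]
    split_ifs
    · exact Finset.mem_insert_of_mem (Finset.mem_image.2 ⟨(_, _), Finset.mk_mem_product (ih _) (ih _), rfl⟩)
    · exact Finset.mem_insert_self _ _

lemma of_mem_maximal {P : List Bool → Prop} {d : ℕ} {a : List Bool}
    (h : a ∈ (maximal P d).addrs) : P a ∧ a.length < d := by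
  induction d generalizing P a with
  | zero => simp [maximal, addrs] at h
  | succ d ih =>
    rw [maximal] at h
    split_ifs at h with h0
    · simp only [addrs, Finset.mem_insert, Finset.mem_union, Finset.mem_image] at h
      rcases h with rfl | ⟨a', ha', rfl⟩ | ⟨a', ha', rfl⟩
      · exact ⟨h0, by simp⟩
      · exact ⟨(ih ha').1, by simpa using (ih ha').2⟩
      · exact ⟨(ih ha').1, by simpa using (ih ha').2⟩
    · simp [addrs] at h

/-- A path of full depth leaves the largest subtree only at an address that violates `P`. -/
lemma not_of_exit_maximal {P : List Bool → Prop} {d : ℕ} {bs e : List Bool}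
    (hd : bs.length < d) (h : (maximal P d).exit bs = some e) : ¬ P e := by
  induction d generalizing P bs e with
  | zero => omega
  | succ d ih =>
    rw [maximal] at h
    split_ifs at h with h0
    · match bs with
      | [] => simp [exit] at h
      | false :: bs =>
        obtain ⟨e', he, rfl⟩ := Option.map_eq_some_iff.1 h
        exact ih (P := fun a => P (false :: a)) (by simpa using hd) he
      | true :: bs =>
        obtain ⟨e', he, rfl⟩ := Option.map_eq_some_iff.1 h
        exact ih (P := fun a => P (true :: a)) (by simpa using hd) he
    · simp only [exit, Option.some.injEq] at h
      exact h ▸ h0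

/-- The generating function of rooted subtrees by size satisfies `S = 1 + x S²`, so it is at most
`2` when `x ≤ 1 / 4`. -/
lemma sum_all_le {x : ℝ} (hx0 : 0 ≤ x) (hx : x ≤ 1 / 4) (d : ℕ) :
    ∑ t ∈ all d, x ^ t.size ≤ 2 := by
  induction d with
  | zero => simp [all, size]
  | succ d ih =>
    rw [all, Finset.sum_insert (by simp), Finset.sum_image fun p _ q _ h => by
      simpa [Prod.ext_iff] using h, Finset.sum_product]
    have h1 : ∑ l ∈ all d, ∑ r ∈ all d, x ^ (node l r).size
        = x * (∑ t ∈ all d, x ^ t.size) ^ 2 := by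
      rw [sq, Finset.sum_mul_sum, Finset.mul_sum]
      refine Finset.sum_congr rfl fun l _ => ?_
      rw [Finset.mul_sum]
      exact Finset.sum_congr rfl fun r _ => by rw [size]; ring
    have h0 : 0 ≤ ∑ t ∈ all d, x ^ t.size := Finset.sum_nonneg fun _ _ => by positivity
    rw [h1]
    simp only [size, pow_zero]
    nlinarith [mul_nonneg hx0 h0]

/-- A path lies completely inside a subtree of size `s` with probability at most `s / 2 ^ T`. -/
lemma card_exit_none_le (t : RTree) {T m : ℕ} (hT : T ≤ m) :
    #{r : Fin m → Bool | t.exit ((List.ofFn r).take T) = none} ≤ t.size * 2 ^ (m - T) := by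
  induction t generalizing T m with
  | nil => simp [exit]
  | node l r hl hr =>
    match T, m with
    | 0, m =>
      refine (Finset.card_le_univ _).trans ?_
      simp only [Fintype.card_fun, Fintype.card_bool, Fintype.card_fin, size, Nat.sub_zero]
      nlinarith [Nat.zero_le ((l.size + r.size) * 2 ^ m)]
    | T + 1, m + 1 =>
      have hsub : Finset.univ.filter (fun q : Fin (m + 1) → Bool =>
          (node l r).exit ((List.ofFn q).take (T + 1)) = none) ⊆
          (Finset.univ.filter fun q : Fin m → Bool =>
            l.exit ((List.ofFn q).take T) = none).image (Fin.cons (α := fun _ => Bool) false) ∪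
          (Finset.univ.filter fun q : Fin m → Bool =>
            r.exit ((List.ofFn q).take T) = none).image (Fin.cons (α := fun _ => Bool) true) := by
        intro q hq
        obtain ⟨b, q, rfl⟩ : ∃ b q', q = Fin.cons b q' := ⟨q 0, Fin.tail q, (Fin.cons_self_tail q).symm⟩
        simp only [Finset.mem_filter, Finset.mem_univ, true_and, List.ofFn_succ, Fin.cons_zero,
          Fin.cons_succ, List.take_succ_cons] at hq
        simp only [Finset.mem_union, Finset.mem_image, Finset.mem_filter, Finset.mem_univ, true_and]
        cases b
        · exact Or.inl ⟨q, by simpa [exit] using hq, rfl⟩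
        · exact Or.inr ⟨q, by simpa [exit] using hq, rfl⟩
      refine (Finset.card_le_card hsub).trans ((Finset.card_union_le _ _).trans ?_)
      have h1 := (Finset.card_image_le (f := Fin.cons (α := fun _ => Bool) false)).trans
        (hl (T := T) (m := m) (by omega))
      have h2 := (Finset.card_image_le (f := Fin.cons (α := fun _ => Bool) true)).trans
        (hr (T := T) (m := m) (by omega))
      rw [Nat.add_sub_add_right, size]
      nlinarith [Nat.zero_le (2 ^ (m - T))]

end RTree

/-! ### Stash overflow and rooted subtrees -/

/-- The largest rooted subtree that consists of full buckets. -/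
noncomputable def fullTree (T Z : ℕ) (m : VORAM) : RTree :=
  RTree.maximal (fun a => Z ≤ (m.bucket (true :: a)).size) (T + 1)

lemma mem_pathOf_cons {T : ℕ} {bs a : List Bool} :
    true :: a ∈ pathOf T (true :: bs) ↔ a <+: bs.take T := by
  rw [mem_pathOf]
  constructor
  · rintro ⟨t, ht, h⟩
    simp only [loc, List.take_succ_cons, List.cons.injEq, true_and] at h
    rw [← h, ← min_eq_left ht, ← List.take_take]
    exact List.take_prefix _ _
  · intro h
    have hl := h.length_le
    refine ⟨a.length, by simp at hl; omega, ?_⟩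
    rw [loc, List.take_succ_cons, ← List.prefix_iff_eq_take.1 (h.trans (List.take_prefix _ _))]

/-- The data in the stash and in the subtree of full buckets belongs to blocks whose exit from this
subtree has not been rewritten since they were put into the stash. -/
lemma StoreInv.stash_add_le {N : Type*} {T Z : ℕ} {live : Finset N}
    {bits : N → List Bool} {size : N → ℕ} {touched : N → Set BucketAddr} {m : VORAM}
    (h : StoreInv T Z ∅ live (fun ν => true :: bits ν) size touched m)
    (hinj : Set.InjOn bits live)
    (good : N → Prop) [DecidablePred good]
    (hgood : ∀ ν ∈ live, (∀ e, (fullTree T Z m).exit ((bits ν).take T) = some e →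
      true :: e ∉ touched ν) → good ν) :
    m.stash.size + Z * (fullTree T Z m).size ≤ ∑ ν ∈ live with good ν, size ν := by
  classical
  set t := fullTree T Z m with ht
  -- `J` contains all blocks with data in the stash or in `t`, and `q j` is the amount of this data
  set J : Finset BlockId := m.stash.support ∪ t.addrs.biUnion fun a => (m.bucket (true :: a)).support
  set q : BlockId → ℕ := fun j => m.stash j + ∑ a ∈ t.addrs, m.bucket (true :: a) j with hq
  have hsize : ∀ f : Blocks, f.support ⊆ J → f.size = ∑ j ∈ J, f j := fun f hf =>
    Finset.sum_subset hf fun j _ hj => by simpa using hj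
  have h1 : m.stash.size + Z * t.size ≤ ∑ j ∈ J, q j := by
    rw [hq, Finset.sum_add_distrib, Finset.sum_comm, hsize _ Finset.subset_union_left,
      ← RTree.card_addrs, mul_comm, ← smul_eq_mul]
    refine Nat.add_le_add_left (Finset.card_nsmul_le_sum _ _ _ fun a ha => ?_) _
    rw [← hsize]
    · exact (RTree.of_mem_maximal ha).1
    · exact (Finset.subset_biUnion_of_mem (fun a => (m.bucket (true :: a)).support) ha).trans
        Finset.subset_union_right
  have hsub : ∀ j, ∀ P : Finset BucketAddr, (∀ a ∈ t.addrs, m.bucket (true :: a) j ≠ 0 →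
      true :: a ∈ P) → q j ≤ m.stash j + ∑ a ∈ P, m.bucket a j := by
    intro j P hP
    refine Nat.add_le_add_left ?_ _
    rw [← Finset.sum_image (f := fun a => m.bucket a j) (g := List.cons true)
      (fun a _ b _ h => by simpa using h), ← Finset.sum_filter_ne_zero]
    refine Finset.sum_le_sum_of_subset fun a ha => ?_
    obtain ⟨h1, h2⟩ := Finset.mem_filter.1 ha
    obtain ⟨b, hb, rfl⟩ := Finset.mem_image.1 h1
    exact hP b hb h2
  have h2 : ∀ j, q j ≤ ∑ ν ∈ {ν ∈ live | good ν} with true :: bits ν = j, size ν := by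
    intro j
    rcases Nat.eq_zero_or_pos (q j) with h0 | hpos
    · rw [h0]; exact Nat.zero_le _
    refine (hsub j (pathOf T j) fun a _ h' => h.placed _ _ h').trans ((h.total_le j).trans ?_)
    refine Finset.sum_le_sum_of_subset fun ν hν => ?_
    obtain ⟨hνl, rfl⟩ := Finset.mem_filter.1 hν
    refine Finset.mem_filter.2 ⟨Finset.mem_filter.2 ⟨hνl, hgood ν hνl fun e he => ?_⟩, rfl⟩
    -- at its exit from `t` the path of `ν` meets a bucket that is not full
    have hmem : true :: e ∈ pathOf T (true :: bits ν) :=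
      mem_pathOf_cons.2 (RTree.exit_prefix he)
    have hnf : (m.bucket (true :: e)).size < Z := not_le.1 <|
      RTree.not_of_exit_maximal (P := fun a => Z ≤ (m.bucket (true :: a)).size)
        (d := T + 1) (by simp) he
    have habove : m.above T (true :: e) (true :: bits ν) ≠ 0 := by
      have : q (true :: bits ν) ≤ m.above T (true :: e) (true :: bits ν) := by
        refine hsub _ _ fun a ha h' => Finset.mem_filter.2 ⟨h.placed _ _ h', ?_⟩
        have := RTree.length_lt_of_mem_addrs he ha (mem_pathOf_cons.1 (h.placed _ _ h'))
        simpa using this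
      omega
    obtain ⟨ν', hν', e', hν''⟩ := h.fresh _ _ hmem (Set.notMem_empty _) hnf habove
    rwa [hinj hν' hνl (by simpa using e')] at hν''
  exact h1.trans ((Finset.sum_le_sum fun j _ => h2 j).trans
    (Finset.sum_fiberwise_le_sum_of_sum_fiber_nonneg fun _ _ => Nat.zero_le _))

/-! ### Nodes of a HIRB and their gaps -/

lemma max_filter_lt_eq_iff {α : Type*} [LinearOrder α] (s : Finset α) (g : α) (b : WithBot α) :
    (s.filter (· < g)).max = b ↔ (b = ⊥ ∨ ∃ m ∈ s, b = (m : WithBot α)) ∧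
      b < g ∧ ∀ m ∈ s, b < (m : WithBot α) → g ≤ m := by
  constructor
  · rintro rfl
    refine ⟨?_, ?_, fun m hm hlt => ?_⟩
    · rcases (s.filter (· < g)).eq_empty_or_nonempty with h | h
      · left; rw [h, Finset.max_empty]
      · obtain ⟨m, hm⟩ := Finset.max_of_nonempty h
        exact Or.inr ⟨m, (Finset.mem_filter.1 (Finset.mem_of_max hm)).1, hm⟩
    · rcases (s.filter (· < g)).eq_empty_or_nonempty with h | h
      · rw [h, Finset.max_empty]; exact WithBot.bot_lt_coe _
      · obtain ⟨m, hm⟩ := Finset.max_of_nonempty h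
        rw [hm]
        exact WithBot.coe_lt_coe.2 (Finset.mem_filter.1 (Finset.mem_of_max hm)).2
    · by_contra hgm
      exact (not_le.2 hlt) (Finset.le_max (Finset.mem_filter.2 ⟨hm, not_le.1 hgm⟩))
  · rintro ⟨h1, h2, h3⟩
    refine le_antisymm (Finset.max_le fun m hm => ?_) ?_
    · by_contra hlt
      obtain ⟨hm, hmg⟩ := Finset.mem_filter.1 hm
      exact absurd (h3 m hm (not_le.1 hlt)) (not_le.2 hmg)
    · rcases h1 with rfl | ⟨m, hm, rfl⟩
      · exact bot_le
      · exact Finset.le_max (Finset.mem_filter.2 ⟨hm, WithBot.coe_lt_coe.1 h2⟩)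

section Gaps
variable {p : VHParams}

lemma mem_separators {D : Hirb p} {l : ℕ} {g : HashVal p} :
    g ∈ separators D l ↔ ∃ j, D g = some j ∧ l < j := by
  simp [separators]

/-- `q` lies in the closed gap of node `ν`, which extends from the left boundary of `ν` to the next
separator. -/
def InGap (D : Hirb p) (ν : HNode p) (q : HashVal p) : Prop :=
  ν.2 ≤ (q : WithBot (HashVal p)) ∧
    ∀ m ∈ separators D ν.1, ν.2 < (m : WithBot (HashVal p)) → q ≤ m

lemma searchNode_eq_iff {D : Hirb p} {ν : HNode p} {g : HashVal p} :
    searchNode D ν.1 g = ν ↔ (ν.2 = ⊥ ∨ ∃ m ∈ separators D ν.1, ν.2 = (m : WithBot (HashVal p))) ∧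
      ν.2 < g ∧ ∀ m ∈ separators D ν.1, ν.2 < (m : WithBot (HashVal p)) → g ≤ m := by
  rw [← max_filter_lt_eq_iff]
  exact ⟨fun h => congrArg Prod.snd h, fun h => Prod.ext rfl h⟩

lemma isHNode_searchNode {D : Hirb p} {l : ℕ} (hl : l ≤ p.H) (g : HashVal p) :
    IsHNode D (searchNode D l g) :=
  ⟨hl, (searchNode_eq_iff (ν := searchNode D l g).1 rfl).1⟩

lemma isHNode_separator {D : Hirb p} {l : ℕ} (hl : l ≤ p.H) {g : HashVal p}
    (hg : g ∈ separators D l) : IsHNode D (l, (g : WithBot (HashVal p))) :=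
  ⟨hl, Or.inr ⟨g, hg, rfl⟩⟩

lemma searchNode_snd_lt (D : Hirb p) (l : ℕ) (g : HashVal p) : (searchNode D l g).2 < g :=
  (searchNode_eq_iff (ν := searchNode D l g).1 rfl).2.1

lemma searchNode_ne_coe (D : Hirb p) (l l' : ℕ) (g : HashVal p) :
    searchNode D l g ≠ (l', (g : WithBot (HashVal p))) := fun h =>
  (searchNode_snd_lt D l g).ne (by rw [h])

lemma not_inGap_of_untouched {D : Hirb p} {h : HashVal p} {ν : HNode p} (hν : IsHNode D ν)
    (h1 : ν.2 ≠ h) (h2 : searchNode D ν.1 h ≠ ν) : ¬ InGap D ν h := fun hc =>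
  h2 (searchNode_eq_iff.2 ⟨hν.2, lt_of_le_of_ne hc.1 h1, hc.2⟩)

section Agree
variable {D D' : Hirb p} {h : HashVal p} (hD : ∀ g, g ≠ h → D' g = D g)
include hD

lemma mem_separators_agree {l : ℕ} {g : HashVal p} (hg : g ≠ h) :
    g ∈ separators D' l ↔ g ∈ separators D l := by
  rw [mem_separators, mem_separators, hD g hg]

lemma searchNode_agree (l : ℕ) : searchNode D' l h = searchNode D l h := by
  have : (separators D' l).filter (· < h) = (separators D l).filter (· < h) := by
    ext g
    simp only [Finset.mem_filter]
    exact and_congr_left fun hg => mem_separators_agree hD hg.ne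
  rw [searchNode, searchNode, this]

lemma isHNode_agree {ν : HNode p} (h1 : ν.2 ≠ h) : IsHNode D' ν ↔ IsHNode D ν := by
  refine and_congr_right fun _ => or_congr_right (exists_congr fun g => ?_)
  constructor
  · rintro ⟨hg, e⟩
    exact ⟨(mem_separators_agree hD fun e' => h1 (by rw [e, e'])).1 hg, e⟩
  · rintro ⟨hg, e⟩
    exact ⟨(mem_separators_agree hD fun e' => h1 (by rw [e, e'])).2 hg, e⟩

lemma inGap_agree_aux {ν : HNode p} (hn : ¬ InGap D ν h) {q : HashVal p} (hq : InGap D ν q) :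
    InGap D' ν q := by
  refine ⟨hq.1, fun m hm hlt => ?_⟩
  by_cases e : m = h
  · subst e
    by_contra hqm
    exact hn ⟨hlt.le, fun m' hm' hlt' => (not_le.1 hqm).le.trans (hq.2 m' hm' hlt')⟩
  · exact hq.2 m ((mem_separators_agree hD e).1 hm) hlt

lemma not_inGap_agree {ν : HNode p} (h1 : ν.2 ≠ h) (hν : IsHNode D ν)
    (h2 : searchNode D ν.1 h ≠ ν) : ¬ InGap D' ν h := by
  refine not_inGap_of_untouched ((isHNode_agree hD h1).2 hν) h1 ?_
  rwa [searchNode_agree hD]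

/-- The gap of a node that is not accessed does not change. -/
lemma inGap_agree {ν : HNode p} (h1 : ν.2 ≠ h) (hν : IsHNode D ν)
    (h2 : searchNode D ν.1 h ≠ ν) (q : HashVal p) : InGap D' ν q ↔ InGap D ν q :=
  ⟨inGap_agree_aux (fun g hg => (hD g hg).symm) (not_inGap_agree hD h1 hν h2),
    inGap_agree_aux hD (not_inGap_of_untouched hν h1 h2)⟩

lemma blockSize_agree {ν : HNode p} (h1 : ν.2 ≠ h) (hν : IsHNode D ν)
    (h2 : searchNode D ν.1 h ≠ ν) : blockSize D' ν = blockSize D ν := by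
  have : nodeItems D' ν = nodeItems D ν := by
    ext g
    simp only [nodeItems, Finset.mem_filter, Finset.mem_univ, true_and]
    by_cases hg : g = h
    · subst hg
      rw [searchNode_agree hD]
      exact ⟨fun hc => absurd hc.2 h2, fun hc => absurd hc.2 h2⟩
    · rw [hD g hg, searchNode_eq_iff, searchNode_eq_iff]
      have h3 := inGap_agree hD h1 hν h2 g
      have h4 := (isHNode_agree hD h1).2 hν
      refine and_congr_right fun _ => ⟨fun hc => ?_, fun hc => ?_⟩
      · exact ⟨hν.2, hc.2.1, (h3.1 ⟨hc.2.1.le, hc.2.2⟩).2⟩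
      · exact ⟨h4.2, hc.2.1, (h3.2 ⟨hc.2.1.le, hc.2.2⟩).2⟩
  rw [blockSize, blockSize, this]

end Agree
end Gaps

/-! ### Which random identifiers are used -/

/-- The index of a random identifier: the number of the vORAM+HIRB operation (`0` for the
initialization), the height, and which of the three identifiers of this access it is. -/
abbrev Idx := ℕ × ℕ × Fin 3

/-- The HIRBs `D 0, D 1, …` that arise from the empty HIRB by operations with label hashes
`h 0, h 1, …`. -/
structure Trace (p : VHParams) where
  h : ℕ → HashVal p
  D : ℕ → Hirb p
  zero : D 0 = fun _ => none
  succ : ∀ k g, g ≠ h k → D (k + 1) g = D k g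

namespace Trace
variable {p : VHParams} (tr : Trace p)

open Classical in
/-- The index of the identifier of a node after `k` operations. Operations are numbered from `0` here, so
the identifiers that are assigned by operation `k` have the first index `k + 1`. -/
noncomputable def ptrIdx : ℕ → HNode p → Idx
  | 0, ν => (0, ν.1, 0)
  | k + 1, ν =>
    if ν.2 = tr.h k then (k + 1, ν.1, 1)
    else if searchNode (tr.D k) ν.1 (tr.h k) = ν then (k + 1, ν.1, 0) else ptrIdx k ν

open Classical in
/-- The indices of the two identifiers whose paths are evicted at height `l` by operation
number `k`: that of the left node, and that of the right node or of the random second path. -/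
noncomputable def evIdx (k l : ℕ) (b : Bool) : Idx :=
  if b then
    if tr.h k ∈ separators (tr.D k) l then tr.ptrIdx k (l, (tr.h k : WithBot (HashVal p)))
    else (k + 1, l, 2)
  else tr.ptrIdx k (searchNode (tr.D k) l (tr.h k))

lemma ptrIdx_level (k : ℕ) (ν : HNode p) : (tr.ptrIdx k ν).2.1 = ν.1 := by
  induction k with
  | zero => rfl
  | succ k ih => rw [ptrIdx]; split_ifs <;> simp [ih]

lemma ptrIdx_clock_le (k : ℕ) (ν : HNode p) : (tr.ptrIdx k ν).1 ≤ k := by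
  induction k with
  | zero => rfl
  | succ k ih =>
    rw [ptrIdx]
    split_ifs
    · exact le_rfl
    · exact le_rfl
    · exact ih.trans (Nat.le_succ k)

lemma ptrIdx_ne_two (k : ℕ) (ν : HNode p) : (tr.ptrIdx k ν).2.2 ≠ 2 := by
  induction k with
  | zero => simp [ptrIdx]
  | succ k ih => rw [ptrIdx]; split_ifs <;> simp [ih]

lemma evIdx_level (k l : ℕ) (b : Bool) : (tr.evIdx k l b).2.1 = l := by
  rw [evIdx]
  split_ifs
  · rw [ptrIdx_level]
  · rfl
  · rw [ptrIdx_level]; rfl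

lemma evIdx_clock_le (k l : ℕ) (b : Bool) : (tr.evIdx k l b).1 ≤ k + 1 := by
  rw [evIdx]
  split_ifs
  · exact (tr.ptrIdx_clock_le _ _).trans (Nat.le_succ k)
  · rfl
  · exact (tr.ptrIdx_clock_le _ _).trans (Nat.le_succ k)

/-- The identifiers that are evicted at time `k` are those of nodes, or a fresh one. -/
lemma evIdx_cases {k l : ℕ} (hl : l ≤ p.H) (b : Bool) :
    (∃ ν, IsHNode (tr.D k) ν ∧ (ν.2 = tr.h k ∨ searchNode (tr.D k) ν.1 (tr.h k) = ν) ∧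
      tr.evIdx k l b = tr.ptrIdx k ν) ∨ tr.evIdx k l b = (k + 1, l, 2) := by
  rw [evIdx]
  split_ifs with h1 h2
  · exact Or.inl ⟨_, isHNode_separator hl h2, Or.inl rfl, rfl⟩
  · exact Or.inr rfl
  · exact Or.inl ⟨_, isHNode_searchNode hl _, Or.inr rfl, rfl⟩

/-- A node that is not accessed by an operation keeps its identifier. -/
lemma ptrIdx_succ_cases {k : ℕ} {ν : HNode p} (hν : IsHNode (tr.D (k + 1)) ν) :
    (tr.ptrIdx (k + 1) ν).1 = k + 1 ∧ InGap (tr.D (k + 1)) ν (tr.h k) ∨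
    ν.2 ≠ tr.h k ∧ searchNode (tr.D k) ν.1 (tr.h k) ≠ ν ∧ IsHNode (tr.D k) ν ∧
      tr.ptrIdx (k + 1) ν = tr.ptrIdx k ν := by
  have hs := searchNode_agree (tr.succ k) ν.1
  rw [ptrIdx]
  split_ifs with h1 h2
  · refine Or.inl ⟨rfl, h1.le, fun m _ hlt => ?_⟩
    rw [h1, WithBot.coe_lt_coe] at hlt
    exact hlt.le
  · obtain ⟨_, h4, h5⟩ := searchNode_eq_iff.1 (hs.trans h2)
    exact Or.inl ⟨rfl, h4.le, h5⟩
  · exact Or.inr ⟨h1, h2, (isHNode_agree (tr.succ k) h1).1 hν, rfl⟩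

/-- Distinct nodes have identifiers with distinct indices. -/
lemma ptrIdx_injOn (k : ℕ) : Set.InjOn (tr.ptrIdx k) {ν | IsHNode (tr.D k) ν} := by
  induction k with
  | zero =>
    intro ν hν μ hμ h
    have hbot : ∀ ν : HNode p, IsHNode (tr.D 0) ν → ν.2 = ⊥ := by
      rintro ν ⟨_, h | ⟨g, hg, _⟩⟩
      · exact h
      · simp [mem_separators, tr.zero] at hg
    exact Prod.ext (by simpa [ptrIdx] using h) ((hbot ν hν).trans (hbot μ hμ).symm)
  | succ k ih =>
    intro ν hν μ hμ h
    have hlev : ν.1 = μ.1 := by rw [← tr.ptrIdx_level (k + 1), h, tr.ptrIdx_level]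
    have hc := fun ν => tr.ptrIdx_clock_le k ν
    have hold : ∀ ν : HNode p, IsHNode (tr.D (k + 1)) ν → ν.2 ≠ tr.h k → IsHNode (tr.D k) ν :=
      fun ν hν h => (isHNode_agree (tr.succ k) h).1 hν
    have hne : ∀ ν l c, tr.ptrIdx k ν ≠ (k + 1, l, c) := fun ν l c e => by
      have := hc ν; rw [e] at this; simp at this
    rw [ptrIdx, ptrIdx] at h
    split_ifs at h with h1 h2 h3 h4 h5 h6 h7 h8
    · exact Prod.ext hlev (h1.trans h2.symm)
    · simp at h
    · exact absurd h.symm (hne _ _ _)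
    · simp at h
    · rw [← h4, ← h6, hlev]
    · exact absurd h.symm (hne _ _ _)
    · exact absurd h (hne _ _ _)
    · exact absurd h (hne _ _ _)
    · exact ih (hold ν hν h1) (hold μ hμ (by assumption)) h

/-- An identifier whose path has been evicted is not used for any node later. -/
lemma evIdx_ne_ptrIdx {k k' l : ℕ} (hk : k < k') (hl : l ≤ p.H) (b : Bool) {ν : HNode p}
    (hν : IsHNode (tr.D k') ν) : tr.evIdx k l b ≠ tr.ptrIdx k' ν := by
  induction k', hk using Nat.le_induction generalizing ν with
  | base =>
    intro h
    have h3 := tr.ptrIdx_ne_two (k + 1) ν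
    rcases tr.evIdx_cases hl b with ⟨μ, hμ, hμ', e⟩ | e
    · rcases tr.ptrIdx_succ_cases hν with ⟨h1, _⟩ | ⟨h1, h2, hν', h4⟩
      · have := tr.ptrIdx_clock_le k μ
        rw [← e, h, h1] at this
        omega
      · rw [e, h4] at h
        obtain rfl := tr.ptrIdx_injOn k hμ hν' h
        exact hμ'.elim h1 h2
    · rw [← h, e] at h3; exact h3 rfl
  | succ k' hk' ih =>
    intro h
    rcases tr.ptrIdx_succ_cases hν with ⟨h1, _⟩ | ⟨_, _, hν', h4⟩
    · have := tr.evIdx_clock_le k l b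
      rw [h, h1] at this
      omega
    · exact ih hν' (h.trans h4)

/-- No identifier is evicted twice. -/
lemma evIdx_inj {k k' l l' : ℕ} {b b' : Bool} (hl : l ≤ p.H) (hl' : l' ≤ p.H)
    (h : tr.evIdx k l b = tr.evIdx k' l' b') : k = k' ∧ l = l' ∧ b = b' := by
  have key : ∀ {k k' l l' : ℕ} {b b' : Bool}, l ≤ p.H → l' ≤ p.H → k < k' →
      tr.evIdx k l b ≠ tr.evIdx k' l' b' := by
    intro k k' l l' b b' hl hl' hk h
    rcases tr.evIdx_cases hl' b' with ⟨μ, hμ, -, e⟩ | e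
    · exact tr.evIdx_ne_ptrIdx hk hl b hμ (h.trans e)
    · have := tr.evIdx_clock_le k l b
      rw [h, e] at this
      simp at this; omega
  have hll : l = l' := by rw [← tr.evIdx_level k l b, h, tr.evIdx_level]
  subst hll
  rcases lt_trichotomy k k' with hk | rfl | hk
  · exact absurd h (key hl hl hk)
  · refine ⟨rfl, rfl, ?_⟩
    have h2 : tr.evIdx k l true ≠ tr.evIdx k l false := by
      simp only [evIdx, if_true, Bool.false_eq_true, if_false]
      split_ifs with h3
      · intro e
        exact searchNode_ne_coe _ _ _ _
          (tr.ptrIdx_injOn k (isHNode_separator hl h3) (isHNode_searchNode hl _) e).symm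
      · intro e
        exact tr.ptrIdx_ne_two k _ (by rw [← e])
    cases b <;> cases b' <;> first | rfl | exact absurd h h2 | exact absurd h.symm h2
  · exact absurd h.symm (key hl' hl hk)

lemma init_ne_evIdx {k l l' : ℕ} (hl : l ≤ p.H) (b : Bool) :
    tr.evIdx k l b ≠ (0, l', 2) := by
  intro h
  rcases tr.evIdx_cases (k := k) hl b with ⟨μ, _, -, e⟩ | e
  · exact tr.ptrIdx_ne_two k μ (by rw [← e, h])
  · rw [h] at e; simp at e

open Classical in
/-- The block of a node was put into the stash by the last operation whose label hash lies in the
closed gap of the node. -/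
lemma ptrIdx_fst (k : ℕ) {ν : HNode p} (hν : IsHNode (tr.D k) ν) :
    (tr.ptrIdx k ν).1 = ((Finset.range k).filter fun j => InGap (tr.D k) ν (tr.h j)).sup (· + 1) := by
  induction k generalizing ν with
  | zero => simp [ptrIdx]
  | succ k ih =>
    rcases tr.ptrIdx_succ_cases hν with ⟨h1, h2⟩ | ⟨h1, h2, hν', h4⟩
    · rw [h1]
      refine le_antisymm ?_ (Finset.sup_le fun j hj => ?_)
      · exact Finset.le_sup (f := (· + 1)) (Finset.mem_filter.2 ⟨Finset.self_mem_range_succ k, h2⟩)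
      · have := Finset.mem_range.1 (Finset.mem_filter.1 hj).1
        omega
    · rw [h4, ih hν', Finset.range_add_one, Finset.filter_insert,
        if_neg (not_inGap_agree (tr.succ k) h1 hν' h2)]
      congr 1
      exact Finset.filter_congr fun j _ => (inGap_agree (tr.succ k) h1 hν' h2 _).symm

end Trace

/-! ### The invariant during a run -/

section Live
variable {p : VHParams}

open Classical in
/-- The nodes of a HIRB. -/
noncomputable def liveNodes (D : Hirb p) : Finset (HNode p) :=
  (Finset.range (p.H + 1) ×ˢ Finset.univ).filter (IsHNode D)

lemma mem_liveNodes {D : Hirb p} {ν : HNode p} : ν ∈ liveNodes D ↔ IsHNode D ν := by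
  simp only [liveNodes, Finset.mem_filter, Finset.mem_product, Finset.mem_range, Finset.mem_univ,
    and_true, and_iff_right_iff_imp]
  exact fun h => Nat.lt_succ_of_le h.1

end Live

namespace Trace
variable {p : VHParams} (tr : Trace p)

/-- The indices of the identifiers whose paths have been evicted in the initialization, in the first
`k` operations, and at the heights `≥ n` in operation number `k`, but not before the identifier with
index `i` was assigned. -/
def evSince (k n : ℕ) (i : Idx) : Set Idx :=
  {e | (∃ l ≤ p.H, e = (0, l, 2) ∧ i.1 = 0 ∧ i.2.1 ≤ l) ∨
    ∃ k' l b, l ≤ p.H ∧ (k' < k ∨ k' = k ∧ n ≤ l) ∧ e = tr.evIdx k' l b ∧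
      (i.1 < k' + 1 ∨ i.1 = k' + 1 ∧ l ≤ i.2.1)}

/-- The buckets on the paths that have been evicted since the identifier with index `i` was
assigned. -/
def touched (id : Idx → BlockId) (k n : ℕ) (i : Idx) : Set BucketAddr :=
  {a | ∃ e ∈ tr.evSince k n i, a ∈ pathOf p.T (id e)}

/-- The HIRB that is relevant for height `l` when operation number `k` has been executed at the
heights `≥ n`. -/
def mid (k n l : ℕ) : Hirb p := if l < n then tr.D k else tr.D (k + 1)

/-- The index of the identifier of node `ν` when operation number `k` has been executed at the
heights `≥ n`. -/
noncomputable def midIdx (k n : ℕ) (ν : HNode p) : Idx :=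
  if ν.1 < n then tr.ptrIdx k ν else tr.ptrIdx (k + 1) ν

open Classical in
/-- The nodes when operation number `k` has been executed at the heights `≥ n`. -/
noncomputable def midLive (k n : ℕ) : Finset (HNode p) :=
  (Finset.range (p.H + 1) ×ˢ Finset.univ).filter fun ν => IsHNode (tr.mid k n ν.1) ν

lemma mem_midLive {k n : ℕ} {ν : HNode p} :
    ν ∈ tr.midLive k n ↔ IsHNode (tr.mid k n ν.1) ν := by
  simp only [midLive, Finset.mem_filter, Finset.mem_product, Finset.mem_range, Finset.mem_univ,
    and_true, and_iff_right_iff_imp]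
  exact fun h => Nat.lt_succ_of_le h.1

/-- The invariant when operation number `k` has been executed at the heights `≥ n`. -/
structure RunInv (id : Idx → BlockId) (k n : ℕ) (s : NodeStore p) : Prop where
  ptr : ∀ ν ∈ tr.midLive k n, s.ptr ν = id (tr.midIdx k n ν)
  inv : StoreInv p.T p.Z ∅ (tr.midLive k n) s.ptr (fun ν => blockSize (tr.mid k n ν.1) ν)
    (fun ν => tr.touched id k n (tr.midIdx k n ν)) s.mem

variable {tr} {id : Idx → BlockId} {sel : SelectionRule}

lemma mid_succ_of_ne {k n l : ℕ} (h : l ≠ n) : tr.mid k (n + 1) l = tr.mid k n l := by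
  rw [mid, mid]
  have : l < n + 1 ↔ l < n := by omega
  simp only [this]

lemma midIdx_succ_of_ne {k n : ℕ} {ν : HNode p} (h : ν.1 ≠ n) :
    tr.midIdx k (n + 1) ν = tr.midIdx k n ν := by
  rw [midIdx, midIdx]
  have : ν.1 < n + 1 ↔ ν.1 < n := by omega
  simp only [this]

lemma evSince_succ {k n : ℕ} {i : Idx} {e : Idx} (he : e ∈ tr.evSince k n i) :
    e ∈ tr.evSince k (n + 1) i ∨ ∃ b, e = tr.evIdx k n b := by
  rcases he with he | ⟨k', l, b, hl, h1, rfl, h2⟩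
  · exact Or.inl (Or.inl he)
  · by_cases h3 : k' = k ∧ l = n
    · obtain ⟨rfl, rfl⟩ := h3; exact Or.inr ⟨b, rfl⟩
    · exact Or.inl (Or.inr ⟨k', l, b, hl, by omega, rfl, h2⟩)

lemma evSince_new {k n : ℕ} {c : Fin 3} {e : Idx} (he : e ∈ tr.evSince k n (k + 1, n, c)) :
    ∃ b, e = tr.evIdx k n b := by
  rcases he with ⟨l, _, _, h, _⟩ | ⟨k', l, b, hl, h1, rfl, h2⟩
  · simp at h
  · obtain ⟨rfl, rfl⟩ : k' = k ∧ l = n := by simp only at h2; omega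
    exact ⟨b, rfl⟩

lemma union_union_sdiff_sdiff {α : Type*} (s t : Set α) : (((∅ ∪ s) ∪ t) \ s) \ t = ∅ := by
  ext a
  simp only [Set.mem_sdiff, Set.mem_union, Set.mem_empty_iff_false]
  tauto

/-- The invariant is preserved by the step of an operation at height `n`. -/
lemma RunInv.pathStep (hid : ∀ i, p.T + 1 ≤ (id i).length) {k n : ℕ} (hn : n ≤ p.H)
    {s : NodeStore p} (h : tr.RunInv id k (n + 1) s) :
    tr.RunInv id k n (pathStep sel (tr.D k) (tr.D (k + 1)) (tr.h k) (id (k + 1, n, 0))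
      (id (k + 1, n, 1)) (id (k + 1, n, 2)) n s) := by
  classical
  set v₀ : HNode p := searchNode (tr.D k) n (tr.h k) with hv₀
  set v₁ : HNode p := (n, (tr.h k : WithBot (HashVal p))) with hv₁
  have hne : v₀ ≠ v₁ := searchNode_ne_coe _ _ _ _
  have hv₀1 : v₀.1 = n := rfl
  have hv₁1 : v₁.1 = n := rfl
  have hmn : tr.mid k (n + 1) n = tr.D k := by simp [mid]
  have hmn' : tr.mid k n n = tr.D (k + 1) := by simp [mid]
  have hv₀' : v₀ = searchNode (tr.D (k + 1)) n (tr.h k) := (searchNode_agree (tr.succ k) n).symm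
  have hlive₀ : v₀ ∈ tr.midLive k (n + 1) := by
    rw [mem_midLive, hv₀1, hmn]; exact isHNode_searchNode hn _
  have hsep : ∀ D : Hirb p, IsHNode D v₁ ↔ tr.h k ∈ separators D n := by
    intro D
    refine ⟨fun h => ?_, isHNode_separator hn⟩
    obtain ⟨_, h | ⟨g, hg, e⟩⟩ := h
    · simp [hv₁] at h
    · rwa [WithBot.coe_inj.1 e]
  have hlive₁ : v₁ ∈ tr.midLive k (n + 1) ↔ tr.h k ∈ separators (tr.D k) n := by
    rw [mem_midLive, hv₁1, hmn, hsep]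
  set id₀ := s.ptr v₀ with hid₀
  set id₁ := if tr.h k ∈ separators (tr.D k) n then s.ptr v₁ else id (k + 1, n, 2) with hid₁
  have e₀ : id₀ = id (tr.evIdx k n false) := by
    rw [hid₀, h.ptr _ hlive₀, midIdx, hv₀1, if_pos n.lt_succ_self]; simp [evIdx, hv₀]
  have e₁ : id₁ = id (tr.evIdx k n true) := by
    rw [hid₁]
    split_ifs with hs
    · rw [h.ptr _ (hlive₁.2 hs), midIdx, hv₁1, if_pos n.lt_succ_self]; simp [evIdx, hs, hv₁]
    · simp [evIdx, hs]
  have l₀ : p.T + 1 ≤ id₀.length := e₀ ▸ hid _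
  have l₁ : p.T + 1 ≤ id₁.length := e₁ ▸ hid _
  set S : Set BucketAddr := (∅ ∪ (pathOf p.T id₀ : Set BucketAddr)) ∪ pathOf p.T id₁ with hS
  have hSev : ∀ b, ∀ a ∈ pathOf p.T (id (tr.evIdx k n b)), a ∈ S := by
    intro b a ha
    cases b
    · rw [← e₀] at ha; exact Or.inl (Or.inr ha)
    · rw [← e₁] at ha; exact Or.inr ha
  set m₁ := (s.mem.evict p.T id₀).evict p.T id₁ with hm₁
  have I₁ : StoreInv p.T p.Z S (tr.midLive k (n + 1)) s.ptr
      (fun ν => blockSize (tr.mid k (n + 1) ν.1) ν)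
      (fun ν => tr.touched id k (n + 1) (tr.midIdx k (n + 1) ν)) m₁ := (h.inv.evict l₀).evict l₁
  -- both paths are empty now, so that removing an old block from the stash removes it completely
  have hb₀ : ∀ a ∈ pathOf p.T id₀, m₁.bucket a = 0 := by
    intro a ha
    by_cases ha₁ : a ∈ pathOf p.T id₁
    · exact VORAM.evict_bucket_of_mem ha₁
    · rw [hm₁, VORAM.evict_bucket_of_notMem ha₁]; exact VORAM.evict_bucket_of_mem ha
  have I₂ := I₁.takeStash hb₀
  set m₂ := m₁.takeStash id₀ with hm₂
  set rest := ((tr.midLive k (n + 1)).erase v₀).erase v₁ with hrest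
  set m₃ := if tr.h k ∈ separators (tr.D k) n then m₂.takeStash id₁ else m₂ with hm₃
  have I₃ : StoreInv p.T p.Z S rest s.ptr
      (fun ν => blockSize (tr.mid k (n + 1) ν.1) ν)
      (fun ν => tr.touched id k (n + 1) (tr.midIdx k (n + 1) ν)) m₃ := by
    rw [hm₃]
    by_cases hs : tr.h k ∈ separators (tr.D k) n
    · rw [if_pos hs]
      have : id₁ = s.ptr v₁ := if_pos hs
      rw [this]
      exact I₂.takeStash fun a ha => VORAM.evict_bucket_of_mem (by rwa [this])
    · rw [if_neg hs, hrest, Finset.erase_eq_of_notMem (a := v₁)]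
      · exact I₂
      · exact fun hc => hs (hlive₁.1 (Finset.mem_of_mem_erase hc))
  set ptr' := (_root_.pathStep sel (tr.D k) (tr.D (k + 1)) (tr.h k) (id (k + 1, n, 0))
      (id (k + 1, n, 1)) (id (k + 1, n, 2)) n s).ptr with hptr'
  have hp₀ : ptr' v₀ = id (k + 1, n, 0) := by
    rw [hptr']
    simp only [_root_.pathStep]
    split_ifs
    · rw [Function.update_of_ne hne, Function.update_self]
    · rw [Function.update_self]
  have hp₁ : tr.h k ∈ separators (tr.D (k + 1)) n → ptr' v₁ = id (k + 1, n, 1) := by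
    intro hs
    rw [hptr']
    simp only [_root_.pathStep, if_pos hs]
    rw [Function.update_self]
  have hpo : ∀ ν, ν ≠ v₀ → ν ≠ v₁ → ptr' ν = s.ptr ν := by
    intro ν h0 h1
    rw [hptr']
    simp only [_root_.pathStep]
    split_ifs
    · rw [Function.update_of_ne h1, Function.update_of_ne h0]
    · rw [Function.update_of_ne h0]
  have hi₀ : tr.midIdx k n v₀ = (k + 1, n, 0) := by
    rw [midIdx, hv₀1, if_neg (lt_irrefl n), ptrIdx, hv₀1, ← hv₀, if_pos rfl, if_neg]
    exact (searchNode_snd_lt _ _ _).ne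
  have hi₁ : tr.midIdx k n v₁ = (k + 1, n, 1) := by
    rw [midIdx, hv₁1, if_neg (lt_irrefl n), ptrIdx, hv₁1, if_pos rfl]
  -- nodes that are not accessed keep their identifiers and their contents
  have huntouched : ∀ ν, ν ≠ v₀ → ν ≠ v₁ → ν.1 = n → ν.2 ≠ tr.h k ∧
      searchNode (tr.D k) ν.1 (tr.h k) ≠ ν := by
    intro ν h0 h1 h2
    exact ⟨fun e => h1 (Prod.ext h2 e), fun e => h0 (by rw [← e, h2])⟩
  have hmemrest : ∀ ν, ν ≠ v₀ → ν ≠ v₁ → (ν ∈ tr.midLive k (n + 1) ↔ ν ∈ tr.midLive k n) := by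
    intro ν h0 h1
    rw [mem_midLive, mem_midLive]
    by_cases h2 : ν.1 = n
    · rw [h2, hmn, hmn']
      exact (isHNode_agree (tr.succ k) (huntouched ν h0 h1 h2).1).symm
    · rw [mid_succ_of_ne h2]
  have hrest' : ∀ ν ∈ rest, ν ≠ v₀ ∧ ν ≠ v₁ ∧ ν ∈ tr.midLive k (n + 1) := by
    intro ν hν
    simp only [hrest, Finset.mem_erase] at hν
    exact ⟨hν.2.1, hν.1, hν.2.2⟩
  have hidx : ∀ ν ∈ rest, tr.midIdx k n ν = tr.midIdx k (n + 1) ν := by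
    intro ν hν
    obtain ⟨h0, h1, -⟩ := hrest' ν hν
    by_cases h2 : ν.1 = n
    · obtain ⟨h3, h4⟩ := huntouched ν h0 h1 h2
      rw [midIdx, midIdx, h2, if_neg (lt_irrefl n), if_pos n.lt_succ_self, ptrIdx, if_neg h3,
        if_neg h4]
    · rw [midIdx_succ_of_ne h2]
  have I₄ : StoreInv p.T p.Z S rest ptr' (fun ν => blockSize (tr.mid k n ν.1) ν)
      (fun ν => tr.touched id k n (tr.midIdx k n ν)) m₃ := by
    refine I₃.congr rfl (fun ν hν => hpo ν (hrest' ν hν).1 (hrest' ν hν).2.1)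
      (fun ν hν => ?_) fun ν hν a => ?_
    · obtain ⟨h0, h1, h2⟩ := hrest' ν hν
      by_cases h3 : ν.1 = n
      · obtain ⟨h4, h5⟩ := huntouched ν h0 h1 h3
        rw [mem_midLive, h3, hmn] at h2
        simp only [h3, hmn, hmn']
        exact blockSize_agree (tr.succ k) h4 h2 h5
      · simp only [mid_succ_of_ne h3]
    · rintro ⟨e, he, ha⟩
      rw [hidx ν hν] at he
      rcases evSince_succ he with he | ⟨b, rfl⟩
      · exact Or.inl ⟨e, he, ha⟩
      · exact Or.inr (hSev b a ha)
  -- only the two paths of this step are touched after the new blocks have been put into the stash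
  have I₅ := I₄.putStash (v := v₀) (by simp [hrest, hne])
    (by
      rintro a ⟨e, he, ha⟩
      rw [hi₀] at he
      obtain ⟨b, rfl⟩ := evSince_new he
      exact hSev b a ha)
  rw [hp₀] at I₅
  simp only [hv₀1, hmn'] at I₅
  set m₄ := m₃.putStash (id (k + 1, n, 0)) (blockSize (tr.D (k + 1)) v₀) with hm₄
  set m₅ := if tr.h k ∈ separators (tr.D (k + 1)) n then
    m₄.putStash (id (k + 1, n, 1)) (blockSize (tr.D (k + 1)) v₁) else m₄ with hm₅
  have hlive₀' : v₀ ∈ tr.midLive k n := by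
    rw [mem_midLive, hv₀1, hmn', hv₀']; exact isHNode_searchNode hn _
  have hlive₁' : v₁ ∈ tr.midLive k n ↔ tr.h k ∈ separators (tr.D (k + 1)) n := by
    rw [mem_midLive, hv₁1, hmn', hsep]
  have I₆ : StoreInv p.T p.Z S (tr.midLive k n) ptr' (fun ν => blockSize (tr.mid k n ν.1) ν)
      (fun ν => tr.touched id k n (tr.midIdx k n ν)) m₅ := by
    have hins : ∀ ν, ν ≠ v₁ → (ν ∈ insert v₀ rest ↔ ν ∈ tr.midLive k n) := by
      intro ν h1
      by_cases h0 : ν = v₀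
      · subst h0; simp [hlive₀']
      · simp [hrest, h0, h1, hmemrest ν h0 h1]
    rw [hm₅]
    split_ifs with hs
    · have := I₅.putStash (v := v₁) (by simp [hrest, hne.symm])
        (by
          rintro a ⟨e, he, ha⟩
          rw [hi₁] at he
          obtain ⟨b, rfl⟩ := evSince_new he
          exact hSev b a ha)
      rw [hp₁ hs] at this
      simp only [hv₁1, hmn'] at this
      refine this.congr ?_ (fun _ _ => rfl) (fun _ _ => rfl) fun _ _ => Set.subset_union_left
      ext ν
      by_cases h1 : ν = v₁
      · subst h1; simp [hlive₁'.2 hs]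
      · rw [Finset.mem_insert, or_iff_right h1, hins ν h1]
    · refine I₅.congr ?_ (fun _ _ => rfl) (fun _ _ => rfl) fun _ _ => Set.subset_union_left
      ext ν
      by_cases h1 : ν = v₁
      · subst h1
        refine ⟨fun hc => ?_, fun hc => absurd (hlive₁'.1 hc) hs⟩
        simp [hrest, hne.symm] at hc
      · exact hins ν h1
  refine ⟨fun ν hν => ?_, ?_⟩
  · show ptr' ν = _
    by_cases h0 : ν = v₀
    · rw [h0, hp₀, hi₀]
    · by_cases h1 : ν = v₁
      · subst h1; rw [hp₁ (hlive₁'.1 hν), hi₁]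
      · have hν' := (hmemrest ν h0 h1).2 hν
        rw [hpo ν h0 h1, h.ptr ν hν', hidx]
        simp only [hrest, Finset.mem_erase]
        exact ⟨h1, h0, hν'⟩
  · have I₇ := (I₆.writeback sel l₀).writeback sel l₁
    have hempty := union_union_sdiff_sdiff (pathOf p.T id₀ : Set BucketAddr) (pathOf p.T id₁)
    rw [← hS] at hempty
    rw [hempty] at I₇
    exact I₇

/-- The invariant is preserved by an operation. -/
lemma RunInv.op (hid : ∀ i, p.T + 1 ≤ (id i).length) {k : ℕ} {s : NodeStore p}
    (h : tr.RunInv id k (p.H + 1) s) :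
    tr.RunInv id k 0 ((List.range (p.H + 1)).reverse.foldl
      (fun st l => _root_.pathStep sel (tr.D k) (tr.D (k + 1)) (tr.h k) (id (k + 1, l, 0))
        (id (k + 1, l, 1)) (id (k + 1, l, 2)) l st) s) := by
  have key : ∀ n ≤ p.H + 1, ∀ s, tr.RunInv id k n s →
      tr.RunInv id k 0 ((List.range n).reverse.foldl
      (fun st l => _root_.pathStep sel (tr.D k) (tr.D (k + 1)) (tr.h k) (id (k + 1, l, 0))
        (id (k + 1, l, 1)) (id (k + 1, l, 2)) l st) s) := by
    intro n
    induction n with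
    | zero => intro _ s h; simpa using h
    | succ n ih =>
      intro hn s h
      rw [List.range_succ, List.reverse_append, List.foldl_append]
      exact ih (by omega) _ (h.pathStep hid (by omega))
  exact key _ le_rfl s h

lemma mid_zero (k l : ℕ) : tr.mid k 0 l = tr.D (k + 1) := if_neg (Nat.not_lt_zero l)

lemma midIdx_zero (k : ℕ) (ν : HNode p) : tr.midIdx k 0 ν = tr.ptrIdx (k + 1) ν :=
  if_neg (Nat.not_lt_zero _)

lemma mid_top {k l : ℕ} (hl : l ≤ p.H) : tr.mid k (p.H + 1) l = tr.D k :=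
  if_pos (Nat.lt_succ_of_le hl)

lemma midIdx_top {k : ℕ} {ν : HNode p} (hl : ν.1 ≤ p.H) :
    tr.midIdx k (p.H + 1) ν = tr.ptrIdx k ν := if_pos (Nat.lt_succ_of_le hl)

lemma midLive_top (k : ℕ) : tr.midLive k (p.H + 1) = liveNodes (tr.D k) := by
  ext ν
  rw [mem_midLive, mem_liveNodes]
  constructor
  · intro h; rwa [mid_top h.1] at h
  · intro h; rwa [mid_top h.1]

lemma midLive_zero (k : ℕ) : tr.midLive k 0 = liveNodes (tr.D (k + 1)) := by
  ext ν
  rw [mem_midLive, mem_liveNodes, mid_zero]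

lemma evSince_top_subset {k : ℕ} {i : Idx} :
    tr.evSince (k + 1) (p.H + 1) i ⊆ tr.evSince k 0 i := by
  rintro e (he | ⟨k', l, b, hl, h1, he⟩)
  · exact Or.inl he
  · exact Or.inr ⟨k', l, b, hl, by omega, he⟩

lemma RunInv.next {k : ℕ} {s : NodeStore p} (h : tr.RunInv id k 0 s) :
    tr.RunInv id (k + 1) (p.H + 1) s := by
  have hl : tr.midLive (k + 1) (p.H + 1) = tr.midLive k 0 := by rw [midLive_top, midLive_zero]
  have hlev : ∀ ν ∈ tr.midLive k 0, ν.1 ≤ p.H := fun ν hν => by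
    rw [midLive_zero, mem_liveNodes] at hν; exact hν.1
  refine ⟨fun ν hν => ?_, ?_⟩
  · rw [hl] at hν
    rw [h.ptr ν hν, midIdx_zero, midIdx_top (hlev ν hν)]
  · refine h.inv.congr hl.symm (fun _ _ => rfl) (fun ν hν => ?_) fun ν hν a => ?_
    · simp only [mid_zero, mid_top (hlev ν hν)]
    · rintro ⟨e, he, ha⟩
      rw [midIdx_top (hlev ν hν)] at he
      rw [midIdx_zero]
      exact Or.inl ⟨e, evSince_top_subset he, ha⟩

lemma blockSize_empty (ν : HNode p) : blockSize (fun _ => none) ν = p.nodeSize 0 := by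
  simp [blockSize, nodeItems]

lemma isHNode_empty {ν : HNode p} : IsHNode (fun _ => none) ν ↔ ν.1 ≤ p.H ∧ ν.2 = ⊥ := by
  simp [IsHNode, separators]

end Trace

section Init
variable {p : VHParams}

/-- The invariant after the initialization at the heights `< n`. -/
structure InitInv (id : Idx → BlockId) (n : ℕ) (s : NodeStore p) : Prop where
  ptr : ∀ l < n, s.ptr (l, ⊥) = id (0, l, 0)
  inv : StoreInv p.T p.Z ∅ ((Finset.range n).image fun l => ((l, ⊥) : HNode p)) s.ptr
    (fun _ => p.nodeSize 0)
    (fun ν => {a | ∃ l < n, ν.1 ≤ l ∧ a ∈ pathOf p.T (id (0, l, 2))}) s.mem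

lemma InitInv.zero (id : Idx → BlockId) :
    InitInv (p := p) id 0 { ptr := fun _ => [], mem := { bucket := fun _ => 0, stash := 0 } } :=
  ⟨fun l hl => absurd hl (Nat.not_lt_zero l), ⟨fun a j h => by simp at h,
    fun j => by simp [VORAM.total], fun j a _ _ _ h => by simp [VORAM.above] at h⟩⟩

variable {L : Type*}

/-- The invariant is preserved by the insertion of the empty node of height `n`. -/
lemma InitInv.step {sel : SelectionRule} {ω : Coins p L} {id : Idx → BlockId}
    (hω : ∀ k l c, ω.idgen k l c = id (k, l, c)) (hid : ∀ i, p.T + 1 ≤ (id i).length)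
    {n : ℕ} {s : NodeStore p} (h : InitInv id n s) : InitInv id (n + 1) (initStep sel ω s n) := by
  classical
  have hp : ∀ l < n, (initStep sel ω s n).ptr (l, ⊥) = s.ptr (l, ⊥) := fun l hl => by
    simp only [initStep]
    rw [Function.update_of_ne]
    intro e
    have := congrArg Prod.fst e
    simp only at this
    omega
  have hpn : (initStep sel ω s n).ptr (n, ⊥) = id (0, n, 0) := by
    simp only [initStep, hω, Function.update_self]
  refine ⟨fun l hl => ?_, ?_⟩
  · rcases (Nat.lt_succ_iff_lt_or_eq.1 hl) with hl | rfl
    · rw [hp l hl, h.ptr l hl]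
    · exact hpn
  · have I₁ := (h.inv.evict (hid (0, n, 2))).congr (ptr' := (initStep sel ω s n).ptr)
      (size' := fun _ => p.nodeSize 0)
      (touched' := fun ν => {a | ∃ l < n + 1, ν.1 ≤ l ∧ a ∈ pathOf p.T (id (0, l, 2))}) rfl
      (fun ν hν => by
        obtain ⟨l, hl, rfl⟩ := Finset.mem_image.1 hν
        exact hp l (Finset.mem_range.1 hl)) (fun _ _ => rfl)
      (fun ν _ a => by
        rintro ⟨l, hl, hl', ha⟩
        rcases (Nat.lt_succ_iff_lt_or_eq.1 hl) with hl | rfl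
        · exact Or.inl ⟨l, hl, hl', ha⟩
        · exact Or.inr (Or.inr ha))
    have I₂ := I₁.putStash (v := ((n, ⊥) : HNode p)) (by simp)
      (by
        rintro a ⟨l, hl, hl', ha⟩
        obtain rfl : l = n := by simp only at hl'; omega
        exact Or.inr ha)
    have I₃ := I₂.writeback sel (hid (0, n, 2))
    rw [Finset.range_add_one, Finset.image_insert]
    have e : (∅ ∪ (pathOf p.T (id (0, n, 2)) : Set BucketAddr)) \ pathOf p.T (id (0, n, 2)) = ∅ := by
      simp
    rw [e, hpn] at I₃
    simp only [initStep, hω] at I₃ ⊢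
    exact I₃

end Init

/-! ### The trace of a sequence of operations -/

section TraceOf
variable {p : VHParams} {L : Type*}

/-- The HIRB operations depend on the hashes and the height coins, but not on the identifiers. -/
lemma applyHirb_congr (a : L → HashVal p) (b : L → Fin p.H → Fin p.β)
    (r r' : ℕ × ℕ × Fin 3 → Fin (2 * p.T + p.γ) → Bool) (D : Hirb p) (op : HOp L) :
    op.applyHirb ((a, b, r) : Coins p L) D = op.applyHirb ((a, b, r') : Coins p L) D := by
  cases op <;> rfl

lemma applyHirb_of_ne (ω : Coins p L) (D : Hirb p) (op : HOp L) {g : HashVal p}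
    (hg : g ≠ ω.hash op.label) : op.applyHirb ω D g = D g := by
  cases op with
  | insert x =>
    simp only [HOp.applyHirb]
    split_ifs
    · exact Function.update_of_ne hg _ _
    · rfl
  | remove x => exact Function.update_of_ne hg _ _
  | update x => rfl

/-- The hash of the label of the `k`-th operation (and `0` if there is no such operation). -/
def opHash (a : L → HashVal p) (ops : List (HOp L)) (k : ℕ) : HashVal p :=
  (ops[k]?.map fun op => a op.label).getD ⟨0, by positivity⟩

lemma opHash_of_lt (a : L → HashVal p) {ops : List (HOp L)} {k : ℕ} (hk : k < ops.length) :
    opHash a ops k = a ops[k].label := by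
  simp [opHash, hk]

/-- The HIRBs that arise from the empty HIRB by a sequence of operations. -/
noncomputable def traceOf (a : L → HashVal p) (b : L → Fin p.H → Fin p.β) (ops : List (HOp L)) :
    Trace p where
  h := opHash a ops
  D k := (ops.take k).foldl (HOp.applyHirb ((a, b, fun _ _ => false) : Coins p L)) fun _ => none
  zero := rfl
  succ k g hg := by
    rcases lt_or_ge k ops.length with hk | hk
    · rw [List.take_succ_eq_append_getElem hk, List.foldl_append]
      refine applyHirb_of_ne _ _ _ ?_
      rw [opHash_of_lt a hk] at hg
      exact hg
    · rw [List.take_of_length_le hk, List.take_of_length_le (by omega)]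

lemma traceOf_succ (a : L → HashVal p) (b : L → Fin p.H → Fin p.β)
    (r : ℕ × ℕ × Fin 3 → Fin (2 * p.T + p.γ) → Bool) {ops : List (HOp L)} {k : ℕ}
    (hk : k < ops.length) : (traceOf a b ops).D (k + 1)
      = ops[k].applyHirb ((a, b, r) : Coins p L) ((traceOf a b ops).D k) := by
  rw [applyHirb_congr a b r (fun _ _ => false)]
  simp only [traceOf]
  rw [List.take_succ_eq_append_getElem hk, List.foldl_append]
  rfl

/-- The identifier that is made from the random bits with a given index. -/
def idOf {m : ℕ} (r : Idx → Fin m → Bool) (i : Idx) : BlockId := idOfBits (r i)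

lemma length_idOf (r : Idx → Fin (2 * p.T + p.γ) → Bool) (i : Idx) :
    p.T + 1 ≤ (idOf r i).length := by
  simp only [idOf, idOfBits, List.length_cons, List.length_ofFn]; omega

/-- The invariant holds after each operation, and the tree is the one predicted by the trace. -/
lemma runInv (sel : SelectionRule) (a : L → HashVal p) (b : L → Fin p.H → Fin p.β)
    (r : ℕ × ℕ × Fin 3 → Fin (2 * p.T + p.γ) → Bool) (ops : List (HOp L)) (k : ℕ)
    (hk : k ≤ ops.length) :
    (runOps sel ((a, b, r) : Coins p L) (ops.take k)).clock = k ∧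
    (runOps sel ((a, b, r) : Coins p L) (ops.take k)).tree = (traceOf a b ops).D k ∧
    (traceOf a b ops).RunInv (idOf r) k (p.H + 1)
      (runOps sel ((a, b, r) : Coins p L) (ops.take k)).store := by
  set ω : Coins p L := (a, b, r) with hω
  have hid := length_idOf (p := p) r
  induction k with
  | zero =>
    refine ⟨rfl, rfl, ?_⟩
    have key : ∀ n, InitInv (p := p) (idOf r) n ((List.range n).foldl (initStep sel ω)
        { ptr := fun _ => [], mem := { bucket := fun _ => 0, stash := 0 } }) := by
      intro n
      induction n with
      | zero => exact InitInv.zero _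
      | succ n ih =>
        rw [List.range_succ, List.foldl_append]
        exact ih.step (fun _ _ _ => rfl) hid
    have I := key (p.H + 1)
    have hl : (traceOf a b ops).midLive 0 (p.H + 1)
        = (Finset.range (p.H + 1)).image fun l => ((l, ⊥) : HNode p) := by
      rw [Trace.midLive_top]
      ext ν
      rw [mem_liveNodes, (traceOf a b ops).zero, Trace.isHNode_empty]
      simp only [Finset.mem_image, Finset.mem_range, Nat.lt_succ_iff]
      exact ⟨fun h => ⟨ν.1, h.1, Prod.ext rfl h.2.symm⟩, by rintro ⟨l, hl, rfl⟩; exact ⟨hl, rfl⟩⟩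
    refine ⟨fun ν hν => ?_, ?_⟩
    · rw [hl] at hν
      obtain ⟨l, hl', rfl⟩ := Finset.mem_image.1 hν
      have hl' := Finset.mem_range.1 hl'
      rw [Trace.midIdx_top (Nat.lt_succ_iff.1 hl')]
      exact I.ptr l hl'
    · refine I.inv.congr hl.symm (fun _ _ => rfl) (fun ν hν => ?_) fun ν hν => ?_
      · obtain ⟨l, hl', rfl⟩ := Finset.mem_image.1 hν
        simp only [Trace.mid_top (Nat.lt_succ_iff.1 (Finset.mem_range.1 hl')),
          (traceOf a b ops).zero, Trace.blockSize_empty]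
      · obtain ⟨l, hl', rfl⟩ := Finset.mem_image.1 hν
        rw [Trace.midIdx_top (Nat.lt_succ_iff.1 (Finset.mem_range.1 hl'))]
        rintro a ⟨e, (⟨l', hl'', rfl, -, h⟩ | ⟨k', l', b', h1, h2, -, -⟩), ha⟩
        · exact Or.inl ⟨l', Nat.lt_succ_of_le hl'', h, ha⟩
        · omega
  | succ k ih =>
    obtain ⟨h1, h2, h3⟩ := ih (by omega)
    have e : runOps sel ω (ops.take (k + 1))
        = execOp sel ω (runOps sel ω (ops.take k)) ops[k] := by
      rw [List.take_succ_eq_append_getElem (by omega), runOps, List.foldl_append]; rfl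
    have hD := traceOf_succ a b r (ops := ops) (k := k) (by omega)
    rw [e]
    refine ⟨by simp [execOp, h1], ?_, ?_⟩
    · simp only [execOp, h2]; exact hD.symm
    · have I := (h3.op (sel := sel) hid).next
      have hh : (traceOf a b ops).h k = ω.hash ops[k].label := opHash_of_lt a (by omega)
      rw [hh, hD] at I
      simp only [execOp, h1, h2]
      exact I

/-- A block contributes to the load of a rooted subtree `t` only if its path stays in `t`, or if no
path that has been evicted since the block was stored leaves `t` at the same place. -/
def Stays (t : RTree) (T : ℕ) {m : ℕ} (r : Idx → Fin m → Bool) (i : Idx) (ev : Set Idx) : Prop :=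
  ∀ e, t.exit ((List.ofFn (r i)).take T) = some e →
    ∀ i' ∈ ev, t.exit ((List.ofFn (r i')).take T) ≠ some e

lemma Trace.evSince_nonempty (tr : Trace p) {k : ℕ} {ν : HNode p} (hν : ν.1 ≤ p.H) :
    (tr.evSince k (p.H + 1) (tr.ptrIdx k ν)).Nonempty := by
  have h1 := tr.ptrIdx_clock_le k ν
  have h2 := tr.ptrIdx_level k ν
  rcases Nat.eq_zero_or_pos (tr.ptrIdx k ν).1 with h0 | h0
  · exact ⟨_, Or.inl ⟨ν.1, hν, rfl, h0, h2.le⟩⟩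
  · exact ⟨_, Or.inr ⟨(tr.ptrIdx k ν).1 - 1, ν.1, true, hν, by omega, rfl, by omega⟩⟩

open Classical in
/-- If the stash overflows, then some rooted subtree has a load that exceeds its capacity by `R`. -/
lemma exists_overloaded_subtree (sel : SelectionRule) (a : L → HashVal p)
    (b : L → Fin p.H → Fin p.β) (r : ℕ × ℕ × Fin 3 → Fin (2 * p.T + p.γ) → Bool)
    (ops : List (HOp L)) (R : ℕ) (tr : Trace p) (htr : tr = traceOf a b ops) (K : ℕ)
    (hK : K = ops.length)
    (hover : StashOverflow R (runOps sel ((a, b, r) : Coins p L) ops))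
    (hcoll : ¬ IdCollision (runOps sel ((a, b, r) : Coins p L) ops)) :
    ∃ t ∈ (RTree.all (p.T + 1)).erase RTree.nil,
      R + p.Z * t.size ≤ ∑ ν ∈ liveNodes (tr.D K) with
        Stays t p.T r (tr.ptrIdx K ν) (tr.evSince K (p.H + 1) (tr.ptrIdx K ν)),
        blockSize (tr.D K) ν := by
  subst htr hK
  obtain ⟨-, h2, h3⟩ := runInv sel a b r ops ops.length le_rfl
  rw [List.take_length] at h2 h3
  set s := runOps sel ((a, b, r) : Coins p L) ops with hs
  set tr := traceOf a b ops with htr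
  set K := ops.length with hK
  have hlev : ∀ ν ∈ liveNodes (tr.D K), ν.1 ≤ p.H := fun ν hν => (mem_liveNodes.1 hν).1
  have hptr : ∀ ν ∈ liveNodes (tr.D K), s.store.ptr ν = idOf r (tr.ptrIdx K ν) := by
    intro ν hν
    rw [h3.ptr ν (by rwa [Trace.midLive_top]), Trace.midIdx_top (hlev ν hν)]
  have I : StoreInv p.T p.Z ∅ (liveNodes (tr.D K))
      (fun ν => true :: List.ofFn (r (tr.ptrIdx K ν))) (blockSize (tr.D K))
      (fun ν => tr.touched (idOf r) K (p.H + 1) (tr.ptrIdx K ν)) s.store.mem := by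
    have hl := Trace.midLive_top (tr := tr) K
    refine h3.inv.congr hl (fun ν hν => ?_) (fun ν hν => ?_) fun ν hν => ?_
    · rw [hl] at hν; rw [hptr ν hν]; rfl
    · rw [hl] at hν; rw [Trace.mid_top (hlev ν hν)]
    · rw [hl] at hν; rw [Trace.midIdx_top (hlev ν hν)]; exact Set.subset_union_left
  have hinj : Set.InjOn (fun ν => List.ofFn (r (tr.ptrIdx K ν)))
      (liveNodes (tr.D K) : Set (HNode p)) := by
    intro ν hν μ hμ h
    by_contra hne
    refine hcoll ⟨ν, μ, ?_, ?_, hne, ?_⟩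
    · rw [h2]; exact mem_liveNodes.1 hν
    · rw [h2]; exact mem_liveNodes.1 hμ
    · rw [hptr ν hν, hptr μ hμ]
      exact congrArg (List.cons true) h
  have hmain := I.stash_add_le hinj
    (fun ν => Stays (fullTree p.T p.Z s.store.mem) p.T r (tr.ptrIdx K ν)
      (tr.evSince K (p.H + 1) (tr.ptrIdx K ν)))
    (fun ν _ h e he i hi h' => h e he ⟨i, hi, mem_pathOf_cons.2 (RTree.exit_prefix h')⟩)
  have hover' : R < s.store.mem.stash.size := hover
  set t := fullTree p.T p.Z s.store.mem with ht
  refine ⟨t, Finset.mem_erase.2 ⟨fun hnil => ?_, RTree.maximal_mem_all _ _⟩, by omega⟩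
  -- an overflow with an empty subtree is impossible: some path has been evicted since each block was
  -- stored, and it left the empty subtree at the root
  rw [hnil, Finset.sum_eq_zero (s := Finset.filter _ _)] at hmain
  · omega
  · intro ν hν
    obtain ⟨hν, hst⟩ := Finset.mem_filter.1 hν
    obtain ⟨i, hi⟩ := tr.evSince_nonempty (k := K) (hlev ν hν)
    exact absurd rfl (hst [] rfl i hi)

/-- An identifier collision is a coincidence of random bits with different indices. -/
lemma exists_bits_eq_of_idCollision (sel : SelectionRule) (a : L → HashVal p)
    (b : L → Fin p.H → Fin p.β) (r : ℕ × ℕ × Fin 3 → Fin (2 * p.T + p.γ) → Bool)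
    (ops : List (HOp L)) (h : IdCollision (runOps sel ((a, b, r) : Coins p L) ops)) :
    ∃ ν ∈ liveNodes ((traceOf a b ops).D ops.length),
      ∃ μ ∈ liveNodes ((traceOf a b ops).D ops.length), ν ≠ μ ∧
      r ((traceOf a b ops).ptrIdx ops.length ν) = r ((traceOf a b ops).ptrIdx ops.length μ) := by
  obtain ⟨-, h2, h3⟩ := runInv sel a b r ops ops.length le_rfl
  rw [List.take_length] at h2 h3
  obtain ⟨ν, μ, hν, hμ, hne, e⟩ := h
  rw [h2] at hν hμ
  rw [h3.ptr ν (by rwa [Trace.midLive_top, mem_liveNodes]), Trace.midIdx_top hν.1,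
    h3.ptr μ (by rwa [Trace.midLive_top, mem_liveNodes]), Trace.midIdx_top hμ.1] at e
  exact ⟨ν, mem_liveNodes.2 hν, μ, mem_liveNodes.2 hμ, hne,
    List.ofFn_injective (List.cons_injective e)⟩

/-! ### The labels behind the stored hashes -/

open Classical in
/-- The effect of an operation on the map that sends each stored hash to the label that was inserted
for it. -/
noncomputable def HOp.applyRep (a : L → HashVal p) (ρ : HashVal p → Option L) :
    HOp L → HashVal p → Option L
  | .insert x => if ρ (a x) = none then Function.update ρ (a x) (some x) else ρ
  | .remove x => Function.update ρ (a x) none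
  | .update _ => ρ

/-- The label behind each stored hash after a sequence of operations. It depends only on the hashes:
the height of a stored hash is that of this label. -/
noncomputable def repAfter (a : L → HashVal p) (ops : List (HOp L)) : HashVal p → Option L :=
  ops.foldl (HOp.applyRep a) fun _ => none

/-- The label behind a hash evolves in the same way as its height. -/
lemma foldl_applyHirb (ω : Coins p L) (ops : List (HOp L)) (D : Hirb p) (ρ : HashVal p → Option L)
    (hD : ∀ g, D g = (ρ g).map ω.chooseHeight) (g : HashVal p) :
    ops.foldl (HOp.applyHirb ω) D g = (ops.foldl (HOp.applyRep ω.1) ρ g).map ω.chooseHeight := by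
  induction ops generalizing D ρ with
  | nil => exact hD g
  | cons op ops ih =>
    refine ih _ _ fun g => ?_
    cases op with
    | insert x =>
      have hn : D (ω.hash x) = none ↔ ρ (ω.1 x) = none := by rw [hD]; simp [Coins.hash]
      by_cases h : ρ (ω.1 x) = none
      · simp only [HOp.applyHirb, HOp.applyRep, if_pos (hn.2 h), if_pos h]
        by_cases hg : g = ω.1 x
        · subst hg; simp [Coins.hash]
        · rw [Function.update_of_ne (a' := ω.hash x) hg, Function.update_of_ne hg, hD]
      · simp only [HOp.applyHirb, HOp.applyRep, if_neg (hn.not.2 h), if_neg h]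
        exact hD g
    | remove x =>
      simp only [HOp.applyHirb, HOp.applyRep, Coins.hash]
      by_cases hg : g = ω.1 x
      · subst hg; simp
      · rw [Function.update_of_ne hg, Function.update_of_ne hg, hD]
    | update x => exact hD g

lemma traceOf_D_length (a : L → HashVal p) (b : L → Fin p.H → Fin p.β) (ops : List (HOp L))
    (g : HashVal p) : (traceOf a b ops).D ops.length g
      = (repAfter a ops g).map fun x => heightOfCoins (b x) := by
  simp only [traceOf, List.take_length]
  exact foldl_applyHirb ((a, b, fun _ _ => false) : Coins p L) ops (fun _ => none)
    (fun _ => none) (fun _ => rfl) g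

lemma repAfter_eq_some [DecidableEq L] {a : L → HashVal p} {ops : List (HOp L)} {g : HashVal p}
    {x : L} (h : repAfter a ops g = some x) :
    a x = g ∧ x ∈ labelsAfter ops ∧ ∃ op ∈ ops, op.label = x := by
  induction ops using List.reverseRecOn generalizing g x with
  | nil => simp [repAfter] at h
  | append_singleton ops op ih =>
    have e1 : repAfter a (ops ++ [op]) = op.applyRep a (repAfter a ops) := by
      simp [repAfter]
    have e2 : labelsAfter (ops ++ [op]) = HOp.applyLabels (labelsAfter ops) op := by
      simp [labelsAfter]
    have hold : ∀ {x}, (∃ op ∈ ops, op.label = x) → ∃ op' ∈ ops ++ [op], op'.label = x :=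
      fun ⟨op', h, e⟩ => ⟨op', List.mem_append_left _ h, e⟩
    rw [e1] at h
    rw [e2]
    cases op with
    | insert y =>
      simp only [HOp.applyRep] at h
      split_ifs at h with hn
      · by_cases hg : g = a y
        · subst hg
          rw [Function.update_self, Option.some.injEq] at h
          subst h
          exact ⟨rfl, Finset.mem_insert_self _ _, .insert y, by simp, rfl⟩
        · rw [Function.update_of_ne hg] at h
          obtain ⟨h1, h2, h3⟩ := ih h
          exact ⟨h1, Finset.mem_insert_of_mem h2, hold h3⟩
      · obtain ⟨h1, h2, h3⟩ := ih h
        exact ⟨h1, Finset.mem_insert_of_mem h2, hold h3⟩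
    | remove y =>
      simp only [HOp.applyRep] at h
      by_cases hg : g = a y
      · subst hg; simp at h
      · rw [Function.update_of_ne hg] at h
        obtain ⟨h1, h2, h3⟩ := ih h
        refine ⟨h1, Finset.mem_erase.2 ⟨?_, h2⟩, hold h3⟩
        rintro rfl
        exact hg h1.symm
    | update y =>
      obtain ⟨h1, h2, h3⟩ := ih h
      exact ⟨h1, h2, hold h3⟩

end TraceOf

/-! ### Random separators on a line -/

section Marks
variable {α : Type*}

/-- The expectation of `F M` for a random subset `M` of `A` that contains each element of `A`
independently with probability `ρ`. -/
noncomputable def markSum (ρ : ℝ) (A : Finset α) (F : Finset α → ℝ) : ℝ :=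
  ∑ M ∈ A.powerset, ρ ^ #M * (1 - ρ) ^ (#A - #M) * F M

lemma markSum_empty (ρ : ℝ) (F : Finset α → ℝ) : markSum ρ ∅ F = F ∅ := by simp [markSum]

lemma markSum_mono {ρ : ℝ} (h0 : 0 ≤ ρ) (h1 : ρ ≤ 1) {A : Finset α} {F G : Finset α → ℝ}
    (h : ∀ M ⊆ A, F M ≤ G M) : markSum ρ A F ≤ markSum ρ A G :=
  Finset.sum_le_sum fun M hM => mul_le_mul_of_nonneg_left (h M (Finset.mem_powerset.1 hM))
    (mul_nonneg (pow_nonneg h0 _) (pow_nonneg (by linarith) _))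

lemma markSum_add_mul (ρ : ℝ) (A : Finset α) (F G : Finset α → ℝ) (x y : ℝ) :
    x * markSum ρ A F + y * markSum ρ A G = markSum ρ A fun M => x * F M + y * G M := by
  simp only [markSum, Finset.mul_sum, ← Finset.sum_add_distrib]
  exact Finset.sum_congr rfl fun M _ => by ring

lemma markSum_mul (ρ : ℝ) (A : Finset α) (F : Finset α → ℝ) (x : ℝ) :
    (markSum ρ A fun M => x * F M) = x * markSum ρ A F := by
  simp only [markSum, Finset.mul_sum]
  exact Finset.sum_congr rfl fun M _ => by ring

variable [DecidableEq α]

lemma markSum_insert (ρ : ℝ) {A : Finset α} {q : α} (hq : q ∉ A) (F : Finset α → ℝ) :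
    markSum ρ (insert q A) F
      = ρ * markSum ρ A (fun M => F (insert q M)) + (1 - ρ) * markSum ρ A F := by
  rw [markSum, Finset.sum_powerset_insert hq, add_comm, markSum, markSum, Finset.mul_sum,
    Finset.mul_sum]
  congr 1 <;> refine Finset.sum_congr rfl fun M hM => ?_
  · have hM := Finset.mem_powerset.1 hM
    rw [Finset.card_insert_of_notMem fun h => hq (hM h), Finset.card_insert_of_notMem hq,
      Nat.add_sub_add_right]
    ring
  · have := Finset.card_le_card (Finset.mem_powerset.1 hM)
    rw [Finset.card_insert_of_notMem hq, Nat.sub_add_comm this]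
    ring

variable (pos : α → ℤ)

/-- The elements of `Q` up to the first separator in `M`. -/
def firstGap (Q M : Finset α) : Finset α := {q ∈ Q | ∀ m ∈ M, pos q ≤ pos m}

/-- The elements of `Q` from the separator `m` to the next one. -/
def nextGap (Q M : Finset α) (m : α) : Finset α :=
  {q ∈ Q | pos m ≤ pos q ∧ ∀ m' ∈ M, pos m < pos m' → pos q ≤ pos m'}

/-- The product of `f` over the closed gaps into which the separators `M` cut `Q`. -/
def gapProd (Q M : Finset α) (f : Finset α → ℝ) : ℝ :=
  f (firstGap pos Q M) * ∏ m ∈ M, f (nextGap pos Q M m)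

variable {pos}

/-- Reversal of the line does not change the gaps. -/
lemma gapProd_neg (hpos : Function.Injective pos) (Q M : Finset α) (f : Finset α → ℝ) :
    gapProd (fun q => -pos q) Q M f = gapProd pos Q M f := by
  induction M using Finset.induction_on_max_value pos generalizing Q with
  | empty => simp [gapProd, firstGap]
  | insert m₀ M hm₀ hmax ih =>
    have hlt : ∀ m ∈ M, pos m < pos m₀ := fun m hm =>
      lt_of_le_of_ne (hmax m hm) fun e => hm₀ (hpos e ▸ hm)
    have h1 : firstGap pos Q (insert m₀ M) = firstGap pos {q ∈ Q | pos q ≤ pos m₀} M := by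
      ext q; simp [firstGap, and_assoc]
    have h2 : nextGap pos Q (insert m₀ M) m₀ = firstGap (fun q => -pos q) Q (insert m₀ M) := by
      ext q
      simp only [nextGap, firstGap, Finset.mem_filter, Finset.mem_insert, forall_eq_or_imp,
        lt_irrefl, false_implies, true_and, neg_le_neg_iff]
      refine and_congr_right fun _ => and_congr_right fun h => ⟨fun _ m hm => ?_, fun _ m hm h' => ?_⟩
      · exact (hlt m hm).le.trans h
      · exact absurd h' (hlt m hm).not_gt
    have h3 : ∀ m ∈ M, nextGap pos Q (insert m₀ M) m
        = nextGap pos {q ∈ Q | pos q ≤ pos m₀} M m := by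
      intro m hm
      ext q
      simp only [nextGap, Finset.mem_filter, Finset.mem_insert, forall_eq_or_imp, hlt m hm,
        true_implies]
      tauto
    have h4 : nextGap (fun q => -pos q) Q (insert m₀ M) m₀
        = firstGap (fun q => -pos q) {q ∈ Q | pos q ≤ pos m₀} M := by
      ext q
      simp only [nextGap, firstGap, Finset.mem_filter, Finset.mem_insert, forall_eq_or_imp,
        lt_irrefl, false_implies, true_and, neg_le_neg_iff, neg_lt_neg_iff]
      rw [and_assoc]
      refine and_congr_right fun _ => and_congr_right fun h => ?_
      exact ⟨fun h' m hm => h' m hm (hlt m hm), fun h' m hm _ => h' m hm⟩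
    have h5 : ∀ m ∈ M, nextGap (fun q => -pos q) Q (insert m₀ M) m
        = nextGap (fun q => -pos q) {q ∈ Q | pos q ≤ pos m₀} M m := by
      intro m hm
      ext q
      simp only [nextGap, Finset.mem_filter, Finset.mem_insert, forall_eq_or_imp, neg_le_neg_iff,
        neg_lt_neg_iff, (hlt m hm).not_gt, false_implies, true_and]
      rw [and_assoc]
      refine and_congr_right fun _ => ⟨fun h => ⟨h.1.trans (hlt m hm).le, h⟩, fun h => h.2⟩
    have := ih {q ∈ Q | pos q ≤ pos m₀}
    rw [gapProd, gapProd] at this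
    rw [gapProd, gapProd, Finset.prod_insert hm₀, Finset.prod_insert hm₀, h1, h2, h4,
      Finset.prod_congr rfl fun m hm => congrArg f (h3 m hm),
      Finset.prod_congr rfl fun m hm => congrArg f (h5 m hm)]
    rw [this, mul_left_comm]

section Insert
variable {Q M : Finset α} {q₀ : α} (hq : ∀ q ∈ Q, pos q₀ < pos q) (hM : M ⊆ Q)
include hq hM

lemma firstGap_insert : firstGap pos (insert q₀ Q) M = insert q₀ (firstGap pos Q M) := by
  ext q
  simp only [firstGap, Finset.mem_filter, Finset.mem_insert]
  constructor
  · rintro ⟨rfl | h, h'⟩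
    · exact Or.inl rfl
    · exact Or.inr ⟨h, h'⟩
  · rintro (rfl | ⟨h, h'⟩)
    · exact ⟨Or.inl rfl, fun m hm => (hq m (hM hm)).le⟩
    · exact ⟨Or.inr h, h'⟩

lemma nextGap_insert {m : α} (hm : m ∈ M) :
    nextGap pos (insert q₀ Q) M m = nextGap pos Q M m := by
  ext q
  simp only [nextGap, Finset.mem_filter, Finset.mem_insert]
  refine and_congr_left fun h => or_iff_right ?_
  rintro rfl
  exact absurd h.1 (hq m (hM hm)).not_ge

lemma firstGap_insert_insert : firstGap pos (insert q₀ Q) (insert q₀ M) = {q₀} := by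
  ext q
  simp only [firstGap, Finset.mem_filter, Finset.mem_insert, Finset.mem_singleton,
    forall_eq_or_imp]
  constructor
  · rintro ⟨rfl | h, h', -⟩
    · rfl
    · exact absurd h' (hq q h).not_ge
  · rintro rfl
    exact ⟨Or.inl rfl, le_rfl, fun m hm => (hq m (hM hm)).le⟩

lemma nextGap_insert_insert_self :
    nextGap pos (insert q₀ Q) (insert q₀ M) q₀ = insert q₀ (firstGap pos Q M) := by
  ext q
  simp only [nextGap, firstGap, Finset.mem_filter, Finset.mem_insert, forall_eq_or_imp, lt_irrefl,
    false_implies, true_and]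
  constructor
  · rintro ⟨rfl | h, -, h'⟩
    · exact Or.inl rfl
    · exact Or.inr ⟨h, fun m hm => h' m hm (hq m (hM hm))⟩
  · rintro (rfl | ⟨h, h'⟩)
    · exact ⟨Or.inl rfl, le_rfl, fun m _ h => h.le⟩
    · exact ⟨Or.inr h, (hq q h).le, fun m hm _ => h' m hm⟩

lemma nextGap_insert_insert {m : α} (hm : m ∈ M) :
    nextGap pos (insert q₀ Q) (insert q₀ M) m = nextGap pos Q M m := by
  rw [← nextGap_insert hq hM hm]
  ext q
  simp only [nextGap, Finset.mem_filter, Finset.mem_insert, forall_eq_or_imp,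
    (hq m (hM hm)).not_gt, false_implies, true_and]

end Insert

/-- Scanning the line from right to left: if a potential `V` of the leftmost gap bounds its factor `f`
on average in each step up to a factor `φ`, then the expected product over all gaps is bounded
by the product of the `φ`. -/
lemma markSum_gaps_le {ρ μ : ℝ} (h0 : 0 ≤ ρ) (h1 : ρ ≤ 1) (hμ : 0 ≤ μ) (hpos : Function.Injective pos)
    (A : Finset α) (f V : Finset α → Finset α → ℝ) (φ : α → ℝ) (hφ : ∀ q, 0 ≤ φ q)
    (hf0 : ∀ M G, 0 ≤ f M G)
    (hf : ∀ M G q, q ∉ G → f (insert q M) G = f M G) (Q : Finset α)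
    (hnot : ∀ q₀ ∈ Q, q₀ ∉ A → ∀ M, ∀ G ⊆ Q, (∀ q ∈ G, pos q₀ < pos q) →
      V M (insert q₀ G) ≤ φ q₀ * V M G)
    (hstep : ∀ q₀ ∈ Q, q₀ ∈ A → ∀ M, ∀ G ⊆ Q, (∀ q ∈ G, pos q₀ < pos q) → q₀ ∉ M →
      ρ * (μ * (V (insert q₀ M) {q₀} * f (insert q₀ M) (insert q₀ G)))
        + (1 - ρ) * V M (insert q₀ G) ≤ φ q₀ * V M G) :
    markSum ρ {q ∈ A | q ∈ Q} (fun M => μ ^ #M *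
      (V M (firstGap pos Q M) * ∏ m ∈ M, f M (nextGap pos Q M m))) ≤ V ∅ ∅ * ∏ q ∈ Q, φ q := by
  induction Q using Finset.induction_on_min_value pos with
  | empty => simp [markSum_empty, firstGap]
  | insert q₀ Q hq₀ hmin ih =>
    have hlt : ∀ q ∈ Q, pos q₀ < pos q := fun q hq =>
      lt_of_le_of_ne (hmin q hq) fun e => hq₀ (hpos e ▸ hq)
    have hsub : Q ⊆ insert q₀ Q := Finset.subset_insert _ _
    have IH := ih (fun q hq hqA M G hG => hnot q (hsub hq) hqA M G (hG.trans hsub))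
      (fun q hq hqA M G hG => hstep q (hsub hq) hqA M G (hG.trans hsub))
    have hgap : ∀ M, firstGap pos Q M ⊆ insert q₀ Q := fun M =>
      (Finset.filter_subset _ _).trans hsub
    have hgap' : ∀ M, ∀ q ∈ firstGap pos Q M, pos q₀ < pos q := fun M q hq =>
      hlt q (Finset.mem_filter.1 hq).1
    have hpr : ∀ M : Finset α, 0 ≤ ∏ m ∈ M, f M (nextGap pos Q M m) := fun M =>
      Finset.prod_nonneg fun _ _ => hf0 _ _
    rw [Finset.prod_insert hq₀, mul_left_comm]
    refine le_trans ?_ (mul_le_mul_of_nonneg_left IH (hφ q₀))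
    rw [← markSum_mul]
    by_cases hA : q₀ ∈ A
    · have e : {q ∈ A | q ∈ insert q₀ Q} = insert q₀ {q ∈ A | q ∈ Q} := by
        ext q
        simp only [Finset.mem_filter, Finset.mem_insert]
        constructor
        · rintro ⟨h, rfl | h'⟩
          · exact Or.inl rfl
          · exact Or.inr ⟨h, h'⟩
        · rintro (rfl | ⟨h, h'⟩)
          · exact ⟨hA, Or.inl rfl⟩
          · exact ⟨h, Or.inr h'⟩
      rw [e, markSum_insert _ (by simp [hq₀]), markSum_add_mul]
      refine markSum_mono h0 h1 fun M hM => ?_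
      have hMQ : M ⊆ Q := fun m hm => (Finset.mem_filter.1 (hM hm)).2
      have hqM : q₀ ∉ M := fun h => hq₀ (hMQ h)
      have hp1 : ∏ m ∈ M, f (insert q₀ M) (nextGap pos (insert q₀ Q) (insert q₀ M) m)
          = ∏ m ∈ M, f M (nextGap pos Q M m) := Finset.prod_congr rfl fun m hm => by
        rw [nextGap_insert_insert hlt hMQ hm]
        exact hf M (nextGap pos Q M m) q₀ fun h => hq₀ (Finset.mem_filter.1 h).1
      have hp2 : ∏ m ∈ M, f M (nextGap pos (insert q₀ Q) M m)
          = ∏ m ∈ M, f M (nextGap pos Q M m) := Finset.prod_congr rfl fun m hm => by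
        rw [nextGap_insert hlt hMQ hm]
      rw [firstGap_insert hlt hMQ, firstGap_insert_insert hlt hMQ, Finset.prod_insert hqM,
        nextGap_insert_insert_self hlt hMQ, Finset.card_insert_of_notMem hqM, hp1, hp2]
      have := mul_le_mul_of_nonneg_right (hstep q₀ (Finset.mem_insert_self _ _) hA M _ (hgap M)
        (hgap' M) hqM) (mul_nonneg (pow_nonneg hμ (#M)) (hpr M))
      refine (le_of_eq ?_).trans (this.trans (le_of_eq ?_)) <;> ring
    · have e : {q ∈ A | q ∈ insert q₀ Q} = {q ∈ A | q ∈ Q} := by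
        ext q
        simp only [Finset.mem_filter, Finset.mem_insert]
        refine and_congr_right fun h => or_iff_right ?_
        rintro rfl
        exact hA h
      rw [e]
      refine markSum_mono h0 h1 fun M hM => ?_
      have hMQ : M ⊆ Q := fun m hm => (Finset.mem_filter.1 (hM hm)).2
      have hp2 : ∏ m ∈ M, f M (nextGap pos (insert q₀ Q) M m)
          = ∏ m ∈ M, f M (nextGap pos Q M m) := Finset.prod_congr rfl fun m hm => by
        rw [nextGap_insert hlt hMQ hm]
      rw [firstGap_insert hlt hMQ, hp2]
      have := mul_le_mul_of_nonneg_right (hnot q₀ (Finset.mem_insert_self _ _) hA M _ (hgap M)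
        (hgap' M)) (mul_nonneg (pow_nonneg hμ (#M)) (hpr M))
      refine (le_of_eq ?_).trans (this.trans (le_of_eq ?_)) <;> ring

/-! ### Weights of gaps -/

/-- The items in `G`: the elements of `A` that are not separators. -/
def gapItems (A M G : Finset α) : Finset α := {q ∈ G | q ∈ A ∧ q ∉ M}

variable (pos) in
/-- The items in `G` to the left of the element of `G` with the largest time `k`. -/
def leftItems (k : α → ℕ) (A M G : Finset α) : Finset α :=
  {q ∈ G | (q ∈ A ∧ q ∉ M) ∧ ∃ q' ∈ G, pos q < pos q' ∧ k q' = G.sup k}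

/-- An item is on the left of the most recently accessed element of its gap, or on the right of it,
or equal to it. -/
lemma card_gapItems_le (hpos : Function.Injective pos) (k : α → ℕ) (A M G : Finset α) :
    #(gapItems A M G) ≤ #(leftItems pos k A M G) + #(leftItems (fun q => -pos q) k A M G) + 1 := by
  rcases G.eq_empty_or_nonempty with rfl | hG
  · simp [gapItems]
  obtain ⟨q', hq', e⟩ := Finset.exists_mem_eq_sup G hG k
  have : gapItems A M G ⊆
      (leftItems pos k A M G ∪ leftItems (fun q => -pos q) k A M G) ∪ {q'} := by
    intro q hq
    obtain ⟨h1, h2⟩ := Finset.mem_filter.1 hq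
    simp only [Finset.mem_union, Finset.mem_singleton, leftItems, Finset.mem_filter]
    rcases lt_trichotomy (pos q) (pos q') with h | h | h
    · exact Or.inl (Or.inl ⟨h1, h2, q', hq', h, e.symm⟩)
    · exact Or.inr (hpos h)
    · exact Or.inl (Or.inr ⟨h1, h2, q', hq', neg_lt_neg h, e.symm⟩)
  refine (Finset.card_le_card this).trans ((Finset.card_union_le _ _).trans ?_)
  exact Nat.add_le_add (Finset.card_union_le _ _) (by simp)

lemma gapItems_insert_mark {A M G : Finset α} {q : α} (hq : q ∉ G) :
    gapItems A (insert q M) G = gapItems A M G := by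
  ext x
  simp only [gapItems, Finset.mem_filter, Finset.mem_insert, not_or]
  refine and_congr_right fun hx => and_congr_right fun _ => and_iff_right ?_
  rintro rfl
  exact hq hx

lemma leftItems_insert_mark {k : α → ℕ} {A M G : Finset α} {q : α} (hq : q ∉ G) :
    leftItems pos k A (insert q M) G = leftItems pos k A M G := by
  ext x
  simp only [leftItems, Finset.mem_filter, Finset.mem_insert, not_or]
  refine and_congr_right fun hx => and_congr_left fun _ => and_congr_right fun _ => and_iff_right ?_
  rintro rfl
  exact hq hx

section InsertItems
variable {k : α → ℕ} {A M G : Finset α} {q₀ : α} (hq : ∀ q ∈ G, pos q₀ < pos q)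
include hq

lemma leftItems_insert_of_gt (hk : G.sup k < k q₀) : leftItems pos k A M (insert q₀ G) = ∅ := by
  refine Finset.filter_eq_empty_iff.2 fun q hqG => ?_
  rintro ⟨-, q', hq', hlt, e⟩
  rw [Finset.sup_insert, sup_eq_left.2 hk.le] at e
  rcases Finset.mem_insert.1 hq' with rfl | hq'
  · rcases Finset.mem_insert.1 hqG with rfl | hqG
    · exact lt_irrefl _ hlt
    · exact absurd hlt (hq q hqG).not_gt
  · exact absurd (Finset.le_sup (f := k) hq') (by omega)

lemma card_leftItems_insert_of_lt (hk : k q₀ < G.sup k) :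
    #(leftItems pos k A M (insert q₀ G))
      = #(leftItems pos k A M G) + if q₀ ∈ A ∧ q₀ ∉ M then 1 else 0 := by
  have hs : (insert q₀ G).sup k = G.sup k := by
    rw [Finset.sup_insert, sup_eq_right.2 hk.le]
  have hG : G.Nonempty := by
    rw [Finset.nonempty_iff_ne_empty]; rintro rfl; simp at hk
  have hq₀ : q₀ ∉ G := fun h => lt_irrefl _ (hq q₀ h)
  obtain ⟨q', hq', e⟩ := Finset.exists_mem_eq_sup G hG k
  have key : ∀ q, (∃ q' ∈ insert q₀ G, pos q < pos q' ∧ k q' = G.sup k)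
      ↔ ∃ q' ∈ G, pos q < pos q' ∧ k q' = G.sup k := by
    intro q
    constructor
    · rintro ⟨q', h1, h2, h3⟩
      rcases Finset.mem_insert.1 h1 with rfl | h1
      · omega
      · exact ⟨q', h1, h2, h3⟩
    · rintro ⟨q', h1, h2⟩
      exact ⟨q', Finset.mem_insert_of_mem h1, h2⟩
  rw [leftItems, hs, Finset.filter_insert]
  simp only [key]
  have h2 : ∃ q' ∈ G, pos q₀ < pos q' ∧ k q' = G.sup k := ⟨q', hq', hq q' hq', e.symm⟩
  by_cases h1 : q₀ ∈ A ∧ q₀ ∉ M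
  · rw [if_pos ⟨h1, h2⟩, if_pos h1, Finset.card_insert_of_notMem]
    · rfl
    · simp [hq₀]
  · rw [if_neg fun h => h1 h.1, if_neg h1]; rfl

end InsertItems

/-- One step of the scan: averaging over the mark of an element that precedes the most recently accessed
element of its gap. It becomes a separator with probability `ρ`, and otherwise it is one more item of
the gap. The reserve `g` of the potential is chosen such that this does not increase the
potential: `ρ + (1 - ρ) * (z * g) ≤ g`. -/
lemma mark_average_le {ρ μ z g y X b B : ℝ} (h0 : 0 ≤ ρ) (h1 : ρ ≤ 1) (hμ : 1 ≤ μ) (hz : 1 ≤ z)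
    (hg : 1 ≤ g) (hρ : ρ + (1 - ρ) * (z * g) ≤ g) (hy0 : 0 ≤ y) (hX1 : 1 ≤ X) (hb : b ≤ B)
    (hB : 1 ≤ B) :
    ρ * (μ * (b * (1 + y * (X - 1)))) + (1 - ρ) * (1 + y * (X * (z * g) - 1))
      ≤ B * (1 + ρ * (μ - 1)) * (1 + y * (X * g - 1)) := by
  have hX0 : 0 ≤ X := zero_le_one.trans hX1
  have hzg : 1 ≤ z * g := one_le_mul_of_one_le_of_one_le hz hg
  have i1 : ρ * (1 + y * (X - 1)) + (1 - ρ) * (1 + y * (X * (z * g) - 1))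
      ≤ 1 + y * (X * g - 1) := by
    have := mul_le_mul_of_nonneg_left hρ (mul_nonneg hy0 hX0)
    have e : ρ * (1 + y * (X - 1)) + (1 - ρ) * (1 + y * (X * (z * g) - 1))
        = 1 - y + y * X * (ρ + (1 - ρ) * (z * g)) := by ring
    rw [e]
    linarith
  have i2 : 1 + y * (X - 1) ≤ 1 + y * (X * g - 1) := by
    have : X - 1 ≤ X * g - 1 := by linarith [le_mul_of_one_le_right hX0 hg]
    linarith [mul_le_mul_of_nonneg_left this hy0]
  have hW : 0 ≤ 1 + y * (X - 1) := by linarith [mul_nonneg hy0 (sub_nonneg.2 hX1)]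
  have hU : 0 ≤ 1 + y * (X * (z * g) - 1) := by
    linarith [mul_nonneg hy0 (sub_nonneg.2 (one_le_mul_of_one_le_of_one_le hX1 hzg))]
  generalize 1 + y * (X - 1) = W at *
  generalize 1 + y * (X * (z * g) - 1) = U at *
  generalize 1 + y * (X * g - 1) = V' at *
  calc ρ * (μ * (b * W)) + (1 - ρ) * U = b * (ρ * μ * W) + 1 * ((1 - ρ) * U) := by ring
    _ ≤ B * (ρ * μ * W) + B * ((1 - ρ) * U) := add_le_add
      (mul_le_mul_of_nonneg_right hb (mul_nonneg (mul_nonneg h0 (zero_le_one.trans hμ)) hW))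
      (mul_le_mul_of_nonneg_right hB (mul_nonneg (sub_nonneg.2 h1) hU))
    _ = B * ((ρ * W + (1 - ρ) * U) + ρ * (μ - 1) * W) := by ring
    _ ≤ B * (V' + ρ * (μ - 1) * V') := mul_le_mul_of_nonneg_left (add_le_add i1
      (mul_le_mul_of_nonneg_left i2 (mul_nonneg h0 (sub_nonneg.2 hμ)))) (by linarith)
    _ = B * (1 + ρ * (μ - 1)) * V' := by ring

section Bounds
variable {ρ μ a z g : ℝ} (h0 : 0 ≤ ρ) (h1 : ρ ≤ 1) (hμ : 1 ≤ μ) (ha : 1 ≤ a) (hz : 1 ≤ z)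
  (hg : 1 ≤ g) (hρ : ρ + (1 - ρ) * (z * g) ≤ g)
include h0 h1 hμ ha hz hg hρ

/-- The expected product over the gaps when the weight of a gap comes from the items to the left of its
most recently accessed element, and its probability `P` from the time of that access. An element that is
neither a separator nor the most recently accessed one of a gap costs nothing; otherwise its share of the
factors of the one or two gaps that it belongs to is `1 + (a ^ 2 * g - 1) * P`. -/
theorem markSum_left_le (hpos : Function.Injective pos) {P : ℕ → ℝ} (hP0 : ∀ i, 0 ≤ P i)
    (hP1 : ∀ i, P i ≤ 1) {k : α → ℕ} {A Q : Finset α} (hk : Set.InjOn k Q) (hk0 : ∀ q ∈ Q, 0 < k q)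
    (hAQ : A ⊆ Q) :
    markSum ρ A (fun M => μ ^ #M * gapProd pos Q M
      (fun G => 1 + P (G.sup k) * (a * z ^ #(leftItems pos k A M G) - 1)))
    ≤ (1 + P 0 * (a * g - 1)) * ((1 + ρ * (μ - 1)) ^ #A *
      ∏ q ∈ Q, (1 + (a ^ 2 * g - 1) * P (k q))) := by
  set f : Finset α → Finset α → ℝ := fun M G =>
    1 + P (G.sup k) * (a * z ^ #(leftItems pos k A M G) - 1) with hf
  -- the potential exceeds the factor of the gap by the reserve `g`
  set V : Finset α → Finset α → ℝ := fun M G =>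
    1 + P (G.sup k) * (a * g * z ^ #(leftItems pos k A M G) - 1) with hV
  set φ : α → ℝ := fun q => (1 + (a ^ 2 * g - 1) * P (k q)) *
    if q ∈ A then 1 + ρ * (μ - 1) else 1 with hφ
  have hag : 1 ≤ a * g := one_le_mul_of_one_le_of_one_le ha hg
  have hC : a * g - 1 ≤ a ^ 2 * g - 1 := by nlinarith
  have hC0 : 0 ≤ a ^ 2 * g - 1 := by linarith
  have hpow : ∀ n : ℕ, (1 : ℝ) ≤ z ^ n := fun n => one_le_pow₀ hz
  have hmono : ∀ M G, f M G ≤ V M G := fun M G => by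
    have := mul_le_mul_of_nonneg_left (mul_le_mul_of_nonneg_right
      (le_mul_of_one_le_right (by linarith) hg : a ≤ a * g)
      (by linarith [hpow #(leftItems pos k A M G)] : 0 ≤ z ^ #(leftItems pos k A M G)))
      (hP0 (G.sup k))
    simp only [hf, hV]
    linarith
  have hf1 : ∀ M G, 1 ≤ f M G := fun M G => by
    have := mul_nonneg (hP0 (G.sup k)) (by
      nlinarith [hpow #(leftItems pos k A M G)] : 0 ≤ a * z ^ #(leftItems pos k A M G) - 1)
    simp only [hf]; linarith
  have hV1 : ∀ M G, 1 ≤ V M G := fun M G => (hf1 M G).trans (hmono M G)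
  have hμ' : 1 ≤ 1 + ρ * (μ - 1) := by nlinarith
  have hφ1 : ∀ q, 1 + (a ^ 2 * g - 1) * P (k q) ≤ φ q := fun q => by
    have : 0 ≤ (a ^ 2 * g - 1) * P (k q) := mul_nonneg hC0 (hP0 _)
    simp only [hφ]
    split_ifs <;> nlinarith
  -- two cases: the new leftmost element is the most recently accessed one, or not
  have hcase : ∀ q₀ ∈ Q, ∀ G ⊆ Q, (∀ q ∈ G, pos q₀ < pos q) →
      G.sup k < k q₀ ∨ k q₀ < G.sup k := by
    intro q₀ hq₀ G hG hlt
    refine lt_or_gt_of_ne fun e => ?_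
    have hne : G.Nonempty := by
      rw [Finset.nonempty_iff_ne_empty]; rintro rfl
      have := hk0 q₀ hq₀; simp at e; omega
    obtain ⟨q', hq', e'⟩ := Finset.exists_mem_eq_sup G hne k
    have := hk (hG hq') hq₀ (by rw [← e', e])
    exact (hlt q' hq').ne (by rw [this])
  have hVgt : ∀ q₀ M G, (∀ q ∈ G, pos q₀ < pos q) → G.sup k < k q₀ →
      V M (insert q₀ G) = 1 + P (k q₀) * (a * g - 1) ∧
      f M (insert q₀ G) = 1 + P (k q₀) * (a - 1) := by
    intro q₀ M G hlt hsup
    simp only [hV, hf, leftItems_insert_of_gt hlt hsup, Finset.sup_insert, sup_eq_left.2 hsup.le,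
      Finset.card_empty, pow_zero, mul_one, and_self]
  have key := markSum_gaps_le (pos := pos) h0 h1 (zero_le_one.trans hμ) hpos A f V φ
    (fun q => (by
      have := hφ1 q
      have : 0 ≤ (a ^ 2 * g - 1) * P (k q) := mul_nonneg hC0 (hP0 _)
      linarith)) (fun M G => zero_le_one.trans (hf1 M G))
    (fun M G q hq => by simp only [hf, leftItems_insert_mark hq]) Q ?_ ?_
  · have e : {q ∈ A | q ∈ Q} = A := Finset.filter_true_of_mem fun q hq => hAQ hq
    rw [e] at key
    refine (markSum_mono h0 h1 fun M _ => ?_).trans (key.trans (le_of_eq ?_))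
    · refine mul_le_mul_of_nonneg_left ?_ (pow_nonneg (zero_le_one.trans hμ) _)
      exact mul_le_mul_of_nonneg_right (hmono M _)
        (Finset.prod_nonneg fun m _ => zero_le_one.trans (hf1 M _))
    · have : ∏ q ∈ Q, φ q = (1 + ρ * (μ - 1)) ^ #A *
          ∏ q ∈ Q, (1 + (a ^ 2 * g - 1) * P (k q)) := by
        simp only [hφ]
        rw [Finset.prod_mul_distrib, mul_comm, Finset.prod_ite_mem,
          Finset.inter_eq_right.2 hAQ, Finset.prod_const]
      rw [this]
      simp [hV, leftItems]
  · intro q₀ hq₀ hA M G hG hlt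
    refine le_trans ?_ (mul_le_mul_of_nonneg_right (hφ1 q₀) (zero_le_one.trans (hV1 M G)))
    have hp := hP0 (k q₀)
    rcases hcase q₀ hq₀ G hG hlt with hs | hs
    · rw [(hVgt q₀ M G hlt hs).1]
      have := hV1 M G
      have h2 : P (k q₀) * (a * g - 1) ≤ (a ^ 2 * g - 1) * P (k q₀) := by nlinarith
      nlinarith [mul_nonneg hC0 hp]
    · have : V M (insert q₀ G) = V M G := by
        simp only [hV, card_leftItems_insert_of_lt hlt hs, Finset.sup_insert, sup_eq_right.2 hs.le,
          hA, false_and, if_false, add_zero]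
      rw [this]
      nlinarith [hV1 M G, mul_nonneg hC0 hp]
  -- an element that may become a separator; then it belongs to the gaps on both sides
  · intro q₀ hq₀ hA M G hG hlt hqM
    have hp := hP0 (k q₀)
    have hp1 := hP1 (k q₀)
    have hφe : φ q₀ = (1 + (a ^ 2 * g - 1) * P (k q₀)) * (1 + ρ * (μ - 1)) := by
      simp only [hφ, if_pos hA]
    have hsing : V (insert q₀ M) {q₀} = 1 + P (k q₀) * (a * g - 1) := by
      have := (hVgt q₀ (insert q₀ M) ∅ (by simp) (by simpa using hk0 q₀ hq₀)).1
      simpa using this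
    rw [hφe, hsing]
    set t := P (k q₀) with ht
    have hV1' := hV1 M G
    rcases hcase q₀ hq₀ G hG hlt with hs | hs
    · rw [(hVgt q₀ M G hlt hs).1, (hVgt q₀ (insert q₀ M) G hlt hs).2, ← ht]
      have e1 : (1 + t * (a * g - 1)) * (1 + t * (a - 1)) ≤ 1 + (a ^ 2 * g - 1) * t := by
        have : t * t ≤ t := by nlinarith
        nlinarith [mul_nonneg (sub_nonneg.2 hag) (sub_nonneg.2 ha)]
      have e2 : 1 + t * (a * g - 1) ≤ 1 + (a ^ 2 * g - 1) * t := by nlinarith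
      have e3 := mul_le_mul_of_nonneg_left e1 (mul_nonneg h0 (zero_le_one.trans hμ))
      have e4 := mul_le_mul_of_nonneg_left e2 (sub_nonneg.2 h1)
      have e5 : (1 + (a ^ 2 * g - 1) * t) * (1 + ρ * (μ - 1)) * 1
          ≤ (1 + (a ^ 2 * g - 1) * t) * (1 + ρ * (μ - 1)) * V M G :=
        mul_le_mul_of_nonneg_left hV1' (mul_nonneg (by nlinarith) (by linarith))
      nlinarith
    · set c := #(leftItems pos k A M G) with hc
      set y := P (G.sup k) with hy
      have hy0 : 0 ≤ y := hP0 _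
      have e1 : f (insert q₀ M) (insert q₀ G) = 1 + y * (a * z ^ c - 1) := by
        simp only [hf, card_leftItems_insert_of_lt hlt hs, Finset.sup_insert, sup_eq_right.2 hs.le,
          leftItems_insert_mark (fun h => lt_irrefl _ (hlt q₀ h)), Finset.mem_insert_self,
          not_true_eq_false, and_false, if_false, add_zero, ← hc, ← hy]
      have e2 : V M (insert q₀ G) = 1 + y * (a * g * z ^ (c + 1) - 1) := by
        simp only [hV, card_leftItems_insert_of_lt hlt hs, Finset.sup_insert, sup_eq_right.2 hs.le,
          if_pos (And.intro hA hqM), ← hc, ← hy]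
      have e3 : V M G = 1 + y * (a * g * z ^ c - 1) := rfl
      rw [e1, e2, e3]
      set X := a * z ^ c with hX
      have hX1 : 1 ≤ X := one_le_mul_of_one_le_of_one_le ha (hpow c)
      have e4 : a * g * z ^ c = X * g := by rw [hX]; ring
      have e5 : a * g * z ^ (c + 1) = X * (z * g) := by rw [hX]; ring
      rw [e4, e5]
      have i4 : 1 + t * (a * g - 1) ≤ 1 + (a ^ 2 * g - 1) * t := by
        linarith [mul_le_mul_of_nonneg_left hC hp]
      exact mark_average_le h0 h1 hμ hz hg hρ hy0 hX1 i4
        (by linarith [mul_nonneg hC0 hp])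

/-- The expected product over the gaps when all items of a gap count, with a fixed probability. -/
theorem markSum_items_le (hpos : Function.Injective pos) {δ : ℝ} (hδ : 0 ≤ δ) {A Q : Finset α}
    (hAQ : A ⊆ Q) :
    markSum ρ A (fun M => μ ^ #M * gapProd pos Q M
      (fun G => 1 + δ * (a * z ^ #(gapItems A M G) - 1)))
    ≤ (1 + δ * (a * g - 1)) * (1 + ρ * (μ * (1 + δ * (a * g - 1)) - 1)) ^ #A := by
  set f : Finset α → Finset α → ℝ := fun M G =>
    1 + δ * (a * z ^ #(gapItems A M G) - 1) with hf
  set V : Finset α → Finset α → ℝ := fun M G =>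
    1 + δ * (a * g * z ^ #(gapItems A M G) - 1) with hV
  have hag : 1 ≤ a * g := one_le_mul_of_one_le_of_one_le ha hg
  set η := μ * (1 + δ * (a * g - 1)) with hη
  have hη1 : 1 ≤ η := one_le_mul_of_one_le_of_one_le hμ (by nlinarith)
  set φ : α → ℝ := fun q => if q ∈ A then 1 + ρ * (η - 1) else 1 with hφ
  have hpow : ∀ n : ℕ, (1 : ℝ) ≤ z ^ n := fun n => one_le_pow₀ hz
  have hf1 : ∀ M G, 1 ≤ f M G := fun M G => by
    have := mul_nonneg hδ (by
      nlinarith [hpow #(gapItems A M G)] : 0 ≤ a * z ^ #(gapItems A M G) - 1)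
    simp only [hf]; linarith
  have hmono : ∀ M G, f M G ≤ V M G := fun M G => by
    have := mul_le_mul_of_nonneg_left (mul_le_mul_of_nonneg_right
      (le_mul_of_one_le_right (by linarith) hg : a ≤ a * g)
      (by linarith [hpow #(gapItems A M G)] : 0 ≤ z ^ #(gapItems A M G))) hδ
    simp only [hf, hV]
    linarith
  have hη' : 1 ≤ 1 + ρ * (η - 1) := by nlinarith
  have key := markSum_gaps_le (pos := pos) h0 h1 (zero_le_one.trans hμ) hpos A f V φ
    (fun q => by simp only [hφ]; split_ifs <;> linarith)
    (fun M G => zero_le_one.trans (hf1 M G))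
    (fun M G q hq => by simp only [hf, gapItems_insert_mark hq]) Q ?_ ?_
  · have e : {q ∈ A | q ∈ Q} = A := Finset.filter_true_of_mem fun q hq => hAQ hq
    rw [e] at key
    refine (markSum_mono h0 h1 fun M _ => ?_).trans (key.trans (le_of_eq ?_))
    · refine mul_le_mul_of_nonneg_left ?_ (pow_nonneg (zero_le_one.trans hμ) _)
      exact mul_le_mul_of_nonneg_right (hmono M _)
        (Finset.prod_nonneg fun m _ => zero_le_one.trans (hf1 M _))
    · have : ∏ q ∈ Q, φ q = (1 + ρ * (η - 1)) ^ #A := by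
        simp only [hφ]
        rw [Finset.prod_ite_mem, Finset.inter_eq_right.2 hAQ, Finset.prod_const]
      rw [this]
      simp [hV, gapItems]
  · intro q₀ _ hA M G _ _
    have : gapItems A M (insert q₀ G) = gapItems A M G := by
      rw [gapItems, Finset.filter_insert, if_neg fun h => hA h.1]; rfl
    simp only [hφ, hV, if_neg hA, this, one_mul, le_refl]
  · intro q₀ _ hA M G _ hlt hqM
    have hq₀ : q₀ ∉ G := fun h => lt_irrefl _ (hlt q₀ h)
    have e1 : gapItems A (insert q₀ M) (insert q₀ G) = gapItems A M G := by
      rw [← gapItems_insert_mark (M := M) hq₀, gapItems, Finset.filter_insert, if_neg (by simp)]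
      rfl
    have e2 : #(gapItems A M (insert q₀ G)) = #(gapItems A M G) + 1 := by
      rw [gapItems, Finset.filter_insert, if_pos ⟨hA, hqM⟩, Finset.card_insert_of_notMem]
      · rfl
      · simp [hq₀]
    have e3 : gapItems A (insert q₀ M) {q₀} = ∅ := by
      rw [gapItems, Finset.filter_singleton, if_neg (by simp)]
    simp only [hφ, hV, hf, if_pos hA, e1, e2, e3, Finset.card_empty, pow_zero, mul_one]
    set X := a * z ^ #(gapItems A M G) with hX
    have hX1 : 1 ≤ X := one_le_mul_of_one_le_of_one_le ha (hpow _)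
    have e4 : a * g * z ^ #(gapItems A M G) = X * g := by rw [hX]; ring
    have e5 : a * g * z ^ (#(gapItems A M G) + 1) = X * (z * g) := by rw [hX]; ring
    rw [e4, e5]
    have := mark_average_le (μ := η) (b := 1) (B := 1) h0 h1 hη1 hz hg hρ hδ hX1 le_rfl le_rfl
    refine (le_of_eq ?_).trans (this.trans (le_of_eq ?_)) <;> rw [hη] <;> ring

end Bounds
end Marks

/-! ### Averages over finite families of independent uniform choices -/

section Averages
variable {I J B : Type*} [Fintype I] [Fintype J] [Fintype B]

lemma expect_univ_prod (F : I × J → ℝ) : 𝔼 x, F x = 𝔼 i, 𝔼 j, F (i, j) := by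
  rw [← Finset.univ_product_univ, Finset.expect_product]

/-- Only the choices that matter need to be averaged over. -/
lemma expect_comp_injective [DecidableEq I] [DecidableEq J] [Nonempty B] {Φ : J → I} (hΦ : Function.Injective Φ)
    (F : (J → B) → ℝ) : 𝔼 r : I → B, F (r ∘ Φ) = 𝔼 s : J → B, F s := by
  classical
  let e : (I → B) ≃ (J → B) × ({i // i ∉ Set.range Φ} → B) :=
    (Equiv.piEquivPiSubtypeProd (fun i => i ∈ Set.range Φ) fun _ => B).trans
      (Equiv.prodCongr ((Equiv.ofInjective Φ hΦ).arrowCongr (Equiv.refl B)).symm (Equiv.refl _))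
  have he : ∀ r, F (r ∘ Φ) = F (e r).1 := fun r => rfl
  rw [Fintype.expect_equiv e (fun r => F (r ∘ Φ)) (fun x => F x.1) he, expect_univ_prod]
  simp only [Fintype.expect_const]

lemma expect_prod_pi [DecidableEq J] (h : J → B → ℝ) : 𝔼 s : J → B, ∏ j, h j (s j) = ∏ j, 𝔼 b, h j b := by
  simp only [Fintype.expect_eq_sum_div_card]
  rw [Finset.prod_div_distrib, Finset.prod_univ_sum, Fintype.piFinset_univ]
  simp

lemma expect_fin_cons {n : ℕ} (F : (Fin (n + 1) → B) → ℝ) :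
    𝔼 c, F c = 𝔼 b, 𝔼 c', F (Fin.cons b c' : Fin (n + 1) → B) := by
  classical
  rw [← expect_univ_prod fun x : B × (Fin n → B) => F (Fin.cons x.1 x.2)]
  exact (Fintype.expect_equiv (Fin.consEquiv fun _ => B) _ _ fun _ => rfl).symm

lemma expect_boole_mul_add [Nonempty B] (p : B → Prop) [DecidablePred p] (x y : ℝ) :
    𝔼 b, (if p b then x else y) = (𝔼 b, if p b then (1 : ℝ) else 0) * x
      + (1 - 𝔼 b, if p b then (1 : ℝ) else 0) * y := by
  have : ∀ b, (if p b then x else y) = (if p b then (1 : ℝ) else 0) * (x - y) + y := by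
    intro b; split_ifs <;> ring
  simp only [this, Finset.expect_add_distrib, ← Finset.expect_mul, Fintype.expect_const]
  ring

end Averages

section Columns
variable {α : Type*} {β : ℕ}

/-- The elements of `A` whose coins in the first `l` columns are all `0`. -/
def survivors {n : ℕ} (c : Fin n → α → Fin β) (A : Finset α) (l : ℕ) : Finset α :=
  {g ∈ A | ∀ i : Fin n, (i : ℕ) < l → (c i g : ℕ) = 0}

lemma survivors_zero {n : ℕ} (c : Fin n → α → Fin β) (A : Finset α) : survivors c A 0 = A := by
  simp [survivors]

lemma survivors_cons {n : ℕ} (c₀ : α → Fin β) (c : Fin n → α → Fin β) (A : Finset α) (l : ℕ) :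
    survivors (Fin.cons c₀ c : Fin (n + 1) → α → Fin β) A (l + 1)
      = survivors c {g ∈ A | (c₀ g : ℕ) = 0} l := by
  ext g
  simp only [survivors, Finset.mem_filter, Fin.forall_fin_succ, Fin.cons_zero, Fin.cons_succ,
    Fin.val_zero, Fin.val_succ, add_lt_add_iff_right, Nat.zero_lt_succ, true_implies, and_assoc]

variable [Fintype α] [DecidableEq α]

lemma expect_eq_zero_coin (hβ : 0 < β) :
    𝔼 c : Fin β, (if (c : ℕ) = 0 then (1 : ℝ) else 0) = 1 / β := by
  have : NeZero β := ⟨hβ.ne'⟩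
  rw [Fintype.expect_eq_sum_div_card, Fintype.card_fin]
  congr 1
  rw [Finset.sum_eq_single (0 : Fin β)]
  · simp
  · intro b _ hb
    rw [if_neg fun h => hb (Fin.ext (by simpa using h))]
  · simp

/-- One column of height coins marks each element of `A` with probability `1 / β`. -/
lemma expect_column (hβ : 0 < β) (A : Finset α) (F : Finset α → ℝ) :
    𝔼 c : α → Fin β, F {g ∈ A | (c g : ℕ) = 0} = markSum (1 / β) A F := by
  have : Nonempty (Fin β) := ⟨⟨0, hβ⟩⟩
  have h1 : ∀ c : α → Fin β, F {g ∈ A | (c g : ℕ) = 0} = ∑ M ∈ A.powerset,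
      (∏ g, if g ∈ A then if g ∈ M then if (c g : ℕ) = 0 then (1 : ℝ) else 0
        else if (c g : ℕ) = 0 then 0 else 1 else 1) * F M := by
    intro c
    rw [Finset.sum_eq_single {g ∈ A | (c g : ℕ) = 0}]
    · rw [Finset.prod_eq_one, one_mul]
      intro g _
      by_cases hA : g ∈ A <;> by_cases hc : (c g : ℕ) = 0 <;> simp [hA, hc]
    · intro M hM hne
      rw [Finset.mem_powerset] at hM
      obtain ⟨g, hg⟩ : ∃ g, ¬ (g ∈ M ↔ g ∈ ({g ∈ A | (c g : ℕ) = 0} : Finset α)) := by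
        by_contra! h
        exact hne (Finset.ext h)
      rw [Finset.prod_eq_zero (Finset.mem_univ g), zero_mul]
      have hA : g ∈ A := by
        by_contra hA
        exact hg (iff_of_false (fun h => hA (hM h)) (by simp [hA]))
      by_cases hc : (c g : ℕ) = 0 <;> simp [hA, hc] at hg ⊢ <;> simp [hg]
    · intro h
      exact absurd (Finset.mem_powerset.2 (Finset.filter_subset _ _)) h
  simp only [h1, Finset.expect_sum_comm, ← Finset.expect_mul]
  rw [markSum]
  refine Finset.sum_congr rfl fun M hM => ?_
  rw [Finset.mem_powerset] at hM
  congr 1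
  rw [expect_prod_pi fun g (b : Fin β) => if g ∈ A then if g ∈ M then
    if (b : ℕ) = 0 then (1 : ℝ) else 0 else if (b : ℕ) = 0 then 0 else 1 else 1]
  have h2 : ∀ g : α, (𝔼 b : Fin β, if g ∈ A then if g ∈ M then
      if (b : ℕ) = 0 then (1 : ℝ) else 0 else if (b : ℕ) = 0 then 0 else 1 else 1)
      = if g ∈ A then if g ∈ M then (1 / β : ℝ) else 1 - 1 / β else 1 := by
    intro g
    split_ifs
    · exact expect_eq_zero_coin hβ
    · rw [expect_boole_mul_add, expect_eq_zero_coin hβ]; ring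
    · exact Fintype.expect_const _
  simp only [h2]
  rw [Finset.prod_ite_mem, Finset.univ_inter, Finset.prod_ite, Finset.prod_const, Finset.prod_const]
  congr 3
  · rw [Finset.filter_mem_eq_inter, Finset.inter_eq_right.2 hM]
  · rw [← Finset.card_sdiff_of_subset hM]
    congr 1
    ext g; simp

/-- If the factor of each level is bounded on average over the next column of coins, up to a change of
the base `μ`, then the expected product over all levels is bounded. -/
lemma expect_levels_le (hβ : 0 < β) {n : ℕ} (F : ℕ → Finset α → Finset α → ℝ) (C μ : ℕ → ℝ)
    (hF : ∀ l A M, 0 ≤ F l A M) (hC : ∀ l, 0 ≤ C l) (A : Finset α)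
    (hstep : ∀ l < n, ∀ A' ⊆ A, markSum (1 / β) A' (fun M => μ (l + 1) ^ #M * F l A' M)
      ≤ C l * μ l ^ #A')
    (hroot : ∀ A' ⊆ A, F n A' ∅ ≤ C n * μ n ^ #A') :
    𝔼 c : Fin n → α → Fin β, ((∏ l ∈ Finset.range n, F l (survivors c A l) (survivors c A (l + 1)))
      * F n (survivors c A n) ∅) ≤ (∏ l ∈ Finset.range (n + 1), C l) * μ 0 ^ #A := by
  have : Nonempty (Fin β) := ⟨⟨0, hβ⟩⟩
  have hβ1 : (1 / β : ℝ) ≤ 1 := by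
    rw [div_le_one (by exact_mod_cast hβ)]; exact_mod_cast hβ
  induction n generalizing F C μ A with
  | zero => simpa [survivors_zero] using hroot A subset_rfl
  | succ n ih =>
    rw [expect_fin_cons]
    simp only [Finset.prod_range_succ' _ n, survivors_cons, survivors_zero]
    have h1 : ∀ c₀ : α → Fin β, (𝔼 c' : Fin n → α → Fin β,
        (∏ l ∈ Finset.range n, F (l + 1) (survivors c' {g ∈ A | (c₀ g : ℕ) = 0} l)
          (survivors c' {g ∈ A | (c₀ g : ℕ) = 0} (l + 1))) * F 0 A {g ∈ A | (c₀ g : ℕ) = 0}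
          * F (n + 1) (survivors c' {g ∈ A | (c₀ g : ℕ) = 0} n) ∅)
        ≤ (∏ l ∈ Finset.range (n + 1), C (l + 1)) *
          (μ 1 ^ #{g ∈ A | (c₀ g : ℕ) = 0} * F 0 A {g ∈ A | (c₀ g : ℕ) = 0}) := by
      intro c₀
      have := ih (fun l => F (l + 1)) (fun l => C (l + 1)) (fun l => μ (l + 1))
        (fun l => hF (l + 1)) (fun l => hC (l + 1)) {g ∈ A | (c₀ g : ℕ) = 0}
        (fun l hl A' hA' => hstep (l + 1) (by omega) A' (hA'.trans (Finset.filter_subset _ _)))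
        (fun A' hA' => hroot A' (hA'.trans (Finset.filter_subset _ _)))
      have := mul_le_mul_of_nonneg_right this (hF 0 A {g ∈ A | (c₀ g : ℕ) = 0})
      rw [Finset.expect_mul] at this
      refine le_trans (le_of_eq ?_) (this.trans (le_of_eq (mul_assoc _ _ _)))
      exact Finset.expect_congr rfl fun c' _ => by ring
    refine (Finset.expect_le_expect fun c₀ _ => h1 c₀).trans ?_
    rw [← Finset.mul_expect, expect_column hβ A fun M => μ 1 ^ #M * F 0 A M,
      Finset.prod_range_succ' _ (n + 1), mul_assoc]
    exact mul_le_mul_of_nonneg_left (hstep 0 (by omega) A subset_rfl)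
      (Finset.prod_nonneg fun l _ => hC _)

end Columns

/-! ### A potential for random evictions -/

section Potential
variable {B E : Type*} [DecidableEq E] (ex : B → Option E)

/-- The exits in `U` that have not been taken by the first `n` evicted paths. -/
def openExits {N : ℕ} (q : Fin N → B) (U : Finset E) (n : ℕ) : Finset E :=
  {e ∈ U | ∀ i : Fin N, (i : ℕ) < n → ex (q i) ≠ some e}

lemma openExits_anti {N : ℕ} (q : Fin N → B) (U : Finset E) {m n : ℕ} (h : m ≤ n) :
    openExits ex q U n ⊆ openExits ex q U m := fun e he => by
  obtain ⟨h1, h2⟩ := Finset.mem_filter.1 he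
  exact Finset.mem_filter.2 ⟨h1, fun i hi => h2 i (hi.trans_le h)⟩

lemma openExits_cons {N : ℕ} (b : B) (q : Fin N → B) (U : Finset E) (n : ℕ) :
    openExits ex (Fin.cons b q : Fin (N + 1) → B) U (n + 1)
      = openExits ex q {e ∈ U | ex b ≠ some e} n := by
  ext g
  simp only [openExits, Finset.mem_filter, Fin.forall_fin_succ, Fin.cons_zero, Fin.cons_succ,
    Fin.val_zero, Fin.val_succ, add_lt_add_iff_right, Nat.zero_lt_succ, true_implies, and_assoc]

variable [Fintype B]

/-- The probability that a random path leaves by an exit in `U`. -/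
noncomputable def exitProb (U : Finset E) : ℝ := 𝔼 b, if ∃ e ∈ U, ex b = some e then 1 else 0

lemma exitProb_nonneg (U : Finset E) : 0 ≤ exitProb ex U :=
  Finset.expect_nonneg fun b _ => by split_ifs <;> norm_num

lemma exitProb_le_one [Nonempty B] (U : Finset E) : exitProb ex U ≤ 1 :=
  Finset.expect_le Finset.univ_nonempty fun b _ => by split_ifs <;> norm_num

lemma exitProb_mono {U V : Finset E} (h : U ⊆ V) : exitProb ex U ≤ exitProb ex V := by
  refine Finset.expect_le_expect fun b _ => ?_
  split_ifs with h1 h2 h2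
  · exact le_rfl
  · obtain ⟨e, he, h3⟩ := h1
    exact absurd ⟨e, h he, h3⟩ h2
  · exact zero_le_one
  · exact le_rfl

/-- The number of untaken exits is a potential: it pays for the probability of leaving by
an untaken exit, summed over time. Each step takes an untaken exit with the current probability `P`, and
then the potential `κ ^ #U` drops by the factor `κ`; this suffices as
`(1 + D * P) * (1 - P * (1 - 1 / κ)) ≤ 1`. -/
lemma expect_openExits_le [Nonempty B] {D κ : ℝ} (hD : 0 ≤ D) (hκ : 1 ≤ κ) (hDκ : D * κ ≤ κ - 1)
    (N : ℕ) (U : Finset E) :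
    𝔼 q : Fin N → B, ∏ n ∈ Finset.range N, (1 + D * exitProb ex (openExits ex q U (n + 1)))
      ≤ κ ^ #U := by
  have hκ0 : 0 < κ := by linarith
  induction N generalizing U with
  | zero => simpa using one_le_pow₀ hκ
  | succ N ih =>
    rw [expect_fin_cons]
    simp only [Finset.prod_range_succ' _ N, openExits_cons]
    set P := exitProb ex U with hP
    have hP0 : 0 ≤ P := exitProb_nonneg ex U
    have hP1 : P ≤ 1 := exitProb_le_one ex U
    have hstep : ∀ b, (𝔼 q : Fin N → B,
        (∏ n ∈ Finset.range N,
          (1 + D * exitProb ex (openExits ex q {e ∈ U | ex b ≠ some e} (n + 1))))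
          * (1 + D * exitProb ex (openExits ex q {e ∈ U | ex b ≠ some e} 0)))
        ≤ (1 + D * P) * if ∃ e ∈ U, ex b = some e then κ ^ #U / κ else κ ^ #U := by
      intro b
      have hsub : {e ∈ U | ex b ≠ some e} ⊆ U := Finset.filter_subset _ _
      have h0 : ∀ q : Fin N → B, openExits ex q {e ∈ U | ex b ≠ some e} 0
          = {e ∈ U | ex b ≠ some e} := fun q => by
        simp [openExits, Finset.filter_filter]
      simp only [h0, ← Finset.expect_mul]
      have hcard : κ ^ #{e ∈ U | ex b ≠ some e}
          ≤ if ∃ e ∈ U, ex b = some e then κ ^ #U / κ else κ ^ #U := by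
        split_ifs with h
        · obtain ⟨e, he, h⟩ := h
          have : #{e ∈ U | ex b ≠ some e} + 1 ≤ #U :=
            Finset.card_lt_card (Finset.filter_ssubset.2 ⟨e, he, by simp [h]⟩)
          rw [le_div_iff₀ hκ0, ← pow_succ]
          exact pow_le_pow_right₀ hκ this
        · exact pow_le_pow_right₀ hκ (Finset.card_le_card hsub)
      rw [mul_comm]
      refine mul_le_mul ?_ ((ih _).trans hcard) ?_ (by positivity)
      · have := mul_le_mul_of_nonneg_left (exitProb_mono ex hsub) hD
        linarith
      · refine Finset.expect_nonneg fun q _ => Finset.prod_nonneg fun n _ => ?_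
        have := mul_nonneg hD (exitProb_nonneg ex
          (openExits ex q {e ∈ U | ex b ≠ some e} (n + 1)))
        linarith
    refine (Finset.expect_le_expect fun b _ => hstep b).trans ?_
    rw [← Finset.mul_expect, expect_boole_mul_add]
    change (1 + D * P) * (P * (κ ^ #U / κ) + (1 - P) * κ ^ #U) ≤ κ ^ #U
    have e : (1 + D * P) * (P * (κ ^ #U / κ) + (1 - P) * κ ^ #U)
        = κ ^ #U * ((1 + D * P) * (1 - P * (1 - 1 / κ))) := by field_simp; ring
    rw [e]
    refine mul_le_of_le_one_right (by positivity) ?_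
    have hD' : D ≤ 1 - 1 / κ := by
      rw [le_sub_iff_add_le, ← sub_nonneg]
      have : 1 - (D + 1 / κ) = (κ - 1 - D * κ) / κ := by field_simp; ring
      rw [this]
      exact div_nonneg (by linarith) hκ0.le
    have h1 : P * (1 - 1 / κ) ≥ P * D := mul_le_mul_of_nonneg_left hD' hP0
    have h2 : 0 ≤ 1 + D * P := by positivity
    calc (1 + D * P) * (1 - P * (1 - 1 / κ)) ≤ (1 + D * P) * (1 - P * D) :=
          mul_le_mul_of_nonneg_left (by linarith) h2
      _ = 1 - (D * P) ^ 2 := by ring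
      _ ≤ 1 := by linarith [sq_nonneg (D * P)]

end Potential

/-! ### The expected product over all nodes -/

section LevelProducts
variable {α : Type*} {pos : α → ℤ} {β H : ℕ} {a z g : ℝ}

/-- The product over the gaps of all levels `0, …, H` when the heights are given by the coins `c`; the
factor of the gap `G` of a level `l` with the elements `A` of height `≥ l` and the separators `M` is
`f l A M G`. -/
def levelProd (pos : α → ℤ) (Q A : Finset α) (f : ℕ → Finset α → Finset α → Finset α → ℝ)
    (c : Fin H → α → Fin β) : ℝ :=
  (∏ l ∈ Finset.range H, gapProd pos Q (survivors c A (l + 1))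
    (f l (survivors c A l) (survivors c A (l + 1)))) * gapProd pos Q ∅ (f H (survivors c A H) ∅)

lemma gapProd_nonneg {Q M : Finset α} {f : Finset α → ℝ} (hf : ∀ G, 0 ≤ f G) :
    0 ≤ gapProd pos Q M f := mul_nonneg (hf _) (Finset.prod_nonneg fun _ _ => hf _)

lemma gapProd_empty (Q : Finset α) (f : Finset α → ℝ) : gapProd pos Q ∅ f = f Q := by
  simp [gapProd, firstGap]

lemma one_add_pow_le_exp {x : ℝ} (hx : 0 ≤ x) (n : ℕ) : (1 + x) ^ n ≤ Real.exp (n * x) := by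
  rw [Real.exp_nat_mul]
  exact pow_le_pow_left₀ (by linarith) (by linarith [Real.add_one_le_exp x]) n

lemma one_add_mul_pow_le {δ : ℝ} (h0 : 0 ≤ δ) (h1 : δ ≤ 1) (n : ℕ) :
    (1 + 0.6 * δ) ^ n ≤ 1 + δ * (2 ^ n - 1) := by
  induction n with
  | zero => simp
  | succ n ih =>
    have h2 : (1 : ℝ) ≤ 2 ^ n := one_le_pow₀ (by norm_num)
    rw [pow_succ, pow_succ]
    calc (1 + 0.6 * δ) ^ n * (1 + 0.6 * δ) ≤ (1 + δ * (2 ^ n - 1)) * (1 + 0.6 * δ) :=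
          mul_le_mul_of_nonneg_right ih (by linarith)
      _ ≤ 1 + δ * (2 ^ n * 2 - 1) := by
        have := mul_nonneg (mul_nonneg h0 (sub_nonneg.2 h1)) (sub_nonneg.2 h2)
        nlinarith

variable [Fintype α] [DecidableEq α]
variable (hpos : Function.Injective pos) (hβ : 2 ≤ β) (ha : 1 ≤ a) (hz : 1 ≤ z) (hg : 1 ≤ g)
  (hρ : 1 / β + (1 - 1 / β) * (z * g) ≤ g) {Q A : Finset α} (hAQ : A ⊆ Q)
include hpos hβ ha hz hg hρ hAQ

/-- The expected product when the items on one side of the most recently accessed element of each gap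
count, and the probability depends on the time of that access. The factor `z` for each of the hashes that
reach height `H` becomes `1 + (z - 1) / β ^ (H - l)` for each of those that reach height `l`. -/
theorem expect_left_product_le (hA : (#A : ℝ) ≤ β ^ H) {P : ℕ → ℕ → ℝ} (hP0 : ∀ l i, 0 ≤ P l i)
    (hP1 : ∀ l i, P l i ≤ 1) {k : α → ℕ} (hk : Set.InjOn k Q) (hk0 : ∀ q ∈ Q, 0 < k q) :
    𝔼 c : Fin H → α → Fin β, levelProd pos Q A
      (fun l A' M G => 1 + P l (G.sup k) * (a * z ^ #(leftItems pos k A' M G) - 1)) c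
    ≤ a * Real.exp (z - 1) * ∏ l ∈ Finset.range H, ((1 + P l 0 * (a * g - 1)) *
      ∏ q ∈ Q, (1 + (a ^ 2 * g - 1) * P l (k q))) := by
  have hβ0 : (0 : ℝ) < β := by positivity
  have h0 : (0 : ℝ) ≤ 1 / β := by positivity
  have h1 : (1 / β : ℝ) ≤ 1 := by
    rw [div_le_one hβ0]; exact_mod_cast (by omega : 1 ≤ β)
  have hag : 1 ≤ a * g := one_le_mul_of_one_le_of_one_le ha hg
  have ha2g : 1 ≤ a ^ 2 * g := one_le_mul_of_one_le_of_one_le (one_le_pow₀ ha) hg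
  have hf : ∀ l A' M G, 0 ≤ 1 + P l (G.sup k) * (a * z ^ #(leftItems pos k A' M G) - 1) := by
    intro l A' M G
    have : 1 ≤ a * z ^ #(leftItems pos k A' M G) :=
      one_le_mul_of_one_le_of_one_le ha (one_le_pow₀ hz)
    linarith [mul_nonneg (hP0 l (G.sup k)) (sub_nonneg.2 this)]
  set C₀ : ℕ → ℝ := fun l => (1 + P l 0 * (a * g - 1)) *
      ∏ q ∈ Q, (1 + (a ^ 2 * g - 1) * P l (k q)) with hC₀
  have hC₀n : ∀ l, 0 ≤ C₀ l := fun l => by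
    refine mul_nonneg ?_ (Finset.prod_nonneg fun q _ => ?_)
    · linarith [mul_nonneg (hP0 l 0) (sub_nonneg.2 hag)]
    · linarith [mul_nonneg (sub_nonneg.2 ha2g) (hP0 l (k q))]
  have key := expect_levels_le (by omega : 0 < β) (n := H) (fun l A' M => gapProd pos Q M
      (fun G => 1 + P l (G.sup k) * (a * z ^ #(leftItems pos k A' M G) - 1)))
    (fun l => if l < H then C₀ l else a) (fun l => 1 + (z - 1) * (1 / β) ^ (H - l))
    (fun l A' M => gapProd_nonneg fun G => hf l A' M G)
    (fun l => by split_ifs; exacts [hC₀n l, by linarith]) A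
    (fun l hl A' hA' => ?_) (fun A' hA' => ?_)
  · refine key.trans ?_
    rw [Finset.prod_range_succ, if_neg (lt_irrefl H),
      Finset.prod_congr rfl fun l hl => if_pos (Finset.mem_range.1 hl), mul_comm _ a, mul_right_comm]
    refine mul_le_mul_of_nonneg_right (mul_le_mul_of_nonneg_left ?_ (by linarith))
      (Finset.prod_nonneg fun l _ => hC₀n l)
    refine (one_add_pow_le_exp (mul_nonneg (by linarith) (by positivity)) _).trans ?_
    rw [Real.exp_le_exp, mul_left_comm]
    refine mul_le_of_le_one_right (by linarith) ?_
    rw [Nat.sub_zero, one_div, inv_pow, ← div_eq_mul_inv, div_le_one (by positivity)]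
    exact hA
  · have hμ : (1 : ℝ) ≤ 1 + (z - 1) * (1 / β) ^ (H - (l + 1)) := by
      have : 0 ≤ (z - 1) * (1 / β : ℝ) ^ (H - (l + 1)) := mul_nonneg (by linarith) (by positivity)
      linarith
    have := markSum_left_le h0 h1 hμ ha hz hg hρ hpos (hP0 l) (hP1 l) hk hk0 (hA'.trans hAQ)
    refine this.trans (le_of_eq ?_)
    have e : 1 + 1 / (β : ℝ) * (1 + (z - 1) * (1 / β) ^ (H - (l + 1)) - 1)
        = 1 + (z - 1) * (1 / β) ^ (H - l) := by
      rw [show H - l = (H - (l + 1)) + 1 by omega, pow_succ]; ring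
    rw [e, if_pos hl, hC₀]
    ring
  · rw [gapProd_empty, if_neg (lt_irrefl H), Nat.sub_self, pow_zero, mul_one, add_sub_cancel]
    have h2 : #(leftItems pos k A' ∅ Q) ≤ #A' := Finset.card_le_card fun q hq =>
      (Finset.mem_filter.1 hq).2.1.1
    have h3 : a * z ^ #(leftItems pos k A' ∅ Q) ≤ a * z ^ #A' :=
      mul_le_mul_of_nonneg_left (pow_le_pow_right₀ hz h2) (by linarith)
    have h4 : 1 ≤ a * z ^ #(leftItems pos k A' ∅ Q) :=
      one_le_mul_of_one_le_of_one_le ha (one_le_pow₀ hz)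
    have := mul_le_mul_of_nonneg_right (hP1 H (Q.sup k)) (sub_nonneg.2 h4)
    linarith

/-- The expected product when all items of each gap count, and the probability is fixed. Each hash of height
at least `l` carries a factor `1 + x l` for what happens at the levels `≥ l`. -/
theorem expect_items_product_le (hag : a * g ≤ 1.6) {n : ℕ} (hA : #A ≤ n)
    (hn : (n : ℝ) ≤ β ^ H) (hH : 2 ^ H ≤ 2 * n) {δ : ℝ} (hδ : 0 ≤ δ) (hδ1 : δ ≤ 1) :
    𝔼 c : Fin H → α → Fin β, levelProd pos Q A
      (fun _ A' M G => 1 + δ * (a * z ^ #(gapItems A' M G) - 1)) c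
    ≤ a * Real.exp ((z - 1) * (1 + 2 * n * δ) + δ * (1.5 * n + 0.6 * H)) := by
  have hβ0 : (0 : ℝ) < β := by positivity
  have hβ2 : (2 : ℝ) ≤ β := by exact_mod_cast hβ
  have h0 : (0 : ℝ) ≤ 1 / β := by positivity
  have h12 : (1 / β : ℝ) ≤ 1 / 2 := one_div_le_one_div_of_le (by norm_num) hβ2
  have h1 : (1 / β : ℝ) ≤ 1 := by linarith
  have hag1 : 1 ≤ a * g := one_le_mul_of_one_le_of_one_le ha hg
  have hf : ∀ A' M G : Finset α, 0 ≤ 1 + δ * (a * z ^ #(gapItems A' M G) - 1) := by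
    intro A' M G
    have : 1 ≤ a * z ^ #(gapItems A' M G) :=
      one_le_mul_of_one_le_of_one_le ha (one_le_pow₀ hz)
    linarith [mul_nonneg hδ (sub_nonneg.2 this)]
  set x : ℕ → ℝ := fun l => 1.5 * δ + ((1 + 0.6 * δ) / β) ^ (H - l) * (z - 1) with hx
  have hx0 : ∀ l, 0 ≤ x l := fun l =>
    add_nonneg (by linarith) (mul_nonneg (by positivity) (by linarith))
  have hy : 1 + δ * (a * g - 1) ≤ 1 + 0.6 * δ := by
    linarith [mul_le_mul_of_nonneg_left (by linarith : a * g - 1 ≤ 0.6) hδ]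
  have hy1 : 1 ≤ 1 + δ * (a * g - 1) := by linarith [mul_nonneg hδ (sub_nonneg.2 hag1)]
  have key := expect_levels_le (by omega : 0 < β) (n := H) (fun _ A' M => gapProd pos Q M
      (fun G => 1 + δ * (a * z ^ #(gapItems A' M G) - 1)))
    (fun l => if l < H then 1 + 0.6 * δ else a) (fun l => 1 + x l)
    (fun l A' M => gapProd_nonneg fun G => hf A' M G)
    (fun l => by split_ifs <;> linarith) A
    (fun l hl A' hA' => ?_) (fun A' hA' => ?_)
  · refine key.trans ?_
    rw [Finset.prod_range_succ, if_neg (lt_irrefl H),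
      Finset.prod_congr rfl fun l hl => if_pos (Finset.mem_range.1 hl), Finset.prod_const,
      Finset.card_range, mul_comm _ a, mul_assoc]
    refine mul_le_mul_of_nonneg_left ?_ (by linarith)
    have e1 : (1 + 0.6 * δ) ^ H ≤ Real.exp (H * (0.6 * δ)) := one_add_pow_le_exp (by linarith) H
    have e2 : (1 + x 0) ^ #A ≤ Real.exp (n * x 0) :=
      (pow_le_pow_right₀ (by linarith [hx0 0]) hA).trans (one_add_pow_le_exp (hx0 0) n)
    refine (mul_le_mul e1 e2 (by have := hx0 0; positivity) (Real.exp_nonneg _)).trans ?_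
    rw [← Real.exp_add, Real.exp_le_exp]
    have e3 : (n : ℝ) * ((1 + 0.6 * δ) / β) ^ H ≤ 1 + 2 * n * δ := by
      have h2 : (2 : ℝ) ^ H ≤ 2 * n := by exact_mod_cast hH
      have h3 := one_add_mul_pow_le hδ hδ1 H
      have h4 : (1 + 0.6 * δ) ^ H ≤ 1 + 2 * n * δ := by nlinarith
      rw [div_pow, mul_div_assoc', div_le_iff₀ (by positivity), mul_comm]
      exact mul_le_mul h4 hn (by positivity) (by positivity)
    have e4 := mul_le_mul_of_nonneg_right e3 (by linarith : 0 ≤ z - 1)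
    simp only [hx, Nat.sub_zero]
    linarith
  · have hμ : (1 : ℝ) ≤ 1 + x (l + 1) := by linarith [hx0 (l + 1)]
    have := markSum_items_le h0 h1 hμ ha hz hg hρ hpos hδ (hA'.trans hAQ)
    refine this.trans ?_
    rw [if_pos hl]
    have e1 : 1 + 1 / (β : ℝ) * ((1 + x (l + 1)) * (1 + δ * (a * g - 1)) - 1) ≤ 1 + x l := by
      have e2 : (1 + x (l + 1)) * (1 + δ * (a * g - 1)) ≤ (1 + x (l + 1)) * (1 + 0.6 * δ) :=
        mul_le_mul_of_nonneg_left hy (by linarith)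
      have e3 := mul_le_mul_of_nonneg_left e2 h0
      have e4 : x l = 1.5 * δ + (1 + 0.6 * δ) / β * (x (l + 1) - 1.5 * δ) := by
        simp only [hx]
        rw [show H - l = (H - (l + 1)) + 1 by omega, pow_succ]; ring
      have e5 : (1 + 0.6 * δ) / β = 1 / β * (1 + 0.6 * δ) := by ring
      have e6 : 1 / (β : ℝ) * (1.5 * δ * (1 + 0.6 * δ) + 0.6 * δ) ≤ 1.5 * δ := by
        have : 1.5 * δ * (1 + 0.6 * δ) + 0.6 * δ ≤ 3 * δ := by nlinarith
        have := mul_le_mul_of_nonneg_left this h0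
        nlinarith
      rw [e4, e5]
      linarith
    have e0 : 0 ≤ 1 + 1 / (β : ℝ) * ((1 + x (l + 1)) * (1 + δ * (a * g - 1)) - 1) := by
      have : 1 ≤ (1 + x (l + 1)) * (1 + δ * (a * g - 1)) :=
        one_le_mul_of_one_le_of_one_le hμ hy1
      linarith [mul_nonneg h0 (sub_nonneg.2 this)]
    exact mul_le_mul hy (pow_le_pow_left₀ e0 e1 _) (pow_nonneg e0 _) (by linarith)
  · rw [gapProd_empty, if_neg (lt_irrefl H)]
    have h2 : #(gapItems A' ∅ Q) ≤ #A' := Finset.card_le_card fun q hq =>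
      (Finset.mem_filter.1 hq).2.1
    have h3 : a * z ^ #(gapItems A' ∅ Q) ≤ a * z ^ #A' :=
      mul_le_mul_of_nonneg_left (pow_le_pow_right₀ hz h2) (by linarith)
    have h4 : 1 ≤ a * z ^ #(gapItems A' ∅ Q) :=
      one_le_mul_of_one_le_of_one_le ha (one_le_pow₀ hz)
    have h5 := mul_le_mul_of_nonneg_right hδ1 (sub_nonneg.2 h4)
    have h6 : z ^ #A' ≤ (1 + x H) ^ #A' := by
      refine pow_le_pow_left₀ (by linarith) ?_ _
      simp only [hx, Nat.sub_self, pow_zero]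
      linarith
    have := mul_le_mul_of_nonneg_left h6 (by linarith : 0 ≤ a)
    linarith

end LevelProducts

/-! ### Random HIRBs -/

lemma le_heightOfCoins {H b l : ℕ} {c : Fin H → Fin b} :
    l ≤ heightOfCoins c ↔ l ≤ H ∧ ∀ i : Fin H, (i : ℕ) < l → (c i : ℕ) = 0 := by
  constructor
  · intro h
    have h0 := Nat.findGreatest_spec (P := fun l => ∀ i : Fin H, (i : ℕ) < l → (c i : ℕ) = 0)
      (Nat.zero_le H) (by simp)
    exact ⟨h.trans (Nat.findGreatest_le H), fun i hi => h0 i (hi.trans_le h)⟩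
  · rintro ⟨h1, h2⟩
    exact Nat.le_findGreatest h1 h2

section TreeOf
variable {p : VHParams}

/-- The HIRB that stores the hashes in `A` with the heights that are given by the columns `c` of
coins. -/
noncomputable def treeOf (A : Finset (HashVal p)) (c : Fin p.H → HashVal p → Fin p.β) : Hirb p :=
  fun g => if g ∈ A then some (heightOfCoins fun i => c i g) else none

/-- The position of a hash on the line. -/
def hashPos (q : HashVal p) : ℤ := (q : ℕ)

lemma hashPos_injective : Function.Injective (hashPos (p := p)) := fun a b h =>
  Fin.ext (by simpa [hashPos] using h)

lemma hashPos_le {a b : HashVal p} : hashPos a ≤ hashPos b ↔ a ≤ b := by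
  simp [hashPos]

lemma hashPos_lt {a b : HashVal p} : hashPos a < hashPos b ↔ a < b := by
  simp [hashPos]

variable {A : Finset (HashVal p)} {c : Fin p.H → HashVal p → Fin p.β}

lemma separators_treeOf {l : ℕ} (hl : l < p.H) :
    separators (treeOf A c) l = survivors c A (l + 1) := by
  ext g
  simp only [mem_separators, survivors, Finset.mem_filter, treeOf]
  by_cases hg : g ∈ A
  · simp only [hg, reduceIte, true_and, Option.some.injEq, exists_eq_left']
    rw [← Nat.succ_le_iff, le_heightOfCoins]
    exact and_iff_right hl
  · simp [hg]

lemma separators_treeOf_top : separators (treeOf A c) p.H = ∅ := by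
  ext g
  simp only [mem_separators, treeOf]
  by_cases hg : g ∈ A
  · simp only [hg, reduceIte, Option.some.injEq, exists_eq_left', Finset.notMem_empty,
      iff_false, not_lt]
    exact Nat.findGreatest_le _
  · simp [hg]

open Classical in
/-- The elements of `Q` in the closed gap of a node. -/
noncomputable def nodeGap (D : Hirb p) (Q : Finset (HashVal p)) (ν : HNode p) :
    Finset (HashVal p) := {q ∈ Q | InGap D ν q}

lemma mem_nodeGap {D : Hirb p} {Q : Finset (HashVal p)} {ν : HNode p} {q : HashVal p} :
    q ∈ nodeGap D Q ν ↔ q ∈ Q ∧ InGap D ν q := by simp [nodeGap]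

lemma nodeGap_bot (D : Hirb p) (Q : Finset (HashVal p)) (l : ℕ) :
    nodeGap D Q (l, ⊥) = firstGap hashPos Q (separators D l) := by
  ext q
  simp [nodeGap, firstGap, InGap, hashPos_le]

lemma nodeGap_coe (D : Hirb p) (Q : Finset (HashVal p)) (l : ℕ) (m : HashVal p) :
    nodeGap D Q (l, (m : WithBot (HashVal p))) = nextGap hashPos Q (separators D l) m := by
  ext q
  simp [nodeGap, nextGap, InGap, hashPos_le, hashPos_lt]

/-- The stored hashes of height at least `l`. -/
noncomputable def levelSet (D : Hirb p) (l : ℕ) : Finset (HashVal p) :=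
  Finset.univ.filter fun g => ∃ j ∈ D g, l ≤ j

lemma mem_levelSet {D : Hirb p} {l : ℕ} {g : HashVal p} :
    g ∈ levelSet D l ↔ ∃ j ∈ D g, l ≤ j := by simp [levelSet]

lemma levelSet_treeOf {l : ℕ} (hl : l ≤ p.H) :
    levelSet (treeOf A c) l = survivors c A l := by
  ext g
  simp only [mem_levelSet, survivors, Finset.mem_filter, treeOf]
  by_cases hg : g ∈ A
  · simp only [hg, reduceIte, true_and, Option.mem_def, Option.some.injEq, exists_eq_left']
    rw [le_heightOfCoins]
    exact and_iff_right hl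
  · simp [hg]

/-- The items of a node lie in its closed gap, and they are not separators. -/
lemma nodeItems_eq_gapItems {D : Hirb p} {Q : Finset (HashVal p)} (hQ : ∀ g, D g ≠ none → g ∈ Q)
    {ν : HNode p} (hν : IsHNode D ν) :
    nodeItems D ν = gapItems (levelSet D ν.1) (separators D ν.1) (nodeGap D Q ν) := by
  ext g
  have key : D g = some ν.1 ↔ g ∈ levelSet D ν.1 ∧ g ∉ separators D ν.1 := by
    simp only [mem_separators, mem_levelSet]
    cases D g with
    | none => simp
    | some j => simp only [Option.mem_def, Option.some.injEq, exists_eq_left', not_lt]; omega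
  simp only [nodeItems, gapItems, mem_nodeGap, Finset.mem_filter, Finset.mem_univ, true_and, key,
    searchNode_eq_iff]
  constructor
  · rintro ⟨h1, -, h2, h3⟩
    exact ⟨⟨hQ g (by rw [key.2 h1]; simp), h2.le, h3⟩, h1⟩
  · rintro ⟨⟨-, h2, h3⟩, h1⟩
    refine ⟨h1, hν.2, lt_of_le_of_ne h2 fun e => ?_, h3⟩
    rcases hν.2 with h | ⟨m, hm, h⟩
    · rw [h] at e; exact WithBot.bot_ne_coe e
    · rw [h, WithBot.coe_inj] at e
      exact h1.2 (e ▸ hm)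

lemma prod_liveNodes (D : Hirb p) (F : HNode p → ℝ) :
    ∏ ν ∈ liveNodes D, F ν = ∏ l ∈ Finset.range (p.H + 1),
      (F (l, ⊥) * ∏ m ∈ separators D l, F (l, (m : WithBot (HashVal p)))) := by
  classical
  have h1 : liveNodes D = (Finset.range (p.H + 1)).biUnion fun l =>
      insert ((l, ⊥) : HNode p) ((separators D l).image fun m : HashVal p =>
        ((l, (m : WithBot (HashVal p))) : HNode p)) := by
    ext ν
    simp only [mem_liveNodes, IsHNode, Finset.mem_biUnion, Finset.mem_range, Finset.mem_insert,
      Finset.mem_image, Nat.lt_succ_iff]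
    constructor
    · rintro ⟨h1, h2 | ⟨g, hg, h2⟩⟩
      · exact ⟨ν.1, h1, Or.inl (Prod.ext rfl h2)⟩
      · exact ⟨ν.1, h1, Or.inr ⟨g, hg, Prod.ext rfl h2.symm⟩⟩
    · rintro ⟨l, hl, rfl | ⟨g, hg, rfl⟩⟩
      · exact ⟨hl, Or.inl rfl⟩
      · exact ⟨hl, Or.inr ⟨g, hg, rfl⟩⟩
  rw [h1, Finset.prod_biUnion]
  · refine Finset.prod_congr rfl fun l _ => ?_
    rw [Finset.prod_insert (by simp), Finset.prod_image]
    intro m _ m' _ h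
    exact WithBot.coe_injective (congrArg Prod.snd h)
  · intro l _ l' _ hne
    refine Finset.disjoint_left.2 fun ν h h' => hne ?_
    have : ∀ l : ℕ, ν ∈ insert ((l, ⊥) : HNode p) ((separators D l).image fun m : HashVal p =>
        ((l, (m : WithBot (HashVal p))) : HNode p)) → ν.1 = l := by
      intro l h
      rcases Finset.mem_insert.1 h with rfl | h
      · rfl
      · obtain ⟨m, _, rfl⟩ := Finset.mem_image.1 h; rfl
    exact (this l h).symm.trans (this l' h')

/-- A product over all nodes of a random HIRB is a product over the gaps of all levels. -/
lemma prod_liveNodes_treeOf (Q : Finset (HashVal p))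
    (f : ℕ → Finset (HashVal p) → Finset (HashVal p) → Finset (HashVal p) → ℝ) :
    ∏ ν ∈ liveNodes (treeOf A c), f ν.1 (levelSet (treeOf A c) ν.1) (separators (treeOf A c) ν.1)
      (nodeGap (treeOf A c) Q ν) = levelProd hashPos Q A f c := by
  rw [prod_liveNodes, Finset.prod_range_succ, levelProd]
  congr 1
  · refine Finset.prod_congr rfl fun l hl => ?_
    rw [gapProd, nodeGap_bot, separators_treeOf (Finset.mem_range.1 hl),
      levelSet_treeOf (Finset.mem_range.1 hl).le]
    simp only [nodeGap_coe, separators_treeOf (Finset.mem_range.1 hl),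
      levelSet_treeOf (Finset.mem_range.1 hl).le]
  · rw [nodeGap_bot, separators_treeOf_top, levelSet_treeOf le_rfl, Finset.prod_empty, mul_one, gapProd,
      Finset.prod_empty, mul_one]

end TreeOf

/-! ### The order of the evictions -/

namespace Trace
variable {p : VHParams} (tr : Trace p)

/-- The indices of the identifiers whose paths are evicted during the initialization and the first `K`
operations, in reverse chronological order. -/
noncomputable def evAt (K n : ℕ) : Idx :=
  if n < 2 * (p.H + 1) * K then
    tr.evIdx (K - 1 - n / (2 * (p.H + 1))) (n % (2 * (p.H + 1)) / 2)
      (decide (n % (2 * (p.H + 1)) % 2 = 1))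
  else (0, p.H - (n - 2 * (p.H + 1) * K), 2)

/-- The total number of evictions. -/
def numEv (p : VHParams) (K : ℕ) : ℕ := 2 * (p.H + 1) * K + (p.H + 1)

/-- The number of evictions since a node of height `l` got the identifier that was assigned by
operation number `i`. -/
def evCount (p : VHParams) (K i l : ℕ) : ℕ :=
  if i = 0 then 2 * (p.H + 1) * K + (p.H - l) + 1 else 2 * ((K - i) * (p.H + 1) + l + 1)

lemma mod_opLen_le {M n : ℕ} (hM : 0 < M) : n % (2 * M) / 2 < M := by
  have := Nat.mod_lt n (by omega : 0 < 2 * M)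
  omega

lemma sub_one_sub_lt {K d : ℕ} (h : d < K) : K - 1 - d < K := by omega

lemma evAt_inj {K n n' : ℕ} (hn : n < numEv p K) (hn' : n' < numEv p K)
    (h : tr.evAt K n = tr.evAt K n') : n = n' := by
  rw [numEv] at hn hn'
  rw [evAt, evAt] at h
  have hl : ∀ n, n % (2 * (p.H + 1)) / 2 ≤ p.H := fun n =>
    Nat.lt_succ_iff.1 (mod_opLen_le (Nat.succ_pos _))
  split_ifs at h with h1 h2 h2
  · obtain ⟨e1, e2, e3⟩ := tr.evIdx_inj (hl n) (hl n') h
    have d1 : n / (2 * (p.H + 1)) < K := Nat.div_lt_of_lt_mul h1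
    have d2 : n' / (2 * (p.H + 1)) < K := Nat.div_lt_of_lt_mul h2
    have e4 : n / (2 * (p.H + 1)) = n' / (2 * (p.H + 1)) := by omega
    rw [decide_eq_decide] at e3
    have e5 : n % (2 * (p.H + 1)) = n' % (2 * (p.H + 1)) := by omega
    rw [← Nat.div_add_mod n (2 * (p.H + 1)), ← Nat.div_add_mod n' (2 * (p.H + 1)), e4, e5]
  · exact absurd h (tr.init_ne_evIdx (hl n) _)
  · exact absurd h.symm (tr.init_ne_evIdx (hl n') _)
  · have := congrArg (fun i : Idx => i.2.1) h
    simp only at this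
    omega

lemma evAt_ne_ptrIdx {K n : ℕ} {ν : HNode p} (hν : IsHNode (tr.D K) ν) :
    tr.evAt K n ≠ tr.ptrIdx K ν := by
  rw [evAt]
  split_ifs with h
  · have d1 : n / (2 * (p.H + 1)) < K := Nat.div_lt_of_lt_mul h
    exact tr.evIdx_ne_ptrIdx (sub_one_sub_lt d1) (Nat.lt_succ_iff.1 (mod_opLen_le (Nat.succ_pos _))) _ hν
  · intro h'
    have := tr.ptrIdx_ne_two K ν
    rw [← h'] at this
    exact this rfl

lemma evAt_bounds {K n : ℕ} : (tr.evAt K n).1 ≤ K ∧ (tr.evAt K n).2.1 ≤ p.H := by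
  rw [evAt]
  split_ifs with h
  · have d1 : n / (2 * (p.H + 1)) < K := Nat.div_lt_of_lt_mul h
    refine ⟨(tr.evIdx_clock_le _ _ _).trans (sub_one_sub_lt d1), ?_⟩
    rw [tr.evIdx_level]
    exact Nat.lt_succ_iff.1 (mod_opLen_le (Nat.succ_pos _))
  · exact ⟨Nat.zero_le _, Nat.sub_le _ _⟩

/-- The last `evCount` evictions come after the assignment of the identifier. -/
lemma evAt_mem_evSince {K n : ℕ} {i : Idx} (hi : i.1 ≤ K) (hl : i.2.1 ≤ p.H)
    (hn : n < evCount p K i.1 i.2.1) : tr.evAt K n ∈ tr.evSince K (p.H + 1) i := by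
  have hlev : n % (2 * (p.H + 1)) / 2 ≤ p.H := Nat.lt_succ_iff.1 (mod_opLen_le (Nat.succ_pos _))
  rw [evAt]
  rw [evCount] at hn
  split_ifs with h
  · have d1 : n / (2 * (p.H + 1)) < K := Nat.div_lt_of_lt_mul h
    refine Or.inr ⟨_, _, _, hlev, Or.inl (sub_one_sub_lt d1), rfl, ?_⟩
    have e := Nat.div_add_mod n (2 * (p.H + 1))
    generalize n % (2 * (p.H + 1)) = r at *
    generalize n / (2 * (p.H + 1)) = d at *
    rcases Nat.eq_zero_or_pos i.1 with h0 | h0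
    · omega
    · rw [if_neg h0.ne'] at hn
      rcases lt_or_ge d (K - i.1) with h2 | h2
      · omega
      · have h3 : d = K - i.1 := by
          refine le_antisymm ?_ h2
          by_contra! h4
          have := Nat.mul_le_mul_left (2 * (p.H + 1)) h4
          rw [Nat.mul_succ] at this
          nlinarith
        subst h3
        have e' : 2 * (p.H + 1) * (K - i.1) = 2 * ((K - i.1) * (p.H + 1)) := by ring
        omega
  · rcases Nat.eq_zero_or_pos i.1 with h0 | h0
    · rw [if_pos h0] at hn
      exact Or.inl ⟨_, Nat.sub_le _ _, rfl, h0, by omega⟩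
    · exfalso
      rw [if_neg h0.ne'] at hn
      have : (K - i.1) * (p.H + 1) + (p.H + 1) ≤ K * (p.H + 1) := by
        rw [← Nat.succ_mul]
        exact Nat.mul_le_mul_right _ (by omega)
      nlinarith

end Trace

/-! ### Averages over the identifiers and over the heights -/

section Extend
variable {ι V B : Type*}

open Classical in
/-- A function on `J`, continued by an arbitrary value. -/
noncomputable def extendFn [Nonempty B] (J : Finset ι) (r : J → B) (i : ι) : B :=
  if h : i ∈ J then r ⟨i, h⟩ else Classical.arbitrary B

lemma extendFn_of_mem [Nonempty B] {J : Finset ι} (r : J → B) {i : ι} (h : i ∈ J) :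
    extendFn J r i = r ⟨i, h⟩ := dif_pos h

/-- If the identifiers of the evicted paths and those of the nodes are all distinct, then given
the evictions, the nodes are independent. -/
lemma expect_extend_prod [DecidableEq ι] [Fintype B] [Nonempty B] (J : Finset ι) {N : ℕ} {ev : Fin N → ι}
    {S : Finset V} {ix : V → ι} (hev : Function.Injective ev) (hix : Set.InjOn ix S)
    (hne : ∀ n, ∀ ν ∈ S, ev n ≠ ix ν) (hevJ : ∀ n, ev n ∈ J) (hixJ : ∀ ν ∈ S, ix ν ∈ J)
    (h : V → (Fin N → B) → B → ℝ) :
    𝔼 r : J → B, ∏ ν ∈ S, h ν (extendFn J r ∘ ev) (extendFn J r (ix ν))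
      = 𝔼 q : Fin N → B, ∏ ν ∈ S, 𝔼 b, h ν q b := by
  classical
  let Φ : Fin N ⊕ S → J := Sum.elim (fun n => ⟨ev n, hevJ n⟩) fun ν => ⟨ix ν, hixJ ν ν.2⟩
  have hΦ : Function.Injective Φ := by
    rintro (n | ν) (n' | ν') e
    · exact congrArg Sum.inl (hev (congrArg Subtype.val e))
    · exact absurd (congrArg Subtype.val e) (hne n ν' ν'.2)
    · exact absurd (congrArg Subtype.val e).symm (hne n' ν ν.2)
    · exact congrArg Sum.inr (Subtype.ext (hix ν.2 ν'.2 (congrArg Subtype.val e)))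
  let F : (Fin N ⊕ S → B) → ℝ := fun s =>
    ∏ ν : S, h ν (fun n => s (Sum.inl n)) (s (Sum.inr ν))
  have h1 : ∀ r : J → B, ∏ ν ∈ S, h ν (extendFn J r ∘ ev) (extendFn J r (ix ν)) = F (r ∘ Φ) := by
    intro r
    rw [← Finset.prod_coe_sort]
    refine Finset.prod_congr rfl fun ν _ => ?_
    have : extendFn J r ∘ ev = fun n => r (Φ (Sum.inl n)) :=
      funext fun n => extendFn_of_mem r (hevJ n)
    rw [this, extendFn_of_mem r (hixJ ν ν.2)]
    rfl
  simp only [h1]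
  rw [expect_comp_injective hΦ F, Fintype.expect_equiv (Equiv.sumArrowEquivProdArrow _ _ _) F
    (fun x => ∏ ν : S, h ν x.1 (x.2 ν)) (fun s => rfl), expect_univ_prod]
  refine Finset.expect_congr rfl fun q _ => ?_
  rw [expect_prod_pi fun ν : S => h ν q]
  exact Finset.prod_coe_sort S fun ν => 𝔼 b, h ν q b

end Extend

/-- The heights of stored hashes come from distinct labels, hence they are independent. -/
lemma expect_extend_heights {p : VHParams} {L : Type*} [DecidableEq L] [Nonempty (Fin p.H → Fin p.β)]
    {J : Finset L} {A : Finset (HashVal p)} {rep : HashVal p → Option L}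
    (hrep : ∀ g ∈ A, ∃ x ∈ J, rep g = some x) (hnone : ∀ g ∉ A, rep g = none)
    (hinj : ∀ g g' x, rep g = some x → rep g' = some x → g = g') (F : Hirb p → ℝ) :
    𝔼 b : J → Fin p.H → Fin p.β, F (fun g => (rep g).map fun x => heightOfCoins (extendFn J b x))
      = 𝔼 c : Fin p.H → HashVal p → Fin p.β, F (treeOf A c) := by
  classical
  choose y hy using hrep
  let Φ : A → J := fun g => ⟨y g g.2, (hy g g.2).1⟩
  have hΦ : Function.Injective Φ := fun g g' e => Subtype.ext <| by
    refine hinj _ _ (y g g.2) (hy g g.2).2 ?_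
    rw [show y g g.2 = y g' g'.2 from congrArg Subtype.val e]
    exact (hy g' g'.2).2
  let F' : (A → Fin p.H → Fin p.β) → ℝ := fun s =>
    F fun g => if h : g ∈ A then some (heightOfCoins (s ⟨g, h⟩)) else none
  have h1 : ∀ b : J → Fin p.H → Fin p.β,
      F (fun g => (rep g).map fun x => heightOfCoins (extendFn J b x)) = F' (b ∘ Φ) := by
    intro b
    refine congrArg F (funext fun g => ?_)
    by_cases hg : g ∈ A
    · rw [dif_pos hg, (hy g hg).2, Option.map_some, extendFn_of_mem b (hy g hg).1]
      rfl
    · rw [dif_neg hg, hnone g hg]; rfl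
  simp only [h1]
  rw [expect_comp_injective hΦ F', ← expect_comp_injective (Subtype.val_injective (p := (· ∈ A))) F']
  refine Fintype.expect_equiv (Equiv.piComm fun _ _ => Fin p.β) _ _ fun s => ?_
  refine congrArg F (funext fun g => ?_)
  by_cases hg : g ∈ A
  · rw [dif_pos hg, treeOf, if_pos hg]; rfl
  · rw [dif_neg hg, treeOf, if_neg hg]

/-! ### Accesses and evictions -/

lemma prod_comp_le_prod {ι κ : Type*} [DecidableEq κ] {s : Finset ι} {t : Finset κ} {e : ι → κ}
    (he : Set.InjOn e s) (hst : ∀ i ∈ s, e i ∈ t) {f : κ → ℝ} (hf : ∀ j, 1 ≤ f j) :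
    ∏ i ∈ s, f (e i) ≤ ∏ j ∈ t, f j := by
  rw [← Finset.prod_image he]
  exact Finset.prod_le_prod_of_subset_of_one_le (Finset.image_subset_iff.2 hst)
    (fun j _ => zero_le_one.trans (hf j)) fun j _ _ => hf j

/-- The factors of all accessed gaps are paid for by the evictions: each access of a height comes with
two evictions, and each initialization with one. -/
lemma prod_accesses_le {p : VHParams} {α : Type*} {Q : Finset α} {k : α → ℕ} {K : ℕ}
    (hk : Set.InjOn k Q) (hk0 : ∀ q ∈ Q, 0 < k q) (hkK : ∀ q ∈ Q, k q ≤ K) {W : ℕ → ℝ}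
    (hW0 : ∀ n, 0 ≤ W n) (hW : Antitone W) {C D c₀ : ℝ} (hC0 : 0 ≤ C) (hC : C ≤ 2 * D)
    (hc0 : 0 ≤ c₀) (hc : c₀ ≤ D) :
    ∏ l ∈ Finset.range p.H, ((1 + W (Trace.evCount p K 0 l) * c₀) *
      ∏ q ∈ Q, (1 + C * W (Trace.evCount p K (k q) l)))
    ≤ ∏ n ∈ Finset.range (Trace.numEv p K), (1 + D * W (n + 1)) := by
  have hD : 0 ≤ D := hc0.trans hc
  have hf : ∀ n, 1 ≤ 1 + D * W (n + 1) := fun n => by linarith [mul_nonneg hD (hW0 (n + 1))]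
  rw [Finset.prod_mul_distrib, Trace.numEv, Finset.prod_range_add, mul_comm]
  refine mul_le_mul ?_ ?_ (Finset.prod_nonneg fun l _ => ?_) (Finset.prod_nonneg fun n _ => ?_)
  · rw [← Finset.prod_product']
    -- the two evictions of an access, in reverse chronological order
    set e : (ℕ × α) × Bool → ℕ := fun x =>
      2 * ((K - k x.1.2) * (p.H + 1) + x.1.1) + if x.2 then 1 else 0 with he
    have hinj : Set.InjOn e ↑((Finset.range p.H ×ˢ Q) ×ˢ (Finset.univ : Finset Bool)) := by
      rintro ⟨⟨l, q⟩, b⟩ h ⟨⟨l', q'⟩, b'⟩ h' heq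
      simp only [Finset.coe_product, Set.mem_prod, Finset.mem_coe, Finset.mem_range] at h h'
      simp only [he] at heq
      have e1 : (K - k q) * (p.H + 1) + l = (K - k q') * (p.H + 1) + l' := by
        split_ifs at heq <;> omega
      have e2 : b = b' := by
        rw [e1] at heq
        cases b <;> cases b' <;> simp at heq ⊢
      have e3 : K - k q = K - k q' := by
        have := congrArg (· / (p.H + 1)) e1
        simp only [add_comm _ l, add_comm _ l', Nat.add_mul_div_right _ _ (Nat.succ_pos p.H)] at this
        rwa [Nat.div_eq_of_lt (by omega), Nat.div_eq_of_lt (by omega), zero_add, zero_add] at this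
      have e4 : k q = k q' := by
        have := hkK q h.1.2
        have := hkK q' h'.1.2
        omega
      rw [e3] at e1
      rw [hk h.1.2 h'.1.2 e4, e2, show l = l' by omega]
    have hmaps : ∀ x ∈ (Finset.range p.H ×ˢ Q) ×ˢ (Finset.univ : Finset Bool),
        e x ∈ Finset.range (2 * (p.H + 1) * K) := by
      rintro ⟨⟨l, q⟩, b⟩ h
      simp only [Finset.mem_product, Finset.mem_range, Finset.mem_univ, and_true] at h ⊢
      have h1 := hk0 q h.2
      have h2 := hkK q h.2
      have h3 : (K - k q) * (p.H + 1) + (p.H + 1) ≤ K * (p.H + 1) := by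
        rw [← Nat.succ_mul]
        exact Nat.mul_le_mul_right _ (by omega)
      have h4 : 2 * (p.H + 1) * K = 2 * (K * (p.H + 1)) := by ring
      simp only [he]
      split_ifs <;> omega
    refine le_trans ?_ (prod_comp_le_prod hinj hmaps hf)
    rw [Finset.prod_product _ (Finset.univ : Finset Bool)]
    refine Finset.prod_le_prod (fun x _ => ?_) fun x hx' => ?_
    · linarith [mul_nonneg hC0 (hW0 (Trace.evCount p K (k x.2) x.1))]
    · have hx : 0 < k x.2 := hk0 _ (Finset.mem_product.1 hx').2
      · rw [Fintype.prod_bool]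
        simp only [he, if_true, Bool.false_eq_true, if_false, Trace.evCount, if_neg hx.ne']
        set j := (K - k x.2) * (p.H + 1) + x.1 with hj
        rw [show 2 * j + 0 + 1 = 2 * j + 1 by ring, show 2 * j + 1 + 1 = 2 * (j + 1) by ring]
        have h1 : W (2 * (j + 1)) ≤ W (2 * j + 1) := hW (by omega)
        have h2 := mul_le_mul_of_nonneg_left h1 hD
        have h3 := mul_le_mul_of_nonneg_right hC (hW0 (2 * (j + 1)))
        have h4 : 0 ≤ D * W (2 * (j + 1)) := mul_nonneg hD (hW0 _)
        nlinarith [mul_nonneg h4 (h4.trans h2)]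
  · have h1 : ∏ l ∈ Finset.range p.H, (1 + W (Trace.evCount p K 0 l) * c₀)
        ≤ ∏ l ∈ Finset.range p.H, (1 + D * W (2 * (p.H + 1) * K + (p.H - l) + 1)) := by
      refine Finset.prod_le_prod (fun l _ => ?_) fun l _ => ?_
      · linarith [mul_nonneg (hW0 (Trace.evCount p K 0 l)) hc0]
      · rw [Trace.evCount, if_pos rfl]
        linarith [mul_le_mul_of_nonneg_left hc (hW0 (2 * (p.H + 1) * K + (p.H - l) + 1))]
    refine h1.trans (prod_comp_le_prod (s := Finset.range p.H) (t := Finset.range (p.H + 1))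
      (e := fun l => p.H - l) ?_ ?_ (f := fun i => 1 + D * W (2 * (p.H + 1) * K + i + 1))
      fun i => hf _)
    · intro l hl l' hl' h
      simp only [Finset.coe_range, Set.mem_Iio] at hl hl' h
      omega
    · intro l _
      simp only [Finset.mem_range]; omega
  · linarith [mul_nonneg (hW0 (Trace.evCount p K 0 l)) hc0]
  · exact zero_le_one.trans (hf _)

/-! ### The expected loads -/

/-- Two independent uniform choices coincide with probability `1 / |B|`. -/
lemma expect_eq_of_ne {ι B : Type*} [DecidableEq ι] [Fintype B] [DecidableEq B] [Nonempty B]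
    {J : Finset ι} {i j : ι} (hi : i ∈ J) (hj : j ∈ J) (hij : i ≠ j) :
    𝔼 r : J → B, (if extendFn J r i = extendFn J r j then (1 : ℝ) else 0)
      = 1 / Fintype.card B := by
  let Φ : Bool → J := fun b => if b then ⟨i, hi⟩ else ⟨j, hj⟩
  have hΦ : Function.Injective Φ := by
    rintro (_ | _) (_ | _) h
    · rfl
    · exact absurd (congrArg Subtype.val h).symm hij
    · exact absurd (congrArg Subtype.val h) hij
    · rfl
  let F : (Bool → B) → ℝ := fun s => if s true = s false then 1 else 0
  have h1 : ∀ r : J → B, (if extendFn J r i = extendFn J r j then (1 : ℝ) else 0) = F (r ∘ Φ) := by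
    intro r
    rw [extendFn_of_mem r hi, extendFn_of_mem r hj]
    rfl
  simp only [h1]
  rw [expect_comp_injective hΦ F, Fintype.expect_equiv (Equiv.boolArrowEquivProd B) F
    (fun x => if x.2 = x.1 then 1 else 0) (fun s => rfl), expect_univ_prod]
  have h2 : ∀ b : B, (𝔼 b' : B, if b' = b then (1 : ℝ) else 0) = 1 / Fintype.card B := by
    intro b
    rw [Fintype.expect_eq_sum_div_card, Finset.sum_ite_eq' Finset.univ b, if_pos (Finset.mem_univ b)]
  simp only [h2, Fintype.expect_const]

lemma levelProd_neg {α : Type*} [DecidableEq α] {pos : α → ℤ} (hpos : Function.Injective pos)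
    {β H : ℕ} (Q A : Finset α) (f : ℕ → Finset α → Finset α → Finset α → ℝ)
    (c : Fin H → α → Fin β) : levelProd (fun q => -pos q) Q A f c = levelProd pos Q A f c := by
  simp only [levelProd, gapProd_neg hpos]

section Loads
variable {p : VHParams} {L : Type*} (a : L → HashVal p) (ops : List (HOp L))

/-- The indices of the random identifiers that can occur in `K` operations. -/
def opIndices (p : VHParams) (K : ℕ) : Finset Idx :=
  Finset.range (K + 1) ×ˢ Finset.range (p.H + 1) ×ˢ Finset.univ

lemma mem_opIndices {K : ℕ} {i : Idx} : i ∈ opIndices p K ↔ i.1 ≤ K ∧ i.2.1 ≤ p.H := by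
  simp [opIndices]

/-- The hashes that occur in the operations. -/
noncomputable def opHashes : Finset (HashVal p) :=
  (Finset.range ops.length).image (opHash a ops)

open Classical in
/-- The stored hashes after the operations. -/
noncomputable def storedHashes : Finset (HashVal p) :=
  Finset.univ.filter fun g => repAfter a ops g ≠ none

/-- The number of the last operation with a given hash. -/
noncomputable def lastOp (q : HashVal p) : ℕ :=
  ((Finset.range ops.length).filter fun j => opHash a ops j = q).sup (· + 1)

variable {a ops}

lemma repAfter_of_notMem_stored {g : HashVal p} (hg : g ∉ storedHashes a ops) :
    repAfter a ops g = none := by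
  simpa [storedHashes] using hg

lemma exists_lastOp {q : HashVal p} (hq : q ∈ opHashes a ops) :
    ∃ j < ops.length, opHash a ops j = q ∧ lastOp a ops q = j + 1 := by
  obtain ⟨j, hj, rfl⟩ := Finset.mem_image.1 hq
  obtain ⟨i, hi, e⟩ := Finset.exists_mem_eq_sup ((Finset.range ops.length).filter fun i =>
    opHash a ops i = opHash a ops j) ⟨j, Finset.mem_filter.2 ⟨hj, rfl⟩⟩ (· + 1)
  obtain ⟨h1, h2⟩ := Finset.mem_filter.1 hi
  exact ⟨i, Finset.mem_range.1 h1, h2, e⟩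

lemma lastOp_injOn : Set.InjOn (lastOp a ops) (opHashes a ops) := by
  intro q hq q' hq' h
  obtain ⟨j, -, h1, h2⟩ := exists_lastOp hq
  obtain ⟨j', -, h1', h2'⟩ := exists_lastOp hq'
  rw [← h1, ← h1', show j = j' by omega]

lemma lastOp_pos {q : HashVal p} (hq : q ∈ opHashes a ops) : 0 < lastOp a ops q := by
  obtain ⟨j, -, -, h⟩ := exists_lastOp hq
  omega

lemma lastOp_le {q : HashVal p} (hq : q ∈ opHashes a ops) : lastOp a ops q ≤ ops.length := by
  obtain ⟨j, h, -, h'⟩ := exists_lastOp hq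
  omega

/-- The identifier of a node was assigned by the last access to its gap. -/
lemma ptrIdx_fst_eq_sup (b : L → Fin p.H → Fin p.β) {ν : HNode p}
    (hν : IsHNode ((traceOf a b ops).D ops.length) ν) :
    ((traceOf a b ops).ptrIdx ops.length ν).1
      = (nodeGap ((traceOf a b ops).D ops.length) (opHashes a ops) ν).sup (lastOp a ops) := by
  classical
  rw [Trace.ptrIdx_fst _ _ hν]
  refine le_antisymm (Finset.sup_le fun j hj => ?_) (Finset.sup_le fun q hq => ?_)
  · obtain ⟨h1, h2⟩ := Finset.mem_filter.1 hj
    refine le_trans ?_ (Finset.le_sup (mem_nodeGap.2 ⟨Finset.mem_image_of_mem _ h1, h2⟩))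
    exact Finset.le_sup (f := (· + 1)) (Finset.mem_filter.2 ⟨h1, rfl⟩)
  · obtain ⟨h1, h2⟩ := mem_nodeGap.1 hq
    obtain ⟨j, hj, rfl, e⟩ := exists_lastOp h1
    rw [e]
    exact Finset.le_sup (f := (· + 1)) (Finset.mem_filter.2 ⟨Finset.mem_range.2 hj, h2⟩)

variable [DecidableEq L]

/-- The labels that occur in the operations. -/
def opLabels (ops : List (HOp L)) : Finset L := (ops.map HOp.label).toFinset

lemma mem_opLabels {x : L} : x ∈ opLabels ops ↔ ∃ op ∈ ops, op.label = x := by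
  simp [opLabels]

lemma repAfter_of_mem_stored {g : HashVal p} (hg : g ∈ storedHashes a ops) :
    ∃ x ∈ opLabels ops, repAfter a ops g = some x := by
  obtain ⟨x, hx⟩ := Option.ne_none_iff_exists'.1 (Finset.mem_filter.1 hg).2
  exact ⟨x, mem_opLabels.2 (repAfter_eq_some hx).2.2, hx⟩

lemma storedHashes_subset : storedHashes a ops ⊆ opHashes a ops := by
  intro g hg
  obtain ⟨x, -, hx⟩ := repAfter_of_mem_stored hg
  obtain ⟨rfl, -, op, hop, rfl⟩ := repAfter_eq_some hx
  obtain ⟨k, hk, rfl⟩ := List.mem_iff_getElem.1 hop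
  exact Finset.mem_image.2 ⟨k, Finset.mem_range.2 hk, opHash_of_lt a hk⟩

lemma card_storedHashes_le : #(storedHashes a ops) ≤ #(labelsAfter ops) := by
  have h : storedHashes a ops ⊆ (labelsAfter ops).image a := by
    intro g hg
    obtain ⟨x, -, hx⟩ := repAfter_of_mem_stored hg
    obtain ⟨h1, h2, -⟩ := repAfter_eq_some hx
    exact Finset.mem_image.2 ⟨x, h2, h1⟩
  exact (Finset.card_le_card h).trans Finset.card_image_le

variable (a ops)

/-- The coins for the heights of the labels that occur. -/
abbrev HeightCoins (p : VHParams) (ops : List (HOp L)) : Type _ :=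
  opLabels ops → Fin p.H → Fin p.β

/-- The random bits of the identifiers that can occur. -/
abbrev IdCoins (p : VHParams) (ops : List (HOp L)) : Type :=
  opIndices p ops.length → Fin (2 * p.T + p.γ) → Bool

variable [Nonempty (Fin p.H → Fin p.β)]

/-- The trace that is determined by the hashes `a` and the coins `b`. -/
noncomputable abbrev coinTrace (b : HeightCoins p ops) : Trace p := traceOf a (extendFn _ b) ops

/-- The HIRB after the operations. -/
noncomputable abbrev finalTree (b : HeightCoins p ops) : Hirb p :=
  (coinTrace a ops b).D ops.length

variable {a ops}

/-- The shape of the HIRB after the operations is that of a random HIRB on the stored hashes. -/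
lemma expect_finalTree (F : Hirb p → ℝ) : 𝔼 b : HeightCoins p ops, F (finalTree a ops b)
    = 𝔼 c : Fin p.H → HashVal p → Fin p.β, F (treeOf (storedHashes a ops) c) := by
  rw [← expect_extend_heights (fun g hg => repAfter_of_mem_stored hg)
    (fun g hg => repAfter_of_notMem_stored hg)
    (fun g g' x h h' => (repAfter_eq_some h).1.symm.trans (repAfter_eq_some h').1) F]
  exact Finset.expect_congr rfl fun b _ =>
    congrArg F (funext fun g => traceOf_D_length a (extendFn _ b) ops g)

/-- Given the hashes and heights, the evicted paths and the paths of the final nodes are independent. -/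
lemma expect_ids_eq (b : HeightCoins p ops)
    (h : HNode p → (Fin (Trace.numEv p ops.length) → Fin (2 * p.T + p.γ) → Bool) →
      (Fin (2 * p.T + p.γ) → Bool) → ℝ) :
    𝔼 r : IdCoins p ops, ∏ ν ∈ liveNodes (finalTree a ops b),
      h ν (fun n => extendFn _ r ((coinTrace a ops b).evAt ops.length n))
        (extendFn _ r ((coinTrace a ops b).ptrIdx ops.length ν))
    = 𝔼 q, ∏ ν ∈ liveNodes (finalTree a ops b), 𝔼 s, h ν q s := by
  refine expect_extend_prod _ (ev := fun n : Fin (Trace.numEv p ops.length) =>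
    (coinTrace a ops b).evAt ops.length n) (fun n n' e => ?_) ?_ (fun n ν hν => ?_) (fun n => ?_)
    (fun ν hν => ?_) h
  · exact Fin.ext (Trace.evAt_inj _ n.2 n'.2 e)
  · intro ν hν μ hμ e
    exact Trace.ptrIdx_injOn _ _ (mem_liveNodes.1 hν) (mem_liveNodes.1 hμ) e
  · exact Trace.evAt_ne_ptrIdx _ (mem_liveNodes.1 hν)
  · exact mem_opIndices.2 (Trace.evAt_bounds _)
  · refine mem_opIndices.2 ⟨Trace.ptrIdx_clock_le _ _ _, ?_⟩
    rw [Trace.ptrIdx_level]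
    exact (mem_liveNodes.1 hν).1

lemma expect_one_add_boole {B : Type*} [Fintype B] [Nonempty B] (P : B → Prop) [DecidablePred P]
    (x : ℝ) : 𝔼 s, (1 + (if P s then (1 : ℝ) else 0) * x)
      = 1 + (𝔼 s, if P s then (1 : ℝ) else 0) * x := by
  rw [Finset.expect_add_distrib, Fintype.expect_const, ← Finset.expect_mul]

/-- The expected exponential load from the items on one side of the most recently accessed element of
each gap, for the nodes whose path leaves the subtree by an exit that has not been taken. -/
theorem expect_side_load_le {E : Type*} [DecidableEq E]
    (ex : (Fin (2 * p.T + p.γ) → Bool) → Option E) (U : Finset E) {pos : HashVal p → ℤ}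
    (hpos : pos = hashPos ∨ pos = fun q => -hashPos q) {aw z g : ℝ} (hβ : 2 ≤ p.β)
    (ha : 1 ≤ aw) (hz : 1 ≤ z) (hg : 1 ≤ g) (hρ : 1 / p.β + (1 - 1 / p.β) * (z * g) ≤ g)
    (hag : aw * g ≤ 1.6) (ha2g : aw ^ 2 * g ≤ 2.2) (hA : (#(labelsAfter ops) : ℝ) ≤ p.β ^ p.H) :
    𝔼 b : HeightCoins p ops, 𝔼 r : IdCoins p ops, ∏ ν ∈ liveNodes (finalTree a ops b),
      (1 + (if ∃ e ∈ openExits ex (fun n : Fin (Trace.numEv p ops.length) =>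
            extendFn _ r ((coinTrace a ops b).evAt ops.length n)) U
            (Trace.evCount p ops.length
              ((nodeGap (finalTree a ops b) (opHashes a ops) ν).sup (lastOp a ops)) ν.1),
          ex (extendFn _ r ((coinTrace a ops b).ptrIdx ops.length ν)) = some e then 1 else 0)
        * (aw * z ^ #(leftItems pos (lastOp a ops) (levelSet (finalTree a ops b) ν.1)
          (separators (finalTree a ops b) ν.1)
          (nodeGap (finalTree a ops b) (opHashes a ops) ν)) - 1))
    ≤ aw * Real.exp (z - 1) * 2.5 ^ #U := by
  set K := ops.length with hK
  set Q := opHashes a ops with hQ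
  set k := lastOp a ops with hk
  set P : (Fin (Trace.numEv p K) → Fin (2 * p.T + p.γ) → Bool) → ℕ → ℕ → ℝ := fun q l i =>
    exitProb ex (openExits ex q U (Trace.evCount p K i l)) with hP
  set f : (Fin (Trace.numEv p K) → Fin (2 * p.T + p.γ) → Bool) →
      ℕ → Finset (HashVal p) → Finset (HashVal p) → Finset (HashVal p) → ℝ := fun q l A' M G =>
    1 + P q l (G.sup k) * (aw * z ^ #(leftItems pos k A' M G) - 1) with hf
  have h1 : ∀ b : HeightCoins p ops, (𝔼 r : IdCoins p ops, ∏ ν ∈ liveNodes (finalTree a ops b),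
      (1 + (if ∃ e ∈ openExits ex (fun n : Fin (Trace.numEv p K) =>
            extendFn _ r ((coinTrace a ops b).evAt K n)) U
            (Trace.evCount p K ((nodeGap (finalTree a ops b) Q ν).sup k) ν.1),
          ex (extendFn _ r ((coinTrace a ops b).ptrIdx K ν)) = some e then 1 else 0)
        * (aw * z ^ #(leftItems pos k (levelSet (finalTree a ops b) ν.1)
          (separators (finalTree a ops b) ν.1) (nodeGap (finalTree a ops b) Q ν)) - 1)))
      = 𝔼 q, ∏ ν ∈ liveNodes (finalTree a ops b), f q ν.1 (levelSet (finalTree a ops b) ν.1)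
          (separators (finalTree a ops b) ν.1) (nodeGap (finalTree a ops b) Q ν) := by
    intro b
    rw [expect_ids_eq b fun ν q s => (1 + (if ∃ e ∈ openExits ex q U
        (Trace.evCount p K ((nodeGap (finalTree a ops b) Q ν).sup k) ν.1), ex s = some e
        then 1 else 0) * (aw * z ^ #(leftItems pos k (levelSet (finalTree a ops b) ν.1)
          (separators (finalTree a ops b) ν.1) (nodeGap (finalTree a ops b) Q ν)) - 1))]
    refine Finset.expect_congr rfl fun q _ => Finset.prod_congr rfl fun ν _ => ?_
    rw [expect_one_add_boole]
    rfl
  refine (Finset.expect_congr rfl fun b _ => h1 b).trans_le ?_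
  rw [Finset.expect_comm]
  have h2 : ∀ q, (𝔼 b : HeightCoins p ops, ∏ ν ∈ liveNodes (finalTree a ops b),
      f q ν.1 (levelSet (finalTree a ops b) ν.1)
          (separators (finalTree a ops b) ν.1) (nodeGap (finalTree a ops b) Q ν))
      ≤ aw * Real.exp (z - 1) * ∏ n ∈ Finset.range (Trace.numEv p K),
        (1 + 0.6 * exitProb ex (openExits ex q U (n + 1))) := by
    intro q
    rw [expect_finalTree fun D => ∏ ν ∈ liveNodes D, f q ν.1 (levelSet D ν.1)
          (separators D ν.1) (nodeGap D Q ν)]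
    simp only [prod_liveNodes_treeOf]
    have e : ∀ c : Fin p.H → HashVal p → Fin p.β,
        levelProd hashPos Q (storedHashes a ops) (f q) c
          = levelProd pos Q (storedHashes a ops) (f q) c := by
      intro c
      rcases hpos with rfl | rfl
      · rfl
      · rw [levelProd_neg hashPos_injective]
    simp only [e]
    have hposi : Function.Injective pos := by
      rcases hpos with rfl | rfl
      · exact hashPos_injective
      · exact neg_injective.comp hashPos_injective
    have hA' : (#(storedHashes a ops) : ℝ) ≤ p.β ^ p.H :=
      le_trans (by exact_mod_cast card_storedHashes_le) hA
    refine (expect_left_product_le hposi hβ ha hz hg hρ storedHashes_subset hA' (P := P q)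
      (fun l i => exitProb_nonneg ex _) (fun l i => exitProb_le_one ex _) lastOp_injOn
      fun q hq => lastOp_pos hq).trans ?_
    refine mul_le_mul_of_nonneg_left ?_ (mul_nonneg (by linarith) (Real.exp_nonneg _))
    have hag1 : 1 ≤ aw * g := one_le_mul_of_one_le_of_one_le ha hg
    have ha2g1 : 1 ≤ aw ^ 2 * g := one_le_mul_of_one_le_of_one_le (one_le_pow₀ ha) hg
    exact prod_accesses_le (W := fun n => exitProb ex (openExits ex q U n)) lastOp_injOn
      (fun q hq => lastOp_pos hq) (fun q hq => lastOp_le hq) (fun n => exitProb_nonneg ex _)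
      (fun m n hmn => exitProb_mono ex (openExits_anti ex q U hmn)) (by linarith) (by linarith)
      (by linarith) (by linarith)
  refine (Finset.expect_le_expect fun q _ => h2 q).trans ?_
  rw [← Finset.mul_expect]
  refine mul_le_mul_of_nonneg_left ?_ (mul_nonneg (by linarith) (Real.exp_nonneg _))
  exact expect_openExits_le ex (by norm_num) (by norm_num) (by norm_num) _ U

/-- The expected product over all nodes when a node counts with a fixed probability. -/
theorem expect_prod_nodes_le {aw z g : ℝ} (hβ : 2 ≤ p.β)
    (ha : 1 ≤ aw) (hz : 1 ≤ z) (hg : 1 ≤ g) (hρ : 1 / p.β + (1 - 1 / p.β) * (z * g) ≤ g)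
    (hag : aw * g ≤ 1.6) {n : ℕ} (hn : #(labelsAfter ops) ≤ n) (hA : (n : ℝ) ≤ p.β ^ p.H)
    (hH : 2 ^ p.H ≤ 2 * n) {δ : ℝ} (hδ : 0 ≤ δ) (hδ1 : δ ≤ 1) :
    𝔼 b : HeightCoins p ops, ∏ ν ∈ liveNodes (finalTree a ops b),
      (1 + δ * (aw * z ^ #(nodeItems (finalTree a ops b) ν) - 1))
    ≤ aw * Real.exp ((z - 1) * (1 + 2 * n * δ) + δ * (1.5 * n + 0.6 * p.H)) := by
  rw [expect_finalTree fun D => ∏ ν ∈ liveNodes D, (1 + δ * (aw * z ^ #(nodeItems D ν) - 1))]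
  have e : ∀ c : Fin p.H → HashVal p → Fin p.β,
      ∏ ν ∈ liveNodes (treeOf (storedHashes a ops) c),
        (1 + δ * (aw * z ^ #(nodeItems (treeOf (storedHashes a ops) c) ν) - 1))
      = levelProd hashPos (opHashes a ops) (storedHashes a ops)
        (fun _ A' M G => 1 + δ * (aw * z ^ #(gapItems A' M G) - 1)) c := by
    intro c
    rw [← prod_liveNodes_treeOf]
    refine Finset.prod_congr rfl fun ν hν => ?_
    rw [nodeItems_eq_gapItems (Q := opHashes a ops) (fun g hg => storedHashes_subset (by
      by_contra h
      exact hg (if_neg h))) (mem_liveNodes.1 hν)]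
  simp only [e]
  exact expect_items_product_le hashPos_injective hβ ha hz hg hρ storedHashes_subset hag
    (card_storedHashes_le.trans hn) hA hH hδ hδ1

/-- The expected exponential load of the nodes whose random bits lie in a given set of probability
`δ`. -/
theorem expect_inner_load_le (S : (Fin (2 * p.T + p.γ) → Bool) → Prop) [DecidablePred S]
    {aw z g : ℝ} (hβ : 2 ≤ p.β)
    (ha : 1 ≤ aw) (hz : 1 ≤ z) (hg : 1 ≤ g) (hρ : 1 / p.β + (1 - 1 / p.β) * (z * g) ≤ g)
    (hag : aw * g ≤ 1.6) {n : ℕ} (hn : #(labelsAfter ops) ≤ n) (hA : (n : ℝ) ≤ p.β ^ p.H)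
    (hH : 2 ^ p.H ≤ 2 * n) {δ : ℝ} (hδ : (𝔼 s, if S s then (1 : ℝ) else 0) = δ) :
    𝔼 b : HeightCoins p ops, 𝔼 r : IdCoins p ops, ∏ ν ∈ liveNodes (finalTree a ops b),
      (1 + (if S (extendFn _ r ((coinTrace a ops b).ptrIdx ops.length ν)) then 1 else 0)
        * (aw * z ^ #(nodeItems (finalTree a ops b) ν) - 1))
    ≤ aw * Real.exp ((z - 1) * (1 + 2 * n * δ) + δ * (1.5 * n + 0.6 * p.H)) := by
  have hδ0 : 0 ≤ δ := hδ ▸ Finset.expect_nonneg fun b _ => by split_ifs <;> norm_num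
  have hδ1 : δ ≤ 1 := hδ ▸ Finset.expect_le Finset.univ_nonempty fun b _ => by
    split_ifs <;> norm_num
  refine le_trans (le_of_eq ?_) (expect_prod_nodes_le (a := a) hβ ha hz hg hρ hag hn hA hH hδ0 hδ1)
  refine Finset.expect_congr rfl fun b _ => ?_
  rw [expect_ids_eq b fun ν _ s => 1 + (if S s then (1 : ℝ) else 0)
    * (aw * z ^ #(nodeItems (finalTree a ops b) ν) - 1), Fintype.expect_const]
  refine Finset.prod_congr rfl fun ν _ => ?_
  rw [expect_one_add_boole, hδ]

end Loads

/-! ### Numerical constants -/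

lemma exp_le_one_div {x : ℝ} (hx : x < 1) : Real.exp x ≤ 1 / (1 - x) := by
  rw [le_div_iff₀ (by linarith), ← le_div_iff₀' (Real.exp_pos x), one_div, ← Real.exp_neg]
  linarith [Real.add_one_le_exp (-x)]

/-- The constants of the exponential moments, for a full node of length `(β + 1) c + β d`. The reserve of the
potential is `g = 1.6 * (1 - 3 / (8 * β))`: it is large enough for the step of the scan, and small enough for
the factors of a single gap. -/
lemma moment_constants {β c d θ : ℝ} (hβ : 2 ≤ β) (hc : 0 < c) (hd : 0 ≤ d)
    (hθ : θ = 1 / (8 * ((β + 1) * c + β * d))) :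
    1 ≤ 1.6 * (1 - 3 / (8 * β)) ∧
    Real.exp (3 * θ * (c + d)) ≤ 5 / 4 ∧
    1 / β + (1 - 1 / β) * (Real.exp (3 * θ * (c + d)) * (1.6 * (1 - 3 / (8 * β))))
      ≤ 1.6 * (1 - 3 / (8 * β)) ∧
    Real.exp (3 * θ * c) ≤ 8 / 7 ∧ Real.exp (3 * θ * c) * (1.6 * (1 - 3 / (8 * β))) ≤ 1.6 ∧
    Real.exp (1.5 * θ * (2 * c + d)) ≤ 8 / 7 ∧
    Real.exp (1.5 * θ * (2 * c + d)) * (1.6 * (1 - 3 / (8 * β))) ≤ 1.6 := by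
  have hβ0 : 0 < β := by linarith
  have hB : 0 < (β + 1) * c + β * d := by positivity
  have hb1 : 3 / (8 * β) ≤ 3 / 16 := by
    rw [div_le_div_iff₀ (by positivity) (by norm_num)]; linarith
  have hb2 : 3 / (8 * (β + 1)) ≤ 1 / 8 := by
    rw [div_le_div_iff₀ (by positivity) (by norm_num)]; linarith
  have hb3 : 3 / (8 * (β + 1)) ≤ 3 / (8 * β) := by
    rw [div_le_div_iff₀ (by positivity) (by positivity)]; linarith
  have h1 : 3 * θ * (c + d) ≤ 3 / (8 * β) := by
    rw [hθ, show 3 * (1 / (8 * ((β + 1) * c + β * d))) * (c + d)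
      = 3 * (c + d) / (8 * ((β + 1) * c + β * d)) by ring,
      div_le_div_iff₀ (by positivity) (by positivity)]
    nlinarith
  have h2 : 3 * θ * c ≤ 3 / (8 * (β + 1)) := by
    rw [hθ, show 3 * (1 / (8 * ((β + 1) * c + β * d))) * c
      = 3 * c / (8 * ((β + 1) * c + β * d)) by ring,
      div_le_div_iff₀ (by positivity) (by positivity)]
    nlinarith [mul_nonneg hβ0.le hd]
  have h3 : 1.5 * θ * (2 * c + d) ≤ 3 / (8 * (β + 1)) := by
    rw [hθ, show 1.5 * (1 / (8 * ((β + 1) * c + β * d))) * (2 * c + d)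
      = 1.5 * (2 * c + d) / (8 * ((β + 1) * c + β * d)) by ring,
      div_le_div_iff₀ (by positivity) (by positivity)]
    nlinarith [mul_nonneg (by linarith : 0 ≤ β - 1) hd]
  have key : ∀ x : ℝ, x ≤ 3 / (8 * β) → Real.exp x * (1 - 3 / (8 * β)) ≤ 1 := by
    intro x hx
    have := exp_le_one_div (x := x) (by linarith)
    calc Real.exp x * (1 - 3 / (8 * β)) ≤ 1 / (1 - x) * (1 - x) :=
          mul_le_mul this (by linarith) (by linarith) (by apply div_nonneg <;> linarith)
      _ = 1 := by field_simp [show (1 - x) ≠ 0 by linarith]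
  have key2 : ∀ x : ℝ, x ≤ 3 / (8 * (β + 1)) → Real.exp x ≤ 8 / 7 := by
    intro x hx
    refine (Real.exp_le_exp.2 (hx.trans hb2)).trans ((exp_le_one_div (by norm_num)).trans ?_)
    norm_num
  refine ⟨by linarith, ?_, ?_, key2 _ h2, ?_, key2 _ h3, ?_⟩
  · refine (Real.exp_le_exp.2 (h1.trans hb1)).trans ((exp_le_one_div (by norm_num)).trans ?_)
    norm_num
  · have h4 := key _ h1
    have h5 : 1 / β ≤ 1 / 2 := one_div_le_one_div_of_le (by norm_num) hβ
    have h6 : Real.exp (3 * θ * (c + d)) * (1.6 * (1 - 3 / (8 * β))) ≤ 1.6 := by linarith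
    have h7 := mul_le_mul_of_nonneg_left h6 (by linarith : 0 ≤ 1 - 1 / β)
    have h8 : 3 / (8 * β) = 3 / 8 * (1 / β) := by ring
    rw [h8] at h7 ⊢
    linarith
  · linarith [key _ (h2.trans hb3)]
  · linarith [key _ (h3.trans hb3)]

/-- The largest of the three summands is at least their average. -/
lemma exp_add_add_le (x y w : ℝ) :
    Real.exp (x + y + w) ≤ Real.exp (3 * x) + Real.exp (3 * y) + Real.exp (3 * w) := by
  have hx := Real.exp_pos (3 * x)
  have hy := Real.exp_pos (3 * y)
  have hw := Real.exp_pos (3 * w)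
  rcases le_total x y with h1 | h1 <;> rcases le_total y w with h2 | h2 <;>
    rcases le_total x w with h3 | h3
  · linarith [Real.exp_le_exp.2 (by linarith : x + y + w ≤ 3 * w)]
  · linarith [Real.exp_le_exp.2 (by linarith : x + y + w ≤ 3 * w)]
  · linarith [Real.exp_le_exp.2 (by linarith : x + y + w ≤ 3 * y)]
  · linarith [Real.exp_le_exp.2 (by linarith : x + y + w ≤ 3 * y)]
  · linarith [Real.exp_le_exp.2 (by linarith : x + y + w ≤ 3 * w)]
  · linarith [Real.exp_le_exp.2 (by linarith : x + y + w ≤ 3 * x)]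
  · linarith [Real.exp_le_exp.2 (by linarith : x + y + w ≤ 3 * x)]
  · linarith [Real.exp_le_exp.2 (by linarith : x + y + w ≤ 3 * x)]

open Classical in
lemma exp_sum_boole {V : Type*} (S : Finset V) (P : V → Prop) (θ : ℝ) (w : V → ℝ) :
    Real.exp (θ * ∑ ν ∈ S, (if P ν then 1 else 0) * w ν)
      = ∏ ν ∈ S, (1 + (if P ν then 1 else 0) * (Real.exp (θ * w ν) - 1)) := by
  rw [Finset.mul_sum, Real.exp_sum]
  refine Finset.prod_congr rfl fun ν _ => ?_
  split_ifs <;> simp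

open Classical in
/-- The exponential of a load is bounded by three products: one for the blocks in the subtree, and two
for the two halves of the blocks that leave it by an open exit. -/
lemma exp_load_le {V : Type*} (S : Finset V) {St In Op : V → Prop}
    (hcases : ∀ ν ∈ S, St ν → In ν ∨ Op ν) {w wL wR : V → ℝ} (hw0 : ∀ ν ∈ S, 0 ≤ w ν)
    (hw : ∀ ν ∈ S, w ν ≤ wL ν + wR ν) {θ : ℝ} (hθ : 0 ≤ θ) :
    Real.exp (θ * ∑ ν ∈ S with St ν, w ν) ≤
      ∏ ν ∈ S, (1 + (if Op ν then 1 else 0) * (Real.exp (3 * θ * wL ν) - 1))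
      + ∏ ν ∈ S, (1 + (if Op ν then 1 else 0) * (Real.exp (3 * θ * wR ν) - 1))
      + ∏ ν ∈ S, (1 + (if In ν then 1 else 0) * (Real.exp (3 * θ * w ν) - 1)) := by
  rw [← exp_sum_boole, ← exp_sum_boole, ← exp_sum_boole]
  simp only [mul_assoc 3 θ]
  refine le_trans (Real.exp_le_exp.2 ?_) (exp_add_add_le _ _ _)
  rw [← mul_add, ← mul_add, ← Finset.sum_add_distrib, ← Finset.sum_add_distrib, Finset.sum_filter]
  refine mul_le_mul_of_nonneg_left (Finset.sum_le_sum fun ν hν => ?_) hθ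
  have h1 := hw0 ν hν
  have h2 := hw ν hν
  have h3 := hcases ν hν
  by_cases h4 : In ν <;> by_cases h5 : Op ν <;> by_cases h6 : St ν <;>
    simp only [h4, h5, h6, if_true, if_false] at h3 ⊢ <;> first | linarith | simp at h3

/-- The first three terms of the binomial expansion. -/
lemma choose_le_pow {y : ℝ} (hy : 0 ≤ y) (N : ℕ) :
    1 + N * y + N * (N - 1) / 2 * y ^ 2 ≤ (1 + y) ^ N := by
  induction N with
  | zero => simp
  | succ N ih =>
    have h0 : (0 : ℝ) ≤ N * (N - 1) := by
      rcases N with _ | N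
      · simp
      · push_cast; rw [add_sub_cancel_right]; positivity
    rw [pow_succ]
    have := mul_le_mul_of_nonneg_right ih (by linarith : 0 ≤ 1 + y)
    refine le_trans ?_ this
    push_cast
    have h3 : 0 ≤ (N : ℝ) * (N - 1) / 2 * y ^ 3 := mul_nonneg (by linarith) (by positivity)
    nlinarith

/-! ### Failure for given hashes -/

section Rates
variable (p : VHParams)

/-- The length of an identifier. -/
noncomputable def idLen : ℝ := 2 * p.T + p.γ + 1

/-- The length of a hash and a value. -/
noncomputable def slotLen : ℝ := hashLength p.H p.γ p.lam p.β + p.v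

/-- The rate of the exponential moments, the inverse of eight lengths of a full node. -/
noncomputable def rate : ℝ := 1 / (8 * ((p.β + 1) * idLen p + p.β * slotLen p))

/-- The factor for each item of a node. The load is divided into three parts by `exp_add_add_le`, hence the
threefold rate here and below. -/
noncomputable def itemWeight : ℝ := Real.exp (3 * rate p * (idLen p + slotLen p))

/-- The factor for a node without items. -/
noncomputable def innerWeight : ℝ := Real.exp (3 * rate p * idLen p)

/-- The factor for one half of a node with one item. The most recently accessed hash of the gap may be an
item; it is divided between the two sides. -/
noncomputable def sideWeight : ℝ := Real.exp (1.5 * rate p * (2 * idLen p + slotLen p))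

lemma idLen_pos : 0 < idLen p := by rw [idLen]; positivity

lemma slotLen_nonneg : 0 ≤ slotLen p := by rw [slotLen]; positivity

lemma nodeSize_eq (k : ℕ) : (p.nodeSize k : ℝ) = idLen p + k * (idLen p + slotLen p) := by
  simp only [VHParams.nodeSize, nodeSize, idLen, slotLen]
  push_cast
  ring

lemma rate_pos : 0 < rate p := by
  have := idLen_pos p
  have := slotLen_nonneg p
  rw [rate]; positivity

lemma rate_mul_nodeSize : rate p * p.nodeSize p.β = 1 / 8 := by
  have := idLen_pos p
  have := slotLen_nonneg p
  rw [nodeSize_eq, rate, show idLen p + p.β * (idLen p + slotLen p)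
    = (p.β + 1) * idLen p + p.β * slotLen p by ring]
  field_simp

lemma one_le_itemWeight : 1 ≤ itemWeight p := by
  have := idLen_pos p
  have := slotLen_nonneg p
  have := rate_pos p
  exact Real.one_le_exp (by positivity)

lemma one_le_innerWeight : 1 ≤ innerWeight p := by
  have := idLen_pos p
  have := rate_pos p
  exact Real.one_le_exp (by positivity)

lemma one_le_sideWeight : 1 ≤ sideWeight p := by
  have := idLen_pos p
  have := slotLen_nonneg p
  have := rate_pos p
  exact Real.one_le_exp (by positivity)

end Rates

lemma expect_exit_none_le {p : VHParams} (t : RTree) :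
    (𝔼 s : Fin (2 * p.T + p.γ) → Bool,
      if t.exit ((List.ofFn s).take p.T) = none then (1 : ℝ) else 0) * 2 ^ p.T ≤ t.size := by
  rw [Fintype.expect_eq_sum_div_card, Finset.sum_boole]
  have h := t.card_exit_none_le (T := p.T) (m := 2 * p.T + p.γ) (by omega)
  have h1 : (Fintype.card (Fin (2 * p.T + p.γ) → Bool) : ℝ)
      = 2 ^ (2 * p.T + p.γ - p.T) * 2 ^ p.T := by
    rw [← pow_add, Nat.sub_add_cancel (by omega)]; simp
  rw [h1, div_mul_eq_mul_div, mul_div_mul_right _ _ (by positivity), div_le_iff₀ (by positivity)]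
  exact_mod_cast h

section Failure
variable {p : VHParams} {L : Type*} [DecidableEq L] [Nonempty (Fin p.H → Fin p.β)]
  (a : L → HashVal p) (ops : List (HOp L))

/-- The path of a node stays in the subtree `t`. -/
def StaysInside (t : RTree) (b : HeightCoins p ops) (r : IdCoins p ops) (ν : HNode p) : Prop :=
  t.exit ((List.ofFn (extendFn _ r ((coinTrace a ops b).ptrIdx ops.length ν))).take p.T) = none

/-- The path of a node leaves the subtree `t` by an exit that no path took that was evicted since the
last access to the gap of the node. -/
def LeavesOpen (t : RTree) (b : HeightCoins p ops) (r : IdCoins p ops) (ν : HNode p) : Prop :=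
  ∃ e ∈ openExits (fun s => t.exit ((List.ofFn s).take p.T))
      (fun n : Fin (Trace.numEv p ops.length) =>
        extendFn _ r ((coinTrace a ops b).evAt ops.length n)) t.exits
      (Trace.evCount p ops.length
        ((nodeGap (finalTree a ops b) (opHashes a ops) ν).sup (lastOp a ops)) ν.1),
    t.exit ((List.ofFn (extendFn _ r ((coinTrace a ops b).ptrIdx ops.length ν))).take p.T) = some e

/-- The number of items of a node on one side of the most recently accessed element of its gap. -/
noncomputable def sideItems (pos : HashVal p → ℤ) (b : HeightCoins p ops) (ν : HNode p) : ℕ :=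
  #(leftItems pos (lastOp a ops) (levelSet (finalTree a ops b) ν.1)
    (separators (finalTree a ops b) ν.1) (nodeGap (finalTree a ops b) (opHashes a ops) ν))

open Classical in
/-- The exponential load of the halves of the nodes that leave the subtree `t` by an open exit. -/
noncomputable def sideLoad (pos : HashVal p → ℤ) (t : RTree) (b : HeightCoins p ops)
    (r : IdCoins p ops) : ℝ :=
  ∏ ν ∈ liveNodes (finalTree a ops b), (1 + (if LeavesOpen a ops t b r ν then 1 else 0) *
    (sideWeight p * itemWeight p ^ sideItems a ops pos b ν - 1))

open Classical in
/-- The exponential load of the nodes whose path stays in the subtree `t`. -/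
noncomputable def innerLoad (t : RTree) (b : HeightCoins p ops) (r : IdCoins p ops) : ℝ :=
  ∏ ν ∈ liveNodes (finalTree a ops b), (1 + (if StaysInside a ops t b r ν then 1 else 0) *
    (innerWeight p * itemWeight p ^ #(nodeItems (finalTree a ops b) ν) - 1))

/-- The sum of the three exponential loads of a subtree. -/
noncomputable def totalLoad (t : RTree) (b : HeightCoins p ops) (r : IdCoins p ops) : ℝ :=
  sideLoad a ops hashPos t b r + sideLoad a ops (fun q => -hashPos q) t b r + innerLoad a ops t b r

variable {a ops}

lemma totalLoad_nonneg (t : RTree) (b : HeightCoins p ops) (r : IdCoins p ops) :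
    0 ≤ totalLoad a ops t b r := by
  have h : ∀ w : ℝ, 1 ≤ w → ∀ k : ℕ, 0 ≤ w * itemWeight p ^ k - 1 := fun w hw k =>
    sub_nonneg.2 (one_le_mul_of_one_le_of_one_le hw (one_le_pow₀ (one_le_itemWeight p)))
  have h1 := h _ (one_le_sideWeight p)
  have h2 := h _ (one_le_innerWeight p)
  refine add_nonneg (add_nonneg ?_ ?_) ?_ <;> refine Finset.prod_nonneg fun ν _ => ?_
  · have := h1 (sideItems a ops hashPos b ν)
    split_ifs <;> linarith
  · have := h1 (sideItems a ops (fun q => -hashPos q) b ν)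
    split_ifs <;> linarith
  · have := h2 #(nodeItems (finalTree a ops b) ν)
    split_ifs <;> linarith

lemma finalTree_mem_opHashes (b : HeightCoins p ops) (g : HashVal p)
    (hg : finalTree a ops b g ≠ none) : g ∈ opHashes a ops := by
  refine storedHashes_subset ?_
  by_contra h
  refine hg ((traceOf_D_length a (extendFn _ b) ops g).trans ?_)
  rw [repAfter_of_notMem_stored h]; rfl

open Classical in
/-- The exponential load of the blocks that can have data in the stash or in the subtree. -/
lemma exp_stays_le (t : RTree) (b : HeightCoins p ops) (r : IdCoins p ops) :
    Real.exp (rate p * ∑ ν ∈ liveNodes (finalTree a ops b) with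
      Stays t p.T (extendFn _ r) ((coinTrace a ops b).ptrIdx ops.length ν)
        ((coinTrace a ops b).evSince ops.length (p.H + 1)
          ((coinTrace a ops b).ptrIdx ops.length ν)), (blockSize (finalTree a ops b) ν : ℝ))
      ≤ totalLoad a ops t b r := by
  have hpw : ∀ k : ℕ, itemWeight p ^ k
      = Real.exp (3 * rate p * (k * (idLen p + slotLen p))) := by
    intro k
    rw [itemWeight, ← Real.exp_nat_mul]; congr 1; ring
  have e1 : ∀ k : ℕ, Real.exp (3 * rate p * ((2 * idLen p + slotLen p) / 2
      + k * (idLen p + slotLen p))) = sideWeight p * itemWeight p ^ k := by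
    intro k
    rw [hpw, sideWeight, ← Real.exp_add]; congr 1; ring
  have e2 : ∀ ν, Real.exp (3 * rate p * (blockSize (finalTree a ops b) ν : ℝ))
      = innerWeight p * itemWeight p ^ #(nodeItems (finalTree a ops b) ν) := by
    intro ν
    rw [hpw, innerWeight, ← Real.exp_add, blockSize, nodeSize_eq]; congr 1; ring
  have key := exp_load_le (liveNodes (finalTree a ops b))
    (St := fun ν => Stays t p.T (extendFn _ r) ((coinTrace a ops b).ptrIdx ops.length ν)
      ((coinTrace a ops b).evSince ops.length (p.H + 1)
        ((coinTrace a ops b).ptrIdx ops.length ν)))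
    (In := StaysInside a ops t b r) (Op := LeavesOpen a ops t b r) ?_
    (w := fun ν => (blockSize (finalTree a ops b) ν : ℝ))
    (wL := fun ν => (2 * idLen p + slotLen p) / 2
      + sideItems a ops hashPos b ν * (idLen p + slotLen p))
    (wR := fun ν => (2 * idLen p + slotLen p) / 2
      + sideItems a ops (fun q => -hashPos q) b ν * (idLen p + slotLen p))
    (fun ν _ => Nat.cast_nonneg _) ?_ (rate_pos p).le
  · simp only [e1, e2] at key
    exact key
  · intro ν hν hst
    have hν := mem_liveNodes.1 hν
    by_cases he : StaysInside a ops t b r ν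
    · exact Or.inl he
    · obtain ⟨e, he⟩ := Option.ne_none_iff_exists'.1 he
      refine Or.inr ⟨e, Finset.mem_filter.2 ⟨RTree.exit_mem_exits he, fun i hi => ?_⟩, he⟩
      refine hst e he _ (Trace.evAt_mem_evSince _ (Trace.ptrIdx_clock_le _ _ _) ?_ ?_)
      · rw [Trace.ptrIdx_level]; exact hν.1
      · rw [Trace.ptrIdx_level, ptrIdx_fst_eq_sup _ hν]; exact hi
  · intro ν hν
    have h1 := card_gapItems_le hashPos_injective (lastOp a ops)
      (levelSet (finalTree a ops b) ν.1) (separators (finalTree a ops b) ν.1)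
      (nodeGap (finalTree a ops b) (opHashes a ops) ν)
    rw [← nodeItems_eq_gapItems (finalTree_mem_opHashes b) (mem_liveNodes.1 hν)] at h1
    have h2 : (#(nodeItems (finalTree a ops b) ν) : ℝ) ≤ _ := Nat.cast_le.2 h1
    push_cast at h2
    have := mul_le_mul_of_nonneg_right h2
      (add_nonneg (idLen_pos p).le (slotLen_nonneg p))
    simp only [blockSize, nodeSize_eq, sideItems]
    linarith

open Classical in
/-- Markov's inequality and the union bound over the subtrees. A bucket has the capacity of `20` full nodes,
which gives the factor `exp (-2.5)` for each bucket of the subtree. -/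
lemma overflow_le_sum (sel : SelectionRule) {R : ℕ}
    (hZ : 20 * p.nodeSize p.β ≤ p.Z) (hR : p.γ * p.nodeSize p.β ≤ R)
    (b : HeightCoins p ops) (r : IdCoins p ops) :
    (if StashOverflow R (runOps sel ((a, extendFn _ b, extendFn _ r) : Coins p L) ops) ∧
        ¬ IdCollision (runOps sel ((a, extendFn _ b, extendFn _ r) : Coins p L) ops)
        then (1 : ℝ) else 0)
      ≤ ∑ t ∈ (RTree.all (p.T + 1)).erase RTree.nil, Real.exp (-(p.γ / 8) - 2.5 * t.size) *
        totalLoad a ops t b r := by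
  have hterm : ∀ t : RTree, 0 ≤ Real.exp (-(p.γ / 8) - 2.5 * t.size) * totalLoad a ops t b r :=
    fun t => mul_nonneg (Real.exp_nonneg _) (totalLoad_nonneg t b r)
  split_ifs with h
  · obtain ⟨t, ht, hle⟩ := exists_overloaded_subtree sel a (extendFn _ b) (extendFn _ r) ops R
      (coinTrace a ops b) rfl ops.length rfl h.1 h.2
    refine le_trans ?_ (Finset.single_le_sum (fun t _ => hterm t) ht)
    have hle' : ((R : ℝ) + p.Z * t.size) ≤ ∑ ν ∈ liveNodes (finalTree a ops b) with
        Stays t p.T (extendFn _ r) ((coinTrace a ops b).ptrIdx ops.length ν)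
          ((coinTrace a ops b).evSince ops.length (p.H + 1)
            ((coinTrace a ops b).ptrIdx ops.length ν)),
        (blockSize (finalTree a ops b) ν : ℝ) := by exact_mod_cast hle
    have hR' : (p.γ : ℝ) * p.nodeSize p.β ≤ R := by exact_mod_cast hR
    have hZ' : 20 * (p.nodeSize p.β : ℝ) ≤ (p.Z : ℝ) := by exact_mod_cast hZ
    have hB := rate_mul_nodeSize p
    have hθ0 := (rate_pos p).le
    have h5 : p.γ / 8 + 2.5 * t.size ≤ rate p * ((R : ℝ) + p.Z * t.size) := by
      have h6 := mul_le_mul_of_nonneg_left hR' hθ0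
      have h7 := mul_le_mul_of_nonneg_left
        (mul_le_mul_of_nonneg_right hZ' (Nat.cast_nonneg t.size)) hθ0
      have h8 : rate p * ((p.γ : ℝ) * p.nodeSize p.β) = p.γ / 8 := by
        linear_combination (p.γ : ℝ) * hB
      have h9 : rate p * (20 * p.nodeSize p.β * t.size) = 2.5 * t.size := by
        linear_combination (20 * t.size : ℝ) * hB
      rw [h8] at h6
      rw [h9] at h7
      linarith
    have h10 := Real.exp_le_exp.2 (h5.trans (mul_le_mul_of_nonneg_left hle' hθ0))
    calc (1 : ℝ) = Real.exp (-(p.γ / 8) - 2.5 * t.size) *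
          Real.exp (p.γ / 8 + 2.5 * t.size) := by
          rw [← Real.exp_add, ← Real.exp_zero]; congr 1; ring
      _ ≤ _ := mul_le_mul_of_nonneg_left (h10.trans (exp_stays_le t b r)) (Real.exp_nonneg _)
  · exact Finset.sum_nonneg fun t _ => hterm t

section Expectation
variable (hβ : 2 ≤ p.β) {n : ℕ} (hn : #(labelsAfter ops) ≤ n) (hA : (n : ℝ) ≤ p.β ^ p.H)
  (hH : 2 ^ p.H ≤ 2 * n) (hT : (2 * n + 0.6 * p.H : ℝ) ≤ 2 ^ p.T)
include hβ hn hA hH hT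

open Classical in
/-- The factor `2.5 ^ (|t| + 1)` for the exits of `t` is at most `2.5 * exp |t|`, and the factor for the nodes
inside of `t` is at most `exp |t|` up to a constant, as `2 * n + 0.6 * H ≤ 2 ^ T`. -/
lemma expect_totalLoad_le (t : RTree) :
    (𝔼 b : HeightCoins p ops, 𝔼 r : IdCoins p ops, totalLoad a ops t b r)
      ≤ 9.2 * Real.exp t.size := by
  obtain ⟨g1, z1, gz, al1, al2, aR1, aR2⟩ := moment_constants (β := p.β) (by exact_mod_cast hβ)
    (idLen_pos p) (slotLen_nonneg p) (rfl : rate p = _)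
  have hz1 := one_le_itemWeight p
  have hal1 := one_le_innerWeight p
  have haR1 := one_le_sideWeight p
  rw [← itemWeight] at z1 gz
  rw [← innerWeight] at al1 al2
  rw [← sideWeight] at aR1 aR2
  set g : ℝ := 1.6 * (1 - 3 / (8 * p.β)) with hg
  simp only [totalLoad, Finset.expect_add_distrib]
  have hA' : (#(labelsAfter ops) : ℝ) ≤ p.β ^ p.H := le_trans (by exact_mod_cast hn) hA
  have ha2g : sideWeight p ^ 2 * g ≤ 2.2 := by nlinarith
  set ex : (Fin (2 * p.T + p.γ) → Bool) → Option (List Bool) :=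
    fun s => t.exit ((List.ofFn s).take p.T) with hex
  have e25 : Real.exp (1 / 4) ≤ 4 / 3 := (exp_le_one_div (by norm_num)).trans (by norm_num)
  have hpow : (2.5 : ℝ) ^ #t.exits ≤ 2.5 * Real.exp t.size := by
    refine (pow_le_pow_right₀ (by norm_num) t.card_exits_le).trans ?_
    rw [pow_succ, mul_comm]
    refine mul_le_mul_of_nonneg_left ?_ (by norm_num)
    rw [← mul_one (t.size : ℝ), Real.exp_nat_mul]
    exact pow_le_pow_left₀ (by norm_num) (by linarith [Real.exp_one_gt_d9]) _
  have hside1 : sideWeight p * Real.exp (itemWeight p - 1) * 2.5 ^ #t.exits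
      ≤ 3.82 * Real.exp t.size := by
    have h1 : Real.exp (itemWeight p - 1) ≤ 4 / 3 :=
      (Real.exp_le_exp.2 (by linarith)).trans e25
    have h2 : sideWeight p * Real.exp (itemWeight p - 1) ≤ 8 / 7 * (4 / 3) :=
      mul_le_mul aR1 h1 (Real.exp_nonneg _) (by norm_num)
    have h3 := mul_le_mul h2 hpow (by positivity) (by norm_num)
    linarith [Real.exp_pos (t.size : ℝ)]
  have hside : ∀ pos : HashVal p → ℤ, (pos = hashPos ∨ pos = fun q => -hashPos q) →
      (𝔼 b : HeightCoins p ops, 𝔼 r : IdCoins p ops, sideLoad a ops pos t b r)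
        ≤ 3.82 * Real.exp t.size := by
    intro pos hpos
    have := expect_side_load_le (a := a) (ops := ops) ex t.exits hpos hβ haR1 hz1 g1 gz aR2 ha2g hA'
    refine le_trans (le_of_eq ?_) (this.trans hside1)
    refine Finset.expect_congr rfl fun b _ => Finset.expect_congr rfl fun r _ => ?_
    refine Finset.prod_congr rfl fun ν _ => ?_
    rw [sideItems]
    congr
  have hinner : (𝔼 b : HeightCoins p ops, 𝔼 r : IdCoins p ops, innerLoad a ops t b r)
      ≤ 1.53 * Real.exp t.size := by
    have s3 := expect_inner_load_le (a := a) (ops := ops) (fun s => ex s = none) hβ hal1 hz1 g1 gz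
      al2 hn hA hH rfl
    have hδ0 : 0 ≤ 𝔼 s : Fin (2 * p.T + p.γ) → Bool, if ex s = none then (1 : ℝ) else 0 :=
      Finset.expect_nonneg fun b _ => by split_ifs <;> norm_num
    have hδT : (𝔼 s : Fin (2 * p.T + p.γ) → Bool, if ex s = none then (1 : ℝ) else 0) * 2 ^ p.T
        ≤ t.size := by
      refine le_trans (le_of_eq ?_) (expect_exit_none_le (p := p) t)
      congr
    generalize (𝔼 s : Fin (2 * p.T + p.γ) → Bool, if ex s = none then (1 : ℝ) else 0) = δ at *
    refine le_trans (le_of_eq ?_) (s3.trans ?_)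
    · refine Finset.expect_congr rfl fun b _ => Finset.expect_congr rfl fun r _ => ?_
      refine Finset.prod_congr rfl fun ν _ => ?_
      congr
    have hn0 : (0 : ℝ) ≤ n := Nat.cast_nonneg n
    have h1 : (itemWeight p - 1) * (1 + 2 * n * δ) + δ * (1.5 * n + 0.6 * p.H)
        ≤ 1 / 4 + t.size := by
      have h2 : (itemWeight p - 1) * (1 + 2 * n * δ) ≤ 1 / 4 * (1 + 2 * n * δ) :=
        mul_le_mul_of_nonneg_right (by linarith) (by positivity)
      have h3 := mul_le_mul_of_nonneg_left hT hδ0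
      linarith
    have h2 := Real.exp_le_exp.2 h1
    rw [Real.exp_add (1 / 4)] at h2
    have h3 := mul_le_mul_of_nonneg_right e25 (Real.exp_nonneg (t.size : ℝ))
    have h4 := mul_le_mul al1 (h2.trans h3) (Real.exp_nonneg _) (by norm_num)
    linarith [Real.exp_pos (t.size : ℝ)]
  linarith [Real.exp_pos (t.size : ℝ), hside _ (Or.inl rfl), hside _ (Or.inr rfl), hinner]

open Classical in
/-- The probability that the stash overflows although the identifiers are distinct. -/
theorem expect_overflow_le (sel : SelectionRule) {R : ℕ}
    (hZ : 20 * p.nodeSize p.β ≤ p.Z) (hR : p.γ * p.nodeSize p.β ≤ R) :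
    𝔼 b : HeightCoins p ops, 𝔼 r : IdCoins p ops,
      (if StashOverflow R (runOps sel ((a, extendFn _ b, extendFn _ r) : Coins p L) ops) ∧
        ¬ IdCollision (runOps sel ((a, extendFn _ b, extendFn _ r) : Coins p L) ops)
        then (1 : ℝ) else 0) ≤ 9.2 * Real.exp (-(p.γ / 8)) := by
  -- the union bound needs a factor of at most `1 / 4` for each bucket
  have hx : Real.exp (-1.5) ≤ 1 / 4 := by
    rw [Real.exp_neg, ← one_div]
    refine one_div_le_one_div_of_le (by norm_num) ?_
    rw [show (1.5 : ℝ) = 1 + 0.5 by norm_num, Real.exp_add]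
    nlinarith [Real.exp_one_gt_d9, Real.add_one_le_exp (0.5 : ℝ)]
  have hsum : ∑ t ∈ (RTree.all (p.T + 1)).erase RTree.nil, Real.exp (-1.5) ^ t.size ≤ 1 := by
    have h1 := RTree.sum_all_le (Real.exp_nonneg _) hx (p.T + 1)
    have h2 : RTree.nil ∈ RTree.all (p.T + 1) := Finset.mem_insert_self _ _
    rw [← Finset.add_sum_erase _ _ h2] at h1
    simp only [RTree.size, pow_zero] at h1
    linarith
  calc _ ≤ 𝔼 b : HeightCoins p ops, 𝔼 r : IdCoins p ops,
        ∑ t ∈ (RTree.all (p.T + 1)).erase RTree.nil, Real.exp (-(p.γ / 8) - 2.5 * t.size) *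
        totalLoad a ops t b r :=
        Finset.expect_le_expect fun b _ => Finset.expect_le_expect fun r _ =>
          overflow_le_sum sel hZ hR b r
    _ = ∑ t ∈ (RTree.all (p.T + 1)).erase RTree.nil, Real.exp (-(p.γ / 8) - 2.5 * t.size) *
        𝔼 b : HeightCoins p ops, 𝔼 r : IdCoins p ops, totalLoad a ops t b r := by
        simp only [Finset.expect_sum_comm, Finset.mul_expect]
    _ ≤ ∑ t ∈ (RTree.all (p.T + 1)).erase RTree.nil, 9.2 * Real.exp (-(p.γ / 8)) *
        Real.exp (-1.5) ^ t.size := by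
        refine Finset.sum_le_sum fun t _ => ?_
        refine (mul_le_mul_of_nonneg_left (expect_totalLoad_le hβ hn hA hH hT t)
          (Real.exp_nonneg _)).trans (le_of_eq ?_)
        rw [← Real.exp_nat_mul, mul_left_comm, ← Real.exp_add, mul_assoc, ← Real.exp_add]
        congr 2
        ring
    _ ≤ 9.2 * Real.exp (-(p.γ / 8)) := by
        rw [← Finset.mul_sum]
        exact mul_le_of_le_one_right (by positivity) hsum

open Classical in
/-- The probability that two nodes have the same identifier. The number of pairs of nodes is at most
`(1 + 0.6 * x) ^ N / (0.36 * x ^ 2)` for `N` nodes and `x = 2 ^ (-T)`, and the power is a special case of the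
products over all nodes (with the weights `1.6` for each node and `1` for each item). -/
theorem expect_idCollision_le (sel : SelectionRule) :
    𝔼 b : HeightCoins p ops, 𝔼 r : IdCoins p ops,
      (if IdCollision (runOps sel ((a, extendFn _ b, extendFn _ r) : Coins p L) ops)
        then (1 : ℝ) else 0) ≤ 24.4 * 0.5 ^ p.γ := by
  set K := ops.length with hK
  set x : ℝ := 1 / 2 ^ p.T with hx
  have hx0 : 0 < x := by positivity
  have hx1 : x ≤ 1 := by
    rw [hx, div_le_one (by positivity)]; exact one_le_pow₀ (by norm_num)
  set q : ℝ := 1 / 2 ^ (2 * p.T + p.γ) with hq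
  have hq0 : 0 ≤ q := by positivity
  have hpair : ∀ b : HeightCoins p ops, (𝔼 r : IdCoins p ops,
      (if IdCollision (runOps sel ((a, extendFn _ b, extendFn _ r) : Coins p L) ops)
        then (1 : ℝ) else 0))
      ≤ 2 * q / (0.36 * x ^ 2) * ∏ ν ∈ liveNodes (finalTree a ops b),
        (1 + x * (1.6 * 1 ^ #(nodeItems (finalTree a ops b) ν) - 1)) := by
    intro b
    set S := liveNodes (finalTree a ops b) with hS
    have h1 : ∀ r : IdCoins p ops,
        (if IdCollision (runOps sel ((a, extendFn _ b, extendFn _ r) : Coins p L) ops)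
          then (1 : ℝ) else 0)
        ≤ ∑ x ∈ S.offDiag, if extendFn _ r ((coinTrace a ops b).ptrIdx K x.1)
          = extendFn _ r ((coinTrace a ops b).ptrIdx K x.2) then (1 : ℝ) else 0 := by
      intro r
      have h0 : ∀ x ∈ S.offDiag, (0 : ℝ) ≤ if extendFn _ r ((coinTrace a ops b).ptrIdx K x.1)
          = extendFn _ r ((coinTrace a ops b).ptrIdx K x.2) then (1 : ℝ) else 0 :=
        fun x _ => by split_ifs <;> norm_num
      split_ifs with h
      · obtain ⟨ν, hν, μ, hμ, hne, e⟩ := exists_bits_eq_of_idCollision sel a _ _ ops h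
        have hνμ : (ν, μ) ∈ S.offDiag := Finset.mem_offDiag.2 ⟨hν, hμ, hne⟩
        refine le_trans ?_ (Finset.single_le_sum h0 hνμ)
        rw [if_pos e]
      · exact Finset.sum_nonneg h0
    have hmem : ∀ ν ∈ S, (coinTrace a ops b).ptrIdx K ν ∈ opIndices p K := by
      intro ν hν
      refine mem_opIndices.2 ⟨Trace.ptrIdx_clock_le _ _ _, ?_⟩
      rw [Trace.ptrIdx_level]
      exact (mem_liveNodes.1 hν).1
    have h2 : ∀ y ∈ S.offDiag, (𝔼 r : IdCoins p ops,
        if extendFn _ r ((coinTrace a ops b).ptrIdx K y.1)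
          = extendFn _ r ((coinTrace a ops b).ptrIdx K y.2) then (1 : ℝ) else 0) = q := by
      intro y hy
      obtain ⟨hν, hμ, hne⟩ := Finset.mem_offDiag.1 hy
      have := expect_eq_of_ne (B := Fin (2 * p.T + p.γ) → Bool) (hmem _ hν) (hmem _ hμ)
        fun e => hne (Trace.ptrIdx_injOn _ _ (mem_liveNodes.1 hν) (mem_liveNodes.1 hμ) e)
      rw [hq]
      convert this using 2
      simp
    refine (Finset.expect_le_expect fun r _ => h1 r).trans ?_
    rw [Finset.expect_sum_comm, Finset.sum_congr rfl h2, Finset.sum_const, Finset.offDiag_card,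
      nsmul_eq_mul]
    simp only [one_pow, mul_one, Finset.prod_const]
    have h3 := choose_le_pow (y := x * (1.6 - 1)) (by nlinarith) #S
    have h4 : ((#S * #S - #S : ℕ) : ℝ) = #S * (#S - 1) := by
      rw [Nat.cast_sub (Nat.le_mul_self _)]; push_cast; ring
    have h5 : (#S : ℝ) * (#S - 1) / 2 * (x * (1.6 - 1)) ^ 2 ≤ (1 + x * (1.6 - 1)) ^ #S := by
      have : 0 ≤ (#S : ℝ) * (x * (1.6 - 1)) := mul_nonneg (Nat.cast_nonneg _) (by nlinarith)
      linarith
    rw [h4, div_mul_eq_mul_div, le_div_iff₀ (by positivity)]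
    have h6 := mul_le_mul_of_nonneg_left h5 (by linarith : 0 ≤ 2 * q)
    refine le_trans (le_of_eq ?_) h6
    ring
  refine (Finset.expect_le_expect fun b _ => hpair b).trans ?_
  rw [← Finset.mul_expect]
  have hβ0 : (0 : ℝ) < p.β := by positivity
  have h3 := expect_prod_nodes_le (a := a) (ops := ops) (aw := 1.6) (z := 1) (g := 1) hβ (by norm_num)
    le_rfl le_rfl (by linarith) (by norm_num) hn hA hH hx0.le hx1
  have h4 : (1.6 : ℝ) * Real.exp ((1 - 1) * (1 + 2 * n * x) + x * (1.5 * n + 0.6 * p.H)) ≤ 4.352 := by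
    have h5 : (1 - 1) * (1 + 2 * n * x) + x * (1.5 * n + 0.6 * p.H) ≤ 1 := by
      have h6 : x * (2 * n + 0.6 * p.H) ≤ 1 := by
        rw [hx, one_div, ← div_eq_inv_mul, div_le_one (by positivity)]; exact hT
      have : (0 : ℝ) ≤ x * n := by positivity
      linarith
    have := (Real.exp_le_exp.2 h5).trans Real.exp_one_lt_d9.le
    linarith
  refine (mul_le_mul_of_nonneg_left (h3.trans h4) (by positivity)).trans ?_
  have e : q / x ^ 2 = 0.5 ^ p.γ := by
    rw [hq, hx, pow_add, pow_mul', show (0.5 : ℝ) = 1 / 2 by norm_num, div_pow, div_pow, one_pow,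
      one_pow]
    field_simp
  have e2 : 2 * q / (0.36 * x ^ 2) * 4.352 = 2 * 4.352 / 0.36 * (q / x ^ 2) := by
    field_simp
  rw [e2, e]
  exact mul_le_mul_of_nonneg_right (by norm_num) (by positivity)

end Expectation
end Failure

/-! ### The random choices that matter -/

section Congr
variable {p : VHParams} {L : Type*}

lemma applyHirb_congr_label {ω ω' : Coins p L} {op : HOp L} (h1 : ω.1 op.label = ω'.1 op.label)
    (h2 : ω.2.1 op.label = ω'.2.1 op.label) (D : Hirb p) :
    op.applyHirb ω D = op.applyHirb ω' D := by
  cases op with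
  | insert x =>
    have e1 : ω.hash x = ω'.hash x := h1
    have e2 : ω.chooseHeight x = ω'.chooseHeight x := congrArg heightOfCoins h2
    simp only [HOp.applyHirb, e1, e2]
  | remove x => exact congrArg (fun g => Function.update D g none) h1
  | update x => rfl

lemma initState_congr (sel : SelectionRule) {ω ω' : Coins p L}
    (h3 : ∀ l ≤ p.H, ∀ c, ω.2.2 (0, l, c) = ω'.2.2 (0, l, c)) :
    initState sel ω = initState sel ω' := by
  simp only [initState, VHState.mk.injEq, true_and]
  refine List.foldl_ext _ _ _ fun s l hl => ?_
  have hl' : l ≤ p.H := Nat.lt_succ_iff.1 (List.mem_range.1 hl)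
  simp only [initStep, Coins.idgen, h3 l hl']

lemma execOp_congr (sel : SelectionRule) {ω ω' : Coins p L} {s : VHState p} {op : HOp L}
    (h1 : ω.1 op.label = ω'.1 op.label) (h2 : ω.2.1 op.label = ω'.2.1 op.label)
    (h3 : ∀ l ≤ p.H, ∀ c, ω.2.2 (s.clock + 1, l, c) = ω'.2.2 (s.clock + 1, l, c)) :
    execOp sel ω s op = execOp sel ω' s op := by
  simp only [execOp, VHState.mk.injEq, true_and]
  refine ⟨applyHirb_congr_label h1 h2 _, List.foldl_ext _ _ _ fun st l hl => ?_⟩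
  have hl' : l ≤ p.H := Nat.lt_succ_iff.1 (List.mem_range.1 (List.mem_reverse.1 hl))
  simp only [Coins.idgen, Coins.hash, h1, h3 l hl', applyHirb_congr_label h1 h2]

lemma runOps_clock (sel : SelectionRule) (ω : Coins p L) (ops : List (HOp L)) :
    (runOps sel ω ops).clock = ops.length := by
  induction ops using List.reverseRecOn with
  | nil => rfl
  | append_singleton l op ih =>
    simp only [runOps, List.foldl_append, List.foldl_cons, List.foldl_nil, execOp] at ih ⊢
    rw [ih, List.length_append, List.length_singleton]

variable [DecidableEq L]

lemma runOps_congr (sel : SelectionRule) {ω ω' : Coins p L} {ops : List (HOp L)}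
    (h1 : ∀ x ∈ opLabels ops, ω.1 x = ω'.1 x) (h2 : ∀ x ∈ opLabels ops, ω.2.1 x = ω'.2.1 x)
    (h3 : ∀ i ∈ opIndices p ops.length, ω.2.2 i = ω'.2.2 i) :
    runOps sel ω ops = runOps sel ω' ops := by
  induction ops using List.reverseRecOn with
  | nil => exact initState_congr sel fun l hl c => h3 _ (mem_opIndices.2 ⟨le_rfl, hl⟩)
  | append_singleton l op ih =>
    have hl : ∀ x ∈ opLabels l, x ∈ opLabels (l ++ [op]) := by
      intro x hx
      obtain ⟨o, ho, rfl⟩ := mem_opLabels.1 hx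
      exact mem_opLabels.2 ⟨o, List.mem_append_left _ ho, rfl⟩
    have hop : op.label ∈ opLabels (l ++ [op]) := mem_opLabels.2 ⟨op, by simp, rfl⟩
    have hlen : (l ++ [op]).length = l.length + 1 := by simp
    have e := ih (fun x hx => h1 x (hl x hx)) (fun x hx => h2 x (hl x hx)) fun i hi =>
      h3 i (mem_opIndices.2 ⟨by rw [hlen]; exact (mem_opIndices.1 hi).1.trans (Nat.le_succ _),
        (mem_opIndices.1 hi).2⟩)
    have e' : ∀ ω : Coins p L, runOps sel ω (l ++ [op]) = execOp sel ω (runOps sel ω l) op :=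
      fun ω => by simp only [runOps, List.foldl_append, List.foldl_cons, List.foldl_nil]
    rw [e', e', e]
    refine execOp_congr sel (h1 _ hop) (h2 _ hop) fun k hk c => h3 _ (mem_opIndices.2 ⟨?_, hk⟩)
    rw [runOps_clock, hlen]

lemma labelsAfter_subset (ops : List (HOp L)) : labelsAfter ops ⊆ opLabels ops := by
  induction ops using List.reverseRecOn with
  | nil => simp [labelsAfter]
  | append_singleton l op ih =>
    have e : labelsAfter (l ++ [op]) = HOp.applyLabels (labelsAfter l) op := by
      simp [labelsAfter]
    have e2 : opLabels (l ++ [op]) = opLabels l ∪ {op.label} := by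
      ext x
      simp [opLabels]
    rw [e, e2]
    intro x hx
    cases op with
    | insert y =>
      rcases Finset.mem_insert.1 hx with rfl | hx
      · simp [HOp.label]
      · exact Finset.mem_union_left _ (ih hx)
    | remove y => exact Finset.mem_union_left _ (ih (Finset.mem_of_mem_erase hx))
    | update y => exact Finset.mem_union_left _ (ih hx)

/-- The failure event depends only on the coins of the labels that occur and on the identifiers
that can be used. -/
lemma mem_failureEvent_congr (sel : SelectionRule) (R : ℕ) {ω ω' : Coins p L} {ops : List (HOp L)}
    (h1 : ∀ x ∈ opLabels ops, ω.1 x = ω'.1 x) (h2 : ∀ x ∈ opLabels ops, ω.2.1 x = ω'.2.1 x)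
    (h3 : ∀ i ∈ opIndices p ops.length, ω.2.2 i = ω'.2.2 i) :
    ω ∈ failureEvent sel R ops ↔ ω' ∈ failureEvent sel R ops := by
  have e : HashCollision ω (labelsAfter ops) ↔ HashCollision ω' (labelsAfter ops) := by
    refine exists_congr fun x => and_congr_right fun hx => exists_congr fun y =>
      and_congr_right fun hy => ?_
    rw [Coins.hash, Coins.hash, Coins.hash, Coins.hash, h1 x (labelsAfter_subset ops hx),
      h1 y (labelsAfter_subset ops hy)]
  simp only [failureEvent, Set.mem_ofPred_eq, runOps_congr sel h1 h2 h3, e]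

end Congr

section Measure
open MeasureTheory ProbabilityTheory

section Uniform
variable {ι B C : Type*} [Fintype B] [Nonempty B] [MeasurableSpace B] [MeasurableSingletonClass B]
  [Fintype C] [Nonempty C] [MeasurableSpace C] [MeasurableSingletonClass C]

omit [Nonempty B] in
open Classical in
lemma uniformOn_univ_real (s : Set B) :
    (uniformOn (Set.univ : Set B)).real s = 𝔼 x, if x ∈ s then (1 : ℝ) else 0 := by
  rw [Measure.real, uniformOn_univ, Fintype.expect_eq_sum_div_card, Finset.sum_boole,
    ENNReal.toReal_div, ENNReal.toReal_natCast, Measure.count_apply_finite _ s.toFinite]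
  congr 2
  rw [ENNReal.toReal_natCast]
  congr 2
  ext; simp

lemma uniformOn_univ_prod : (uniformOn (Set.univ : Set B)).prod (uniformOn (Set.univ : Set C))
    = uniformOn (Set.univ : Set (B × C)) := by
  refine Measure.ext_of_singleton fun x => ?_
  rw [← Set.singleton_prod_singleton, Measure.prod_prod]
  simp only [uniformOn_univ, Set.singleton_prod_singleton, Measure.count_singleton,
    Fintype.card_prod, Nat.cast_mul, one_div]
  rw [ENNReal.mul_inv] <;> simp

/-- Finitely many coordinates of a family of independent uniform choices are uniform. -/
lemma infinitePi_uniformOn_map_restrict [DecidableEq ι] (J : Finset ι) :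
    (Measure.infinitePi fun _ : ι => uniformOn (Set.univ : Set B)).map J.restrict
      = uniformOn (Set.univ : Set (J → B)) := by
  rw [Measure.infinitePi_map_restrict]
  refine Measure.ext_of_singleton fun x => ?_
  rw [Measure.pi_singleton]
  simp only [uniformOn_univ, Measure.count_singleton, Finset.prod_const, Fintype.card_fun,
    Finset.card_univ, Nat.cast_pow, one_div, ENNReal.inv_pow]

open Classical in
/-- The probability of an event that depends on finitely many uniform choices is an average. -/
lemma prod_infinitePi_real {κ ι' D : Type*} [DecidableEq ι] [DecidableEq κ] [DecidableEq ι']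
    [Fintype D] [Nonempty D] [MeasurableSpace D] [MeasurableSingletonClass D] (J : Finset ι)
    (J' : Finset κ) (J'' : Finset ι') (E : Set ((J → B) × (J' → C) × (J'' → D))) :
    ((Measure.infinitePi fun _ : ι => uniformOn (Set.univ : Set B)).prod
      ((Measure.infinitePi fun _ : κ => uniformOn (Set.univ : Set C)).prod
        (Measure.infinitePi fun _ : ι' => uniformOn (Set.univ : Set D)))).real
      {ω | (J.restrict ω.1, J'.restrict ω.2.1, J''.restrict ω.2.2) ∈ E}
    = 𝔼 a : J → B, 𝔼 b : J' → C, 𝔼 c : J'' → D, if (a, b, c) ∈ E then (1 : ℝ) else 0 := by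
  have h1 : Measurable (J.restrict (π := fun _ => B)) := Finset.measurable_restrict J
  have h2 : Measurable (J'.restrict (π := fun _ => C)) := Finset.measurable_restrict J'
  have h3 : Measurable (J''.restrict (π := fun _ => D)) := Finset.measurable_restrict J''
  have hρ := h1.prodMap (h2.prodMap h3)
  have hset : {ω : (ι → B) × (κ → C) × (ι' → D) |
      (J.restrict ω.1, J'.restrict ω.2.1, J''.restrict ω.2.2) ∈ E}
      = Prod.map J.restrict (Prod.map J'.restrict J''.restrict) ⁻¹' E := rfl
  rw [hset, ← map_measureReal_apply hρ E.toFinite.measurableSet,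
    ← Measure.map_prod_map _ _ h1 (h2.prodMap h3), ← Measure.map_prod_map _ _ h2 h3,
    infinitePi_uniformOn_map_restrict, infinitePi_uniformOn_map_restrict,
    infinitePi_uniformOn_map_restrict, uniformOn_univ_prod, uniformOn_univ_prod,
    uniformOn_univ_real, expect_univ_prod]
  simp only [expect_univ_prod]

end Uniform

variable {p : VHParams} {L : Type*} [DecidableEq L] [Nonempty (HashVal p)]
  [Nonempty (Fin p.H → Fin p.β)]

open Classical in
/-- The failure probability is an average over finitely many choices. -/
theorem coinsMeasure_real_failureEvent (sel : SelectionRule) (R : ℕ) (ops : List (HOp L)) :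
    (coinsMeasure p L).real (failureEvent sel R ops)
      = 𝔼 a : opLabels ops → HashVal p, 𝔼 b : HeightCoins p ops, 𝔼 r : IdCoins p ops,
        if ((extendFn _ a, extendFn _ b, extendFn _ r) : Coins p L) ∈ failureEvent sel R ops
          then (1 : ℝ) else 0 := by
  let E : Set ((opLabels ops → HashVal p) × HeightCoins p ops × IdCoins p ops) :=
    {x | ((extendFn _ x.1, extendFn _ x.2.1, extendFn _ x.2.2) : Coins p L)
      ∈ failureEvent sel R ops}
  have hE : failureEvent sel R ops = {ω : Coins p L |
      ((opLabels ops).restrict ω.1, (opLabels ops).restrict ω.2.1,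
        (opIndices p ops.length).restrict ω.2.2) ∈ E} := by
    ext ω
    refine mem_failureEvent_congr sel R ?_ ?_ ?_
    · intro x hx
      exact (extendFn_of_mem ((opLabels ops).restrict ω.1) hx).symm
    · intro x hx
      exact (extendFn_of_mem ((opLabels ops).restrict ω.2.1) hx).symm
    · intro x hx
      exact (extendFn_of_mem ((opIndices p ops.length).restrict ω.2.2) hx).symm
  refine (congrArg (coinsMeasure p L).real hE).trans ?_
  refine (prod_infinitePi_real (B := HashVal p) (C := Fin p.H → Fin p.β)
    (D := Fin (2 * p.T + p.γ) → Bool) (opLabels ops) (opLabels ops)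
    (opIndices p ops.length) E).trans ?_
  refine Finset.expect_congr rfl fun a _ => Finset.expect_congr rfl fun b _ =>
    Finset.expect_congr rfl fun r _ => ?_
  exact if_congr Iff.rfl rfl rfl

omit [Nonempty (Fin p.H → Fin p.β)] in
open Classical in
/-- A given pair of labels has the same hash with probability at most `β ^ (-2 * H) * 2 ^ (-γ)`,
and there are at most `n ^ 2 ≤ β ^ (2 * H)` pairs. The other coins may depend on the hashes. -/
lemma expect_hashCollision_le {n : ℕ} (ops : List (HOp L)) (hβ : 2 ≤ p.β)
    (hn : #(labelsAfter ops) ≤ n) (hA : (n : ℝ) ≤ p.β ^ p.H)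
    (f : (opLabels ops → HashVal p) → (L → Fin p.H → Fin p.β) ×
      (ℕ × ℕ × Fin 3 → Fin (2 * p.T + p.γ) → Bool)) :
    𝔼 a : opLabels ops → HashVal p,
      (if HashCollision ((extendFn _ a, f a) : Coins p L) (labelsAfter ops) then (1 : ℝ) else 0)
      ≤ 0.5 ^ p.γ := by
  set S := labelsAfter ops with hS
  set h := hashLength p.H p.γ p.lam p.β with hh
  have h1 : ∀ a : opLabels ops → HashVal p,
      (if HashCollision ((extendFn _ a, f a) : Coins p L) S then (1 : ℝ) else 0)
      ≤ ∑ x ∈ S.offDiag, if extendFn _ a x.1 = extendFn _ a x.2 then (1 : ℝ) else 0 := by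
    intro a
    have h0 : ∀ x ∈ S.offDiag, (0 : ℝ) ≤ if extendFn _ a x.1 = extendFn _ a x.2 then 1 else 0 :=
      fun x _ => by split_ifs <;> norm_num
    split_ifs with hc
    · obtain ⟨x, hx, y, hy, hne, e⟩ := hc
      have hxy : (x, y) ∈ S.offDiag := Finset.mem_offDiag.2 ⟨hx, hy, hne⟩
      refine le_trans ?_ (Finset.single_le_sum h0 hxy)
      exact (if_pos e).ge
    · exact Finset.sum_nonneg h0
  have h2 : ∀ y ∈ S.offDiag, (𝔼 a : opLabels ops → HashVal p,
      if extendFn _ a y.1 = extendFn _ a y.2 then (1 : ℝ) else 0) = 1 / 2 ^ h := by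
    intro y hy
    obtain ⟨hx, hy, hne⟩ := Finset.mem_offDiag.1 hy
    have := expect_eq_of_ne (B := HashVal p) (labelsAfter_subset ops hx)
      (labelsAfter_subset ops hy) hne
    convert this using 2
    simp [hh]
  refine (Finset.expect_le_expect fun a _ => h1 a).trans ?_
  rw [Finset.expect_sum_comm, Finset.sum_congr rfl h2, Finset.sum_const, Finset.offDiag_card,
    nsmul_eq_mul]
  have h3 : ((#S * #S - #S : ℕ) : ℝ) ≤ (p.β : ℝ) ^ (2 * p.H) := by
    calc ((#S * #S - #S : ℕ) : ℝ) ≤ ((n * n : ℕ) : ℝ) :=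
          Nat.cast_le.2 ((Nat.sub_le _ _).trans (Nat.mul_le_mul hn hn))
      _ = (n : ℝ) * n := by push_cast; ring
      _ ≤ p.β ^ p.H * p.β ^ p.H := mul_le_mul hA hA (Nat.cast_nonneg n) (by positivity)
      _ = _ := by ring
  have h4 : (p.β : ℝ) ^ (2 * p.H) * 2 ^ p.γ ≤ 2 ^ h := by
    have hb : (0 : ℝ) < p.β := by positivity
    have h5 : (p.β : ℝ) ^ (2 * p.H) ≤ 2 ^ ⌈2 * (p.H : ℝ) * Real.logb 2 (p.β : ℝ)⌉₊ := by
      have e1 := Nat.le_ceil (2 * (p.H : ℝ) * Real.logb 2 (p.β : ℝ))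
      have e2 : Real.logb 2 ((p.β : ℝ) ^ (2 * p.H)) = 2 * (p.H : ℝ) * Real.logb 2 (p.β : ℝ) := by
        rw [Real.logb_pow]; push_cast; ring
      rw [← e2, Real.logb_le_iff_le_rpow (by norm_num) (by positivity), Real.rpow_natCast] at e1
      rwa [e2] at e1
    calc (p.β : ℝ) ^ (2 * p.H) * 2 ^ p.γ
        ≤ 2 ^ ⌈2 * (p.H : ℝ) * Real.logb 2 (p.β : ℝ)⌉₊ * 2 ^ p.γ :=
          mul_le_mul_of_nonneg_right h5 (by positivity)
      _ = 2 ^ (⌈2 * (p.H : ℝ) * Real.logb 2 (p.β : ℝ)⌉₊ + p.γ) := (pow_add _ _ _).symm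
      _ ≤ 2 ^ h := pow_le_pow_right₀ (by norm_num) (le_max_left _ _)
  rw [mul_one_div, div_le_iff₀ (by positivity)]
  have h6 : (0.5 : ℝ) ^ p.γ * 2 ^ p.γ = 1 := by rw [← mul_pow]; norm_num
  calc ((#S * #S - #S : ℕ) : ℝ) ≤ (p.β : ℝ) ^ (2 * p.H) := h3
    _ = 0.5 ^ p.γ * ((p.β : ℝ) ^ (2 * p.H) * 2 ^ p.γ) := by rw [mul_left_comm, h6, mul_one]
    _ ≤ _ := mul_le_mul_of_nonneg_left h4 (by positivity)

end Measure

/-! ### The failure probability -/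

lemma boole_or_le {F P Q S : Prop} [Decidable F] [Decidable (P ∧ ¬ Q)] [Decidable Q] [Decidable S]
    (h : F ↔ P ∨ Q ∨ S) : (if F then (1 : ℝ) else 0)
      ≤ (if P ∧ ¬ Q then 1 else 0) + (if Q then 1 else 0) + if S then 1 else 0 := by
  split_ifs <;> first | (exfalso; tauto) | norm_num

/-- The base comes from `exp (-1 / 8) ≤ 0.883`. -/
lemma sum_failure_bounds_le {γ : ℕ} (hγ : 0 < γ) :
    9.2 * Real.exp (-((γ : ℝ) / 8)) + 24.4 * 0.5 ^ γ + 0.5 ^ γ ≤ 30 * 0.883 ^ γ := by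
  have h1 : Real.exp (-((γ : ℝ) / 8)) ≤ 0.883 ^ γ := by
    rw [show -((γ : ℝ) / 8) = γ * (-(1 / 8)) by ring, Real.exp_nat_mul]
    refine pow_le_pow_left₀ (Real.exp_nonneg _) ?_ _
    have h := Real.sum_le_exp_of_nonneg (x := 1 / 8) (by norm_num) 4
    norm_num [Finset.sum_range_succ, Nat.factorial] at h
    rw [Real.exp_neg, inv_le_comm₀ (Real.exp_pos _) (by norm_num)]
    refine le_trans ?_ (le_trans h (le_of_eq ?_)) <;> norm_num
  have h2 : (0.5 : ℝ) ^ γ ≤ 0.6 * 0.883 ^ γ := by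
    obtain ⟨k, rfl⟩ := Nat.exists_eq_succ_of_ne_zero hγ.ne'
    rw [pow_succ, pow_succ]
    have := pow_le_pow_left₀ (by norm_num) (by norm_num : (0.5 : ℝ) ≤ 0.883) k
    have : (0 : ℝ) ≤ 0.883 ^ k := by positivity
    linarith
  have : (0 : ℝ) ≤ 0.883 ^ γ := by positivity
  linarith

theorem mainTheorem2 {L : Type*} [DecidableEq L] (p : VHParams) (n R : ℕ)
    (hn : 1 ≤ n) (hγ : 0 < p.γ)
    (hT : Real.logb 2 (4 * (n : ℝ) + Real.logb 2 (n : ℝ) + (p.γ : ℝ)) ≤ (p.T : ℝ))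
    (hβ : IsGreatest {b : ℕ | 1 ≤ b ∧ 20 * nodeSize p.T p.H p.γ p.lam p.v b b ≤ p.Z} p.β)
    (hβ2 : 2 ≤ p.β)
    (hR : p.γ * nodeSize p.T p.H p.γ p.lam p.v p.β p.β ≤ R)
    (hH : Real.logb (p.β : ℝ) (n : ℝ) ≤ (p.H : ℝ))
    (hH' : p.H ≤ ⌈Real.logb 2 (n : ℝ)⌉₊)
    (sel : SelectionRule) (ops : List (HOp L)) (hops : (labelsAfter ops).card ≤ n) :
    (coinsMeasure p L).real (failureEvent sel R ops) ≤ 30 * (0.883 : ℝ) ^ p.γ := by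
  classical
  have hn1 : (1 : ℝ) ≤ n := by exact_mod_cast hn
  have hn0 : (0 : ℝ) < n := by linarith
  have hβ1 : (1 : ℝ) < p.β := by exact_mod_cast hβ2
  have hlg : 0 ≤ Real.logb 2 (n : ℝ) := Real.logb_nonneg (by norm_num) hn1
  have hγ0 : (0 : ℝ) < p.γ := by exact_mod_cast hγ
  have : Nonempty (HashVal p) := ⟨⟨0, by positivity⟩⟩
  have : Nonempty (Fin p.H → Fin p.β) := ⟨fun _ => ⟨0, by omega⟩⟩
  have hA : (n : ℝ) ≤ p.β ^ p.H := by
    rwa [Real.logb_le_iff_le_rpow hβ1 hn0, Real.rpow_natCast] at hH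
  have hHlt : (p.H : ℝ) < Real.logb 2 (n : ℝ) + 1 :=
    (Nat.cast_le.2 hH').trans_lt (Nat.ceil_lt_add_one hlg)
  have hH2 : 2 ^ p.H ≤ 2 * n := by
    have h1 : (p.H : ℝ) ≤ Real.logb 2 (n * 2 : ℝ) := by
      rw [Real.logb_mul hn0.ne' (by norm_num), Real.logb_self_eq_one (by norm_num)]
      exact hHlt.le
    rw [Real.le_logb_iff_rpow_le (by norm_num) (by positivity), Real.rpow_natCast] at h1
    rw [mul_comm]
    exact_mod_cast h1
  have hT2 : (2 * n + 0.6 * p.H : ℝ) ≤ 2 ^ p.T := by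
    rw [Real.logb_le_iff_le_rpow (by norm_num) (by positivity), Real.rpow_natCast] at hT
    linarith
  have hbound : ∀ (a : opLabels ops → HashVal p) (b : HeightCoins p ops) (r : IdCoins p ops),
      (if ((extendFn _ a, extendFn _ b, extendFn _ r) : Coins p L) ∈ failureEvent sel R ops
        then (1 : ℝ) else 0)
      ≤ (if StashOverflow R (runOps sel ((extendFn _ a, extendFn _ b, extendFn _ r) : Coins p L) ops)
          ∧ ¬ IdCollision (runOps sel ((extendFn _ a, extendFn _ b, extendFn _ r) : Coins p L) ops)
          then (1 : ℝ) else 0)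
        + (if IdCollision (runOps sel ((extendFn _ a, extendFn _ b, extendFn _ r) : Coins p L) ops)
          then (1 : ℝ) else 0)
        + (if HashCollision ((extendFn _ a, extendFn _ b, extendFn _ r) : Coins p L)
          (labelsAfter ops) then (1 : ℝ) else 0) := by
    intro a b r
    exact boole_or_le Iff.rfl
  rw [coinsMeasure_real_failureEvent]
  refine (Finset.expect_le_expect fun a _ => Finset.expect_le_expect fun b _ =>
    Finset.expect_le_expect fun r _ => hbound a b r).trans ?_
  simp only [Finset.expect_add_distrib]
  refine le_trans (add_le_add (add_le_add ?_ ?_) ?_) (sum_failure_bounds_le hγ)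
  · refine (Finset.expect_le_expect fun a _ => expect_overflow_le (a := extendFn _ a) (ops := ops)
      hβ2 hops hA hH2 hT2 sel hβ.1.2 hR).trans ?_
    rw [Fintype.expect_const]
  · refine (Finset.expect_le_expect fun a _ => expect_idCollision_le (a := extendFn _ a) (ops := ops)
      hβ2 hops hA hH2 hT2 sel).trans ?_
    rw [Fintype.expect_const]
  · let f : (L → Fin p.H → Fin p.β) × (ℕ × ℕ × Fin 3 → Fin (2 * p.T + p.γ) → Bool) :=
      Classical.arbitrary _
    refine le_trans (le_of_eq ?_) (expect_hashCollision_le ops hβ2 hops hA fun _ => f)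
    refine Finset.expect_congr rfl fun a _ => ?_
    have e : ∀ (b : HeightCoins p ops) (r : IdCoins p ops),
        (if HashCollision ((extendFn _ a, extendFn _ b, extendFn _ r) : Coins p L)
          (labelsAfter ops) then (1 : ℝ) else 0)
        = if HashCollision ((extendFn _ a, f) : Coins p L) (labelsAfter ops) then 1 else 0 :=
      fun _ _ => if_congr Iff.rfl rfl rfl
    simp only [e, Fintype.expect_const]
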